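/- Theorem 5.1 (Two moment theorem for flat polynomials, complex case). Conventions. A complex random variable $\xi$ of mean zero and variance one satisfies $\mathbb E\,\xi=0$ and $\mathbb E|\xi|^2=1$. For $n\ge 1$, the flat (Weyl) polynomial with atom distribution $\xi$ is $f_{n,\xi}(z)=\sum_{i=0}^n \frac{1}{\sqrt{i!}}\,\xi_i z^i$, where $\xi_0,\dots,\xi_n$ are jointly independent copies of $\xi$. Two complex random variables $\xi,\tilde\xi$ match moments to second order if $\mathbb E\,\mathrm{Re}(\xi)^a\,\mathrm{Im}(\xi)^b=\mathbb E\,\mathrm{Re}(\tilde\xi)^a\,\mathrm{Im}(\tilde\xi)^b$ for all integers $a,b\ge 0$ with $a+b\le 2$. The $k$-point correlation function $\rho^{(k)}_f$ of a random polynomial $f$ of degree at most $n$ is understood as the measure on $\mathbb C^k$ such that $$\mathbb E\sum_{i_1,\dots,i_k\text{ distinct}}\varphi(\zeta_{i_1},\dots,\zeta_{i_k})=\int_{\mathbb C^k}\varphi(z_1,\dots,z_k)\,\rho^{(k)}_f(z_1,\dots,z_k)\,dz_1\cdots dz_k$$ for all continuous compactly supported $\varphi:\mathbb C^k\to\mathbb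 C$, where $(\zeta_i)$ are the zeroes of $f$ in $\mathbb C$ listed with multiplicity (only the indices have to be distinct; the zero polynomial is regarded as having no zeroes in $\mathbb C$). For smooth $G:\mathbb C^k\to\mathbb C$, $|\nabla^a G(w)|$ is the Euclidean norm of the tensor of all partial derivatives of order $a$ of $G$ at $w$ in the $2k$ real coordinates of $\mathbb C^k\cong\mathbb R^{2k}$, and $B(0,C)=\{w\in\mathbb C:|w|<C\}$. Statement. For every $\varepsilon>0$ there is $c_0>0$ depending only on $\varepsilon$ such that for every integer $k\ge 1$ and every $C>0$ there is a constant $\tilde C$ depending only on $k,\varepsilon,C$ with the following property. Let $n\ge 1$, and let $f_{n,\xi},f_{n,\tilde\xi}$ be flat polynomials whose atom distributions $\xi,\tilde\xi$ are complex random variables of mean zero and variance one that match moments to second order and satisfy $\mathbb E|\xi|^{2+\varepsilon},\ \mathbb E|\tilde\xi|^{2+\varepsilon}\le C$. Let $z_1,\dots,z_k\in\mathbb C$ (possibly depending on $n$) satisfy $n^{\varepsilon}\le|z_i|\le\sqrt n+C$ for all $i=1,\dots,k$. Let $G:\mathbb C^k\to\mathbb C$ be a smooth function supported on the polydisc $B(0,C)^k$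 such that $|\nabla^aG(w)|\le C$ for all $0\le a\le 5k+1$ and all $w\in\mathbb C^k$. Then $$\Big|\int_{\mathbb C^k}G(w)\,\rho^{(k)}_{f_{n,\xi}}(z_1+w_1,\dots,z_k+w_k)\,dw_1\cdots dw_k-\int_{\mathbb C^k}G(w)\,\rho^{(k)}_{f_{n,\tilde\xi}}(z_1+w_1,\dots,z_k+w_k)\,dw_1\cdots dw_k\Big|\le\tilde C\,n^{-c_0}.$$ -/

import Mathlib

open MeasureTheory ProbabilityTheory
open scoped ENNReal

noncomputable section

/-- The polynomial `f(z) = ∑_{i=0}^n c_i ξ_i z^i`. -/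
def coeffPolynomial {n : ℕ} (c ξ : Fin (n + 1) → ℂ) : Polynomial ℂ :=
  ∑ i : Fin (n + 1), Polynomial.C (c i * ξ i) * Polynomial.X ^ (i : ℕ)

/-- The coefficients `c_i = 1 / √(i!)` of flat (Weyl) polynomials of degree parameter `n`. -/
def flatCoeff (n : ℕ) (i : Fin (n + 1)) : ℂ :=
  ((1 / Real.sqrt ((i : ℕ).factorial : ℝ) : ℝ) : ℂ)

/-- The flat polynomial `∑_{i=0}^n ξ_i z^i / √(i!)`. -/
def flatPolynomial (n : ℕ) (ξ : Fin (n + 1) → ℂ) : Polynomial ℂ :=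
  coeffPolynomial (flatCoeff n) ξ

/-- The counting measure on `ℂ^k` of the `k`-tuples `(ζ_{i_1}, …, ζ_{i_k})` of finite zeroes of `p`
with distinct indices `i_1, …, i_k`. Zeroes are listed with multiplicity (the type of indices is
the multiset of roots, in which a zero of multiplicity `m` has `m` different indices), so the zeroes
in a tuple may coincide. The zero polynomial has no zeroes in `ℂ` (`Polynomial.roots 0 = 0`). -/
def zeroTupleMeasure (k : ℕ) (p : Polynomial ℂ) : Measure (Fin k → ℂ) :=
  ∑ s : Fin k ↪ p.roots.ToType, Measure.dirac (fun j => (s j).1)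

/-- The `k`-point correlation measure `ρ^{(k)}` of the zeroes of a random polynomial `f` on a
probability space `(Ω, P)`: the mean of the random measure `zeroTupleMeasure k (f ω)`. It satisfies
`E ∑_{i_1, …, i_k distinct} φ(ζ_{i_1}, …, ζ_{i_k}) = ∫ φ dρ^{(k)}` for all continuous compactly
supported `φ`, see `integral_correlationMeasure`. -/
def correlationMeasure {Ω : Type*} [MeasurableSpace Ω] (P : Measure Ω) (k : ℕ)
    (f : Ω → Polynomial ℂ) : Measure (Fin k → ℂ) :=
  P.bind (fun ω => zeroTupleMeasure k (f ω))

/-- `μ` is the law of a complex random variable of mean zero and variance one. -/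
structure IsNormalizedAtom (μ : Measure ℂ) : Prop where
  isProbabilityMeasure : IsProbabilityMeasure μ
  memLp : MemLp (fun x : ℂ => x) 2 μ
  mean_eq_zero : ∫ x, x ∂μ = 0
  variance_eq_one : ∫ x, ‖x‖ ^ 2 ∂μ = 1

/-- `ξ_0, …, ξ_n` are jointly independent, each with law `μ`. -/
structure IsIIDWithLaw {Ω : Type*} [MeasurableSpace Ω] (P : Measure Ω) {n : ℕ}
    (ξ : Fin (n + 1) → Ω → ℂ) (μ : Measure ℂ) : Prop where
  indep : iIndepFun ξ P
  hasLaw : ∀ i, HasLaw (ξ i) μ P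

/-- Two laws on `ℂ` match moments to order `m`:
`E Re(ξ)^a Im(ξ)^b = E Re(ξ')^a Im(ξ')^b` for all natural `a, b` with `a + b ≤ m`. -/
def MatchMoments (m : ℕ) (μ ν : Measure ℂ) : Prop :=
  ∀ a b : ℕ, a + b ≤ m →
    ∫ x : ℂ, x.re ^ a * x.im ^ b ∂μ = ∫ x : ℂ, x.re ^ a * x.im ^ b ∂ν

/-- The `2k` standard real basis vectors of `ℂ^k = ℝ^{2k}`: `e_j` for `(j, 0)` and `√-1 e_j` for
`(j, 1)`. -/
def realBasisVec {k : ℕ} (p : Fin k × Fin 2) : Fin k → ℂ :=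
  Pi.single p.1 (if p.2 = 0 then 1 else Complex.I)

/-- `|∇^a G(w)|`, the Euclidean norm of the tensor of all `a`-th order partial derivatives of `G`
with respect to the `2k` real coordinates of `ℂ^k`. -/
def gradNorm {k : ℕ} (a : ℕ) (G : (Fin k → ℂ) → ℂ) (w : Fin k → ℂ) : ℝ :=
  Real.sqrt (∑ s : Fin a → Fin k × Fin 2,
    ‖iteratedFDeriv ℝ a G w (fun l => realBasisVec (s l))‖ ^ 2)

theorem zeroTupleMeasure_eq {k d : ℕ} {c : ℂ} (hc : c ≠ 0) (ζ : Fin d → ℂ) :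
    zeroTupleMeasure k (Polynomial.C c * ∏ i, (Polynomial.X - Polynomial.C (ζ i))) =
      ∑ s : Fin k ↪ Fin d, Measure.dirac (fun j => ζ (s j)) := by
  have hroots : (Polynomial.C c * ∏ i, (Polynomial.X - Polynomial.C (ζ i))).roots =
      (Finset.univ : Finset (Fin d)).val.map ζ := by
    rw [Polynomial.roots_C_mul _ hc]
    have h := Polynomial.roots_multiset_prod_X_sub_C ((Finset.univ : Finset (Fin d)).val.map ζ)
    rw [Multiset.map_map] at h
    exact h
  unfold zeroTupleMeasure
  rw [hroots]
  let e₁ : (Finset.univ : Finset (Fin d)).val.ToType ≃ Fin d :=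
    { toFun := fun x => x.1
      invFun := fun i => ⟨i, ⟨0, Multiset.count_pos.2 (by simp)⟩⟩
      left_inv := by
        rintro ⟨x, i, hi⟩
        have : Multiset.count x (Finset.univ : Finset (Fin d)).val ≤ 1 :=
          Multiset.nodup_iff_count_le_one.1 Finset.univ.nodup x
        have : i = 0 := by omega
        subst this
        rfl
      right_inv := fun i => rfl }
  let e := e₁.symm.trans ((Finset.univ : Finset (Fin d)).val.mapEquiv ζ)
  refine (Fintype.sum_equiv (Equiv.embeddingCongr (Equiv.refl (Fin k)) e) _ _ ?_).symm
  intro s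
  congr 1
  funext j
  exact (Multiset.mapEquiv_apply (Finset.univ : Finset (Fin d)).val ζ (e₁.symm (s j))).symm

theorem measurable_zeroTupleMeasure (n k : ℕ) :
    Measurable (fun a : Fin (n + 1) → ℂ =>
      zeroTupleMeasure k (∑ i, Polynomial.C (a i) * Polynomial.X ^ (i : ℕ))) := by
  let q : Fin (n + 1) → ℂ × (ℕ → ℂ) → Polynomial ℂ := fun d x =>
    Polynomial.C x.1 * ∏ i : Fin d, (Polynomial.X - Polynomial.C (x.2 i))
  let Φ : Fin (n + 1) × (ℂ × (ℕ → ℂ)) → (Fin (n + 1) → ℂ) := fun x i => (q x.1 x.2).coeff i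
  have hrec : ∀ p : Polynomial ℂ, p.natDegree ≤ n →
      ∑ i : Fin (n + 1), Polynomial.C (p.coeff i) * Polynomial.X ^ (i : ℕ) = p := by
    intro p hp
    rw [Fin.sum_univ_eq_sum_range (fun i => Polynomial.C (p.coeff i) * Polynomial.X ^ i) (n + 1)]
    exact (p.as_sum_range_C_mul_X_pow' (by omega)).symm
  have hqdeg : ∀ d x, (q d x).natDegree ≤ n := by
    intro d x
    refine (Polynomial.natDegree_C_mul_le _ _).trans ?_
    refine (Polynomial.natDegree_prod_le _ _).trans ?_
    simp only [Polynomial.natDegree_X_sub_C]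
    simp
    omega
  have hΦ : Measurable Φ := by
    refine measurable_from_prod_countable_right fun d => ?_
    refine measurable_pi_iff.2 fun i => ?_
    refine Continuous.measurable ?_
    show Continuous fun x : ℂ × (ℕ → ℂ) => (q d x).coeff i
    simp only [q, Polynomial.coeff_C_mul]
    refine continuous_fst.mul ?_
    have key : ∀ (t : Finset (Fin d)) (m : ℕ), Continuous fun x : ℂ × (ℕ → ℂ) =>
        (∏ i ∈ t, (Polynomial.X - Polynomial.C (x.2 i))).coeff m := by
      intro t
      induction t using Finset.induction_on with
      | empty => intro m; simp only [Finset.prod_empty]; fun_prop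
      | insert a t ha ih =>
        intro m
        simp only [Finset.prod_insert ha, sub_mul, Polynomial.coeff_sub, Polynomial.coeff_C_mul]
        refine Continuous.sub ?_ ((by fun_prop : Continuous fun x : ℂ × (ℕ → ℂ) => x.2 a).mul (ih m))
        cases m with
        | zero => simp only [Polynomial.coeff_X_mul_zero]; fun_prop
        | succ m => simpa only [Polynomial.coeff_X_mul] using ih m
    exact key Finset.univ i
  have hsurj : Function.Surjective Φ := by
    intro a
    set p : Polynomial ℂ := ∑ i : Fin (n + 1), Polynomial.C (a i) * Polynomial.X ^ (i : ℕ) with hp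
    have hcoeff : ∀ i : Fin (n + 1), p.coeff i = a i := by
      intro i
      simp only [hp, Polynomial.finsetSum_coeff, Polynomial.coeff_C_mul, Polynomial.coeff_X_pow]
      rw [Finset.sum_eq_single i]
      · simp
      · intro b _ hb
        have : (i : ℕ) ≠ b := fun h => hb (Fin.ext h.symm)
        simp [this]
      · simp
    have hdeg : p.natDegree ≤ n := by
      refine Polynomial.natDegree_sum_le_of_forall_le _ _ fun i _ => ?_
      exact (Polynomial.natDegree_C_mul_X_pow_le _ _).trans (by omega)
    have hcard : p.roots.card = p.natDegree :=
      (IsAlgClosed.splits p).natDegree_eq_card_roots.symm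
    refine ⟨(⟨p.natDegree, by omega⟩, p.leadingCoeff, fun i => p.roots.toList.getD i 0), ?_⟩
    funext i
    rw [← hcoeff i]
    show (q _ _).coeff i = _
    congr 1
    show Polynomial.C p.leadingCoeff * ∏ i : Fin p.natDegree, _ = p
    conv_rhs => rw [(IsAlgClosed.splits p).eq_prod_roots]
    congr 1
    have hlen : p.roots.toList.length = p.natDegree := by simp [hcard]
    rw [← Multiset.prod_toList, ← List.prod_ofFn]
    conv_rhs => rw [← Multiset.coe_toList p.roots]
    rw [Multiset.map_coe, Multiset.prod_toList, Multiset.prod_coe]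
    congr 1
    apply List.ext_getElem
    · simp [hlen]
    · intro m h₁ h₂
      have : m < p.roots.toList.length := by simpa using h₂
      simp [List.getElem?_eq_getElem this]
  rw [← hΦ.measurable_comp_iff_of_surjective hsurj]
  refine measurable_from_prod_countable_right fun d => ?_
  have hform : (fun x : ℂ × (ℕ → ℂ) => ((fun a : Fin (n + 1) → ℂ =>
      zeroTupleMeasure k (∑ i, Polynomial.C (a i) * Polynomial.X ^ (i : ℕ))) ∘ Φ) (d, x)) =
      fun x => if x.1 = 0 then zeroTupleMeasure k 0 else
        ∑ s : Fin k ↪ Fin d, Measure.dirac (fun j => x.2 (s j)) := by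
    funext x
    simp only [Function.comp_apply, Φ]
    rw [hrec _ (hqdeg d x)]
    split_ifs with h
    · simp [q, h]
    · exact zeroTupleMeasure_eq h fun i : Fin d => x.2 i
  rw [hform]
  refine Measurable.ite ?_ measurable_const ?_
  · exact measurable_fst (measurableSet_singleton 0)
  · refine Measure.measurable_of_measurable_coe _ fun B hB => ?_
    simp only [Measure.finsetSum_apply]
    refine Finset.measurable_sum _ fun s _ => ?_
    refine (Measure.measurable_coe hB).comp (Measure.measurable_dirac.comp ?_)
    fun_prop

/-- The identity that characterizes the correlation measure of a random polynomial of degree at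
most `n`. -/
theorem integral_correlationMeasure {Ω : Type*} [MeasurableSpace Ω] (P : Measure Ω)
    [IsProbabilityMeasure P] (n k : ℕ) (f : Ω → Polynomial ℂ) (hdeg : ∀ ω, (f ω).natDegree ≤ n)
    (hf : ∀ i : Fin (n + 1), AEMeasurable (fun ω => (f ω).coeff i) P)
    (φ : (Fin k → ℂ) → ℂ) (hφ : Continuous φ) (hφ' : HasCompactSupport φ) :
    ∫ x, φ x ∂(correlationMeasure P k f) =
      ∫ ω, ∑ s : Fin k ↪ (f ω).roots.ToType, φ (fun j => (s j).1) ∂P := by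
  let A : Ω → Fin (n + 1) → ℂ := fun ω i => (f ω).coeff i
  have hA : AEMeasurable A P := aemeasurable_pi_iff.2 hf
  let q : (Fin (n + 1) → ℂ) → Polynomial ℂ := fun a =>
    ∑ i, Polynomial.C (a i) * Polynomial.X ^ (i : ℕ)
  have hq : ∀ ω, q (A ω) = f ω := by
    intro ω
    show ∑ i : Fin (n + 1), Polynomial.C ((f ω).coeff i) * Polynomial.X ^ (i : ℕ) = f ω
    rw [Fin.sum_univ_eq_sum_range (fun i => Polynomial.C ((f ω).coeff i) * Polynomial.X ^ i) (n + 1)]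
    exact ((f ω).as_sum_range_C_mul_X_pow' (by have := hdeg ω; omega)).symm
  have hqdeg : ∀ a, (q a).natDegree ≤ n := by
    intro a
    refine Polynomial.natDegree_sum_le_of_forall_le _ _ fun i _ => ?_
    exact (Polynomial.natDegree_C_mul_X_pow_le _ _).trans (by omega)
  let κ : Kernel (Fin (n + 1) → ℂ) (Fin k → ℂ) :=
    ⟨fun a => zeroTupleMeasure k (q a), measurable_zeroTupleMeasure n k⟩
  have hκ : ∀ a, κ a = zeroTupleMeasure k (q a) := fun a => rfl
  have hfin : IsFiniteKernel κ := by
    refine ⟨⟨((n ^ k : ℕ) : ℝ≥0∞), ENNReal.natCast_lt_top _, fun a => ?_⟩⟩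
    rw [hκ]
    simp only [zeroTupleMeasure, Measure.finsetSum_apply, measure_univ, Finset.sum_const,
      Finset.card_univ, nsmul_eq_mul, mul_one, Fintype.card_embedding_eq, Fintype.card_fin]
    rw [Nat.cast_le]
    refine (Nat.descFactorial_le_pow _ _).trans (Nat.pow_le_pow_left ?_ k)
    rw [Multiset.card_coe]
    exact (Polynomial.card_roots' _).trans (hqdeg a)
  have hcorr : correlationMeasure P k f =
      (κ ∘ₖ Kernel.const Unit (P.map A)) () := by
    rw [Kernel.comp_apply, Kernel.const_apply]
    show Measure.join _ = Measure.join _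
    rw [AEMeasurable.map_map_of_aemeasurable κ.measurable.aemeasurable hA]
    congr 2
    funext ω
    show zeroTupleMeasure k (f ω) = κ (A ω)
    rw [hκ, hq]
  have : IsProbabilityMeasure (P.map A) := Measure.isProbabilityMeasure_map hA
  have hint : Integrable φ ((κ ∘ₖ Kernel.const Unit (P.map A)) ()) :=
    hφ.integrable_of_hasCompactSupport hφ'
  have hinner : ∀ a, ∫ y, φ y ∂κ a =
      ∑ s : Fin k ↪ (q a).roots.ToType, φ (fun j => (s j).1) := by
    intro a
    rw [hκ, zeroTupleMeasure, integral_finsetSum_measure]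
    · simp only [integral_dirac]
    · intro s _
      exact hφ.integrable_of_hasCompactSupport hφ'
  rw [hcorr, Kernel.integral_comp hint, Kernel.const_apply, integral_map hA]
  · refine integral_congr_ae (Filter.Eventually.of_forall fun ω => ?_)
    show ∫ y, φ y ∂κ (A ω) = _
    rw [hinner, hq]
  · have := hint.integral_comp.aestronglyMeasurable
    rwa [Kernel.const_apply] at this

end

open MeasureTheory ProbabilityTheory
open scoped ENNReal

noncomputable section

/-! The statement compares means of sums of a test function over tuples of zeroes. Since `log |x| /
(2π)` is the fundamental solution of the planar Laplacian, the sum of `G` over all `m`-tuples of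
zeroes of `p` is `(2π)^{-m}` times the integral of `∏ log |p(x_j)|` against the product of the
Laplacians of `G` in all variables (`integral_prod_log_smul_fullLaplacian`). Tuples with distinct
indices differ from all tuples by sums over fewer variables
(`exists_rootSum_eq_distinctRootSum_add`), which an induction removes.

Near a reference point `z` the polynomial is multiplied by `exp(-x z̄ + |z|²/2)`. Zeroes are
unchanged, and the logarithm changes by the real part of an affine function, which is harmonic. The
squared moduli of the new coefficients are Poisson weights of parameter `|x|²` times `exp(|x - z|²)`
(`norm_weylCoeff_sq`). So their sum is bounded above and below, also when `z` lies at the edge `|z|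
≈ √n`, while each is `O(1/|x|)`, a negative power of `n`.

The logarithms are replaced by `truncLog`, smooth at scale `η = n^{-δ}` and flattened at scale `B`,
a large power of `n`. Their product has second order Taylor expansions with remainder of order `p =
2 + e`, where `0 < e ≤ 1`, so Lindeberg's exchange of atoms one by one (`lindeberg`) leaves a
negative power of `n`: matching moments cancel the quadratic parts, and the small coefficients beat
the powers of `η⁻¹`.

The truncation is paid for by two bounds on small values. Characteristic functions give probability
`O(n^{-δ/2})` for `|F| ≤ √η` (`exists_smallBall_bound`). A lacunary subsequence of coefficients
makes `|F| ≤ exp(-n^a)` rarer than any power of `n` (`concentrationBound_of_lacunary`). The latter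
also controls high moments of `log |F|` over a disc, because one lower bound at the centre suffices
(`abs_log_norm_weylField_le`). On the remaining rare event there are at most `n` zeroes, and a
deterministic bound is enough. -/

/-- The derivative of `G` in the direction `v`. -/
def dirDeriv {E : Type*} [NormedAddCommGroup E] [NormedSpace ℝ E] (v : E) (G : E → ℂ) : E → ℂ :=
  fun x => fderiv ℝ G x v

/-- The Laplacian of a function on `ℂ = ℝ²`. -/
def planeLaplacian (φ : ℂ → ℂ) : ℂ → ℂ :=
  fun x => dirDeriv 1 (dirDeriv 1 φ) x + dirDeriv Complex.I (dirDeriv Complex.I φ) x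

/-! ### Directional derivatives of smooth compactly supported functions. -/

section Derivatives

variable {E : Type*} [NormedAddCommGroup E] [NormedSpace ℝ E]

theorem ContDiff.dirDeriv {G : E → ℂ} (hG : ContDiff ℝ (⊤ : ℕ∞) G) (v : E) :
    ContDiff ℝ (⊤ : ℕ∞) (dirDeriv v G) :=
  (hG.fderiv_right (by exact_mod_cast le_top)).clm_apply contDiff_const

theorem HasCompactSupport.dirDeriv {G : E → ℂ} (hG : HasCompactSupport G) (v : E) :
    HasCompactSupport (dirDeriv v G) :=
  hG.fderiv_apply (𝕜 := ℝ) v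

theorem ContDiff.planeLaplacian {φ : ℂ → ℂ} (h : ContDiff ℝ (⊤ : ℕ∞) φ) :
    ContDiff ℝ (⊤ : ℕ∞) (planeLaplacian φ) :=
  ((h.dirDeriv 1).dirDeriv 1).add ((h.dirDeriv _).dirDeriv _)

theorem HasCompactSupport.planeLaplacian {φ : ℂ → ℂ} (h : HasCompactSupport φ) :
    HasCompactSupport (planeLaplacian φ) :=
  ((h.dirDeriv 1).dirDeriv 1).add ((h.dirDeriv _).dirDeriv _)

end Derivatives

/-! ### Green's formula for the logarithm in the plane. -/

/-- In polar coordinates the Jacobian cancels the singularity, and the area of a rectangle remains.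
-/
theorem lintegral_inv_norm_ball_le (R : ℝ) :
    ∫⁻ x in Metric.ball (0 : ℂ) R, ENNReal.ofReal ‖x‖⁻¹ ≤ ENNReal.ofReal (2 * Real.pi * R) := by
  rw [← lintegral_indicator Metric.isOpen_ball.measurableSet,
    ← Complex.lintegral_comp_polarCoord_symm]
  have hle : ∀ p ∈ polarCoord.target, ENNReal.ofReal p.1 •
      (Metric.ball (0 : ℂ) R).indicator (fun x => ENNReal.ofReal ‖x‖⁻¹)
        (Complex.polarCoord.symm p) ≤
      (Set.Ioo 0 R ×ˢ Set.Ioo (-Real.pi) Real.pi).indicator (fun _ => (1 : ℝ≥0∞)) p := by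
    intro p hp
    rw [polarCoord_target] at hp
    have h0 : 0 < p.1 := hp.1
    have hn : ‖Complex.polarCoord.symm p‖ = p.1 := by
      rw [Complex.norm_polarCoord_symm, abs_of_pos h0]
    by_cases h : p.1 < R
    · rw [Set.indicator_of_mem (by rw [mem_ball_zero_iff, hn]; exact h),
        Set.indicator_of_mem (show p ∈ Set.Ioo 0 R ×ˢ Set.Ioo (-Real.pi) Real.pi from
          ⟨⟨h0, h⟩, hp.2⟩), hn, smul_eq_mul, ← ENNReal.ofReal_mul h0.le,
        mul_inv_cancel₀ h0.ne', ENNReal.ofReal_one]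
    · rw [Set.indicator_of_notMem (by rw [mem_ball_zero_iff, hn]; exact h)]
      simp
  refine (setLIntegral_mono' polarCoord.open_target.measurableSet hle).trans ?_
  refine (setLIntegral_le_lintegral _ _).trans ?_
  rw [lintegral_indicator (measurableSet_Ioo.prod measurableSet_Ioo), setLIntegral_one,
    Measure.volume_eq_prod, Measure.prod_prod, Real.volume_Ioo, Real.volume_Ioo,
    ← ENNReal.ofReal_mul' (by linarith [Real.pi_pos])]
  exact ENNReal.ofReal_le_ofReal (by ring_nf; rfl)

/-- The bound must not depend on the position of the singularity, which will be a random zero.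
Within distance one of it the previous estimate applies after a translation; elsewhere the integrand
is at most one. -/
theorem lintegral_inv_norm_sub_ball_le (c ζ : ℂ) {R : ℝ} (hR : 0 ≤ R) :
    ∫⁻ x in Metric.ball c R, ENNReal.ofReal ‖x - ζ‖⁻¹ ≤
      ENNReal.ofReal (2 * Real.pi + Real.pi * R ^ 2) := by
  have hle : ∀ x : ℂ, ENNReal.ofReal ‖x - ζ‖⁻¹ ≤
      (Metric.ball (0 : ℂ) 1).indicator (fun y => ENNReal.ofReal ‖y‖⁻¹) (x - ζ) + 1 := by
    intro x
    by_cases h : ‖x - ζ‖ < 1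
    · rw [Set.indicator_of_mem (by rwa [mem_ball_zero_iff])]
      exact le_self_add
    · refine le_trans ?_ le_add_self
      rw [← ENNReal.ofReal_one]
      exact ENNReal.ofReal_le_ofReal (inv_le_one_of_one_le₀ (not_lt.1 h))
  calc ∫⁻ x in Metric.ball c R, ENNReal.ofReal ‖x - ζ‖⁻¹
      ≤ ∫⁻ x in Metric.ball c R, ((Metric.ball (0 : ℂ) 1).indicator
          (fun y => ENNReal.ofReal ‖y‖⁻¹) (x - ζ) + 1) := lintegral_mono fun x => hle x
    _ = (∫⁻ x in Metric.ball c R, (Metric.ball (0 : ℂ) 1).indicator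
          (fun y => ENNReal.ofReal ‖y‖⁻¹) (x - ζ)) + volume (Metric.ball c R) := by
        rw [lintegral_add_right _ measurable_const, setLIntegral_one]
    _ ≤ (∫⁻ x, (Metric.ball (0 : ℂ) 1).indicator
          (fun y => ENNReal.ofReal ‖y‖⁻¹) (x - ζ)) + volume (Metric.ball c R) := by
        exact add_le_add (setLIntegral_le_lintegral _ _) le_rfl
    _ = (∫⁻ x in Metric.ball (0 : ℂ) 1, ENNReal.ofReal ‖x‖⁻¹) + volume (Metric.ball c R) := by
        rw [lintegral_sub_right_eq_self
          (fun x => (Metric.ball (0 : ℂ) 1).indicator (fun y => ENNReal.ofReal ‖y‖⁻¹) x) ζ,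
          lintegral_indicator Metric.isOpen_ball.measurableSet]
    _ ≤ ENNReal.ofReal (2 * Real.pi * 1) + ENNReal.ofReal (Real.pi * R ^ 2) := by
        gcongr
        · exact lintegral_inv_norm_ball_le 1
        · rw [Complex.volume_ball, ENNReal.ofReal_mul Real.pi_pos.le, ENNReal.ofReal_pow hR,
            mul_comm]
          refine le_of_eq ?_
          congr 1
          exact (ENNReal.ofReal_coe_nnreal (p := NNReal.pi)).symm
    _ = _ := by
        rw [← ENNReal.ofReal_add (by positivity) (by positivity), mul_one]

theorem locallyIntegrable_inv_norm : LocallyIntegrable (fun x : ℂ => ‖x‖⁻¹) := by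
  rw [locallyIntegrable_iff]
  intro K hK
  obtain ⟨R, hR, hKR⟩ := hK.isBounded.subset_ball_lt 0 0
  refine IntegrableOn.mono_set ?_ hKR
  refine ⟨by fun_prop, ?_⟩
  rw [hasFiniteIntegral_iff_ofReal (Filter.Eventually.of_forall fun x => by positivity)]
  exact (lintegral_inv_norm_ball_le R).trans_lt ENNReal.ofReal_lt_top

theorem abs_log_le_inv_add {r : ℝ} (hr : 0 ≤ r) : |Real.log r| ≤ r⁻¹ + r := by
  rcases hr.eq_or_lt with rfl | h
  · simp
  · rw [abs_le]
    have h1 := Real.log_le_self hr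
    have h2 := Real.log_le_self (inv_pos.2 h).le
    rw [Real.log_inv] at h2
    have := inv_pos.2 h
    constructor <;> linarith

theorem locallyIntegrable_log_norm : LocallyIntegrable (fun x : ℂ => Real.log ‖x‖) := by
  have h : LocallyIntegrable (fun x : ℂ => ‖x‖⁻¹ + ‖x‖) :=
    locallyIntegrable_inv_norm.add continuous_norm.locallyIntegrable
  refine h.mono (Real.measurable_log.comp measurable_norm).aestronglyMeasurable (Filter.Eventually.of_forall fun x => ?_)
  rw [Real.norm_eq_abs, Real.norm_eq_abs]
  exact (abs_log_le_inv_add (norm_nonneg x)).trans (le_abs_self _)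

/-- In polar coordinates, the radial derivative divided by the radius integrates to the value at
the origin. -/
theorem integral_fderiv_self_div_sq {φ : ℂ → ℂ} (hφ : ContDiff ℝ (⊤ : ℕ∞) φ)
    (hc : HasCompactSupport φ) :
    ∫ x : ℂ, (‖x‖ ^ 2)⁻¹ • fderiv ℝ φ x x = -(2 * Real.pi) * φ 0 := by
  rw [← Complex.integral_comp_polarCoord_symm, polarCoord_target]
  have hpolar : ∀ p : ℝ × ℝ, Complex.polarCoord.symm p = p.1 • Complex.exp (p.2 * Complex.I) := by
    intro p
    rw [Complex.polarCoord_symm_apply, Complex.exp_mul_I, Complex.real_smul]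
    simp
  have hd : Differentiable ℝ φ := hφ.differentiable (by simp)
  -- The Jacobian `r`, the weight `r⁻²` and the factor `r` from linearity of the derivative cancel,
  -- so the integrand becomes the plain radial derivative.
  let g : ℝ × ℝ → ℂ := fun p =>
    fderiv ℝ φ (p.1 • Complex.exp (p.2 * Complex.I)) (Complex.exp (p.2 * Complex.I))
  have hgc : Continuous g := by
    have := hφ.continuous_fderiv (by simp)
    fun_prop
  have hnorm : ∀ θ : ℝ, ‖Complex.exp (θ * Complex.I)‖ = 1 := Complex.norm_exp_ofReal_mul_I
  obtain ⟨R, hR, hKR⟩ := hc.isBounded.subset_ball_lt 0 0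
  have hzero : ∀ r θ : ℝ, R ≤ r → φ (r • Complex.exp (θ * Complex.I)) = 0 := by
    intro r θ hr
    refine image_eq_zero_of_notMem_tsupport fun hmem => ?_
    have := hKR hmem
    rw [mem_ball_zero_iff, norm_smul, hnorm, mul_one, Real.norm_eq_abs] at this
    linarith [le_abs_self r]
  have hgzero : ∀ r θ : ℝ, R ≤ r → g (r, θ) = 0 := by
    intro r θ hr
    have : fderiv ℝ φ (r • Complex.exp (θ * Complex.I)) = 0 := by
      refine image_eq_zero_of_notMem_tsupport fun hmem => ?_
      have := hKR (tsupport_fderiv_subset ℝ hmem)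
      rw [mem_ball_zero_iff, norm_smul, hnorm, mul_one, Real.norm_eq_abs] at this
      linarith [le_abs_self r]
    show fderiv ℝ φ (r • Complex.exp (θ * Complex.I)) _ = 0
    rw [this]; rfl
  have hcongr : ∫ p in Set.Ioi (0 : ℝ) ×ˢ Set.Ioo (-Real.pi) Real.pi,
      p.1 • ((‖Complex.polarCoord.symm p‖ ^ 2)⁻¹ •
        fderiv ℝ φ (Complex.polarCoord.symm p) (Complex.polarCoord.symm p)) =
      ∫ p in Set.Ioi (0 : ℝ) ×ˢ Set.Ioo (-Real.pi) Real.pi, g p := by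
    refine setIntegral_congr_fun (measurableSet_Ioi.prod measurableSet_Ioo) fun p hp => ?_
    have h0 : (0 : ℝ) < p.1 := hp.1
    simp only [hpolar, norm_smul, hnorm, mul_one, map_smul, Real.norm_eq_abs, sq_abs, g]
    rw [smul_smul, smul_smul]
    have : p.1 * (p.1 ^ 2)⁻¹ * p.1 = 1 := by field_simp
    rw [this, one_smul]
  have hint : IntegrableOn g (Set.Ioi (0 : ℝ) ×ˢ Set.Ioo (-Real.pi) Real.pi) := by
    have h1 : IntegrableOn g (Set.Icc (0 : ℝ) R ×ˢ Set.Icc (-Real.pi) Real.pi) :=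
      hgc.continuousOn.integrableOn_compact (isCompact_Icc.prod isCompact_Icc)
    refine h1.of_forall_sdiff_eq_zero (measurableSet_Ioi.prod measurableSet_Ioo) ?_
    rintro ⟨r, θ⟩ ⟨⟨h0, hθ⟩, hn⟩
    refine hgzero r θ ?_
    by_contra hlt
    exact hn ⟨⟨(show (0:ℝ) < r from h0).le, (not_le.1 hlt).le⟩, ⟨hθ.1.le, hθ.2.le⟩⟩
  -- The fundamental theorem of calculus along a ray: the value at infinity vanishes.
  have hinner : ∀ θ : ℝ, ∫ r in Set.Ioi (0 : ℝ), g (r, θ) = - φ 0 := by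
    intro θ
    have hder : ∀ r ∈ Set.Ici (0 : ℝ),
        HasDerivAt (fun r : ℝ => φ (r • Complex.exp (θ * Complex.I))) (g (r, θ)) r := by
      intro r _
      have h1 : HasDerivAt (fun r : ℝ => r • Complex.exp (θ * Complex.I))
          ((1 : ℝ) • Complex.exp (θ * Complex.I)) r := (hasDerivAt_id r).smul_const _
      have := (hd (r • Complex.exp (θ * Complex.I))).hasFDerivAt.comp_hasDerivAt r h1
      rwa [one_smul] at this
    have hi : IntegrableOn (fun r => g (r, θ)) (Set.Ioi 0) := by
      have h1 : IntegrableOn (fun r => g (r, θ)) (Set.Icc 0 R) :=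
        (hgc.comp (by fun_prop : Continuous fun r : ℝ => (r, θ))).continuousOn.integrableOn_compact
          isCompact_Icc
      refine h1.of_forall_sdiff_eq_zero measurableSet_Ioi ?_
      rintro r ⟨h0, hn⟩
      refine hgzero r θ ?_
      by_contra hlt
      exact hn ⟨(show (0:ℝ) < r from h0).le, (not_le.1 hlt).le⟩
    have ht : Filter.Tendsto (fun r : ℝ => φ (r • Complex.exp (θ * Complex.I))) Filter.atTop
        (nhds 0) := by
      refine tendsto_const_nhds.congr' ?_
      filter_upwards [Filter.eventually_ge_atTop R] with r hr
      exact (hzero r θ hr).symm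
    rw [integral_Ioi_of_hasDerivAt_of_tendsto' hder hi ht]
    simp
  rw [hcongr]
  rw [Measure.volume_eq_prod] at hint ⊢
  rw [IntegrableOn, ← Measure.prod_restrict] at hint
  rw [← Measure.prod_restrict, integral_prod_symm _ hint]
  simp only [hinner, integral_const]
  simp only [measureReal_restrict_apply_univ, Real.volume_real_Ioo]
  rw [max_eq_left (by linarith [Real.pi_pos]), Complex.real_smul]
  push_cast
  ring

/-- The regularization by `η` makes the logarithm differentiable everywhere, with gradient `x / (η²
+ ‖x‖²)`, so one integration by parts is legitimate. The singular case follows by letting `η` tend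
to zero. -/
theorem integral_regularized_log_mul_planeLaplacian {φ : ℂ → ℂ} (hφ : ContDiff ℝ (⊤ : ℕ∞) φ)
    (hc : HasCompactSupport φ) {η : ℝ} (hη : 0 < η) :
    ∫ x : ℂ, (Real.log (η ^ 2 + ‖x‖ ^ 2) / 2) • planeLaplacian φ x =
      -∫ x : ℂ, (η ^ 2 + ‖x‖ ^ 2)⁻¹ • fderiv ℝ φ x x := by
  have hpos : ∀ x : ℂ, 0 < η ^ 2 + ‖x‖ ^ 2 := fun x => by positivity
  let F : ℂ → ℝ := fun x => Real.log (η ^ 2 + ‖x‖ ^ 2) / 2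
  have hF : ∀ x : ℂ, HasFDerivAt F ((η ^ 2 + ‖x‖ ^ 2)⁻¹ • innerSL ℝ x) x := by
    intro x
    have h1 : HasFDerivAt (fun y : ℂ => η ^ 2 + ‖y‖ ^ 2) (2 • innerSL ℝ x) x :=
      (hasStrictFDerivAt_norm_sq x).hasFDerivAt.const_add _
    have h2 := (h1.log (hpos x).ne').mul_const (2⁻¹ : ℝ)
    refine (h2.congr_fderiv ?_).congr_of_eventuallyEq (Filter.Eventually.of_forall fun y => ?_)
    · ext v
      all_goals simp; try field_simp
    · simp [F, div_eq_mul_inv]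
  have hFd : Differentiable ℝ F := fun x => (hF x).differentiableAt
  have hfd : ∀ x v, fderiv ℝ F x v = (η ^ 2 + ‖x‖ ^ 2)⁻¹ * inner ℝ x v := by
    intro x v; rw [(hF x).fderiv]; rfl
  have hFc : Continuous F := hFd.continuous
  have hqc : Continuous fun x : ℂ => (η ^ 2 + ‖x‖ ^ 2)⁻¹ :=
    (by fun_prop : Continuous fun x : ℂ => η ^ 2 + ‖x‖ ^ 2).inv₀ fun x => (hpos x).ne'
  have hint : ∀ (q : ℂ → ℝ) (ψ : ℂ → ℂ), Continuous q → Continuous ψ → HasCompactSupport ψ →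
      Integrable fun x => q x • ψ x := fun q ψ hq hψ hs =>
    (hq.smul hψ).integrable_of_hasCompactSupport hs.smul_left
  have hparts : ∀ v : ℂ, ∫ x, F x • dirDeriv v (dirDeriv v φ) x =
      -∫ x, ((η ^ 2 + ‖x‖ ^ 2)⁻¹ * inner ℝ x v) • dirDeriv v φ x := by
    intro v
    have hψ := hφ.dirDeriv v
    have hψc := hc.dirDeriv v
    have hin : Continuous fun x : ℂ => (η ^ 2 + ‖x‖ ^ 2)⁻¹ * inner ℝ x v := by fun_prop
    have := integral_smul_fderiv_eq_neg_fderiv_smul_of_integrable (μ := volume)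
      (f := F) (g := dirDeriv v φ) (v := v) (by
        simp only [hfd]
        exact hint _ _ hin hψ.continuous hψc)
      (hint _ _ hFc (hψ.dirDeriv v).continuous (hψc.dirDeriv v))
      (hint _ _ hFc hψ.continuous hψc) (fun x _ => hFd x)
      (fun x _ => hψ.differentiable (by simp) x)
    simp only [hfd] at this
    exact this
  have hsplit : ∀ x, (Real.log (η ^ 2 + ‖x‖ ^ 2) / 2) • planeLaplacian φ x =
      F x • dirDeriv 1 (dirDeriv 1 φ) x + F x • dirDeriv Complex.I (dirDeriv Complex.I φ) x :=
    fun x => smul_add _ _ _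
  have hin : ∀ v : ℂ, Continuous fun x : ℂ => (η ^ 2 + ‖x‖ ^ 2)⁻¹ * inner ℝ x v := fun v => by
    fun_prop
  simp only [hsplit]
  rw [integral_add (hint _ _ hFc ((hφ.dirDeriv _).dirDeriv _).continuous
      ((hc.dirDeriv _).dirDeriv _)) (hint _ _ hFc ((hφ.dirDeriv _).dirDeriv _).continuous
      ((hc.dirDeriv _).dirDeriv _)), hparts, hparts, ← neg_add,
    ← integral_add (hint _ _ (hin _) (hφ.dirDeriv _).continuous (hc.dirDeriv _))
      (hint _ _ (hin _) (hφ.dirDeriv _).continuous (hc.dirDeriv _))]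
  congr 1
  refine integral_congr_ae (Filter.Eventually.of_forall fun x => ?_)
  have hx : x = x.re • (1 : ℂ) + x.im • Complex.I := by simp [Complex.re_add_im]
  show _ = (η ^ 2 + ‖x‖ ^ 2)⁻¹ • fderiv ℝ φ x x
  have h1 : inner ℝ x (1 : ℂ) = x.re := by simp [Complex.inner]
  have h2 : inner ℝ x Complex.I = x.im := by simp [Complex.inner]
  have h3 : fderiv ℝ φ x x = x.re • fderiv ℝ φ x 1 + x.im • fderiv ℝ φ x Complex.I := by
    conv_lhs => rw [hx]
    rw [map_add, map_smul, map_smul, ← hx]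
  simp only [dirDeriv, h1, h2, h3, smul_add, smul_smul]

/-- `log ‖x‖ / (2π)` is the fundamental solution of the Laplacian of the plane. -/
theorem integral_log_norm_smul_planeLaplacian {φ : ℂ → ℂ} (hφ : ContDiff ℝ (⊤ : ℕ∞) φ)
    (hc : HasCompactSupport φ) :
    ∫ x : ℂ, Real.log ‖x‖ • planeLaplacian φ x = 2 * Real.pi * φ 0 := by
  let η : ℕ → ℝ := fun n => 1 / ((n : ℝ) + 1)
  have hη : ∀ n, 0 < η n := fun n => Nat.one_div_pos_of_nat
  have hη1 : ∀ n, η n ≤ 1 := fun n => by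
    have : (0 : ℝ) ≤ n := Nat.cast_nonneg n
    exact (div_le_one (by linarith)).2 (by linarith)
  have hηt : Filter.Tendsto η Filter.atTop (nhds 0) := tendsto_one_div_add_atTop_nhds_zero_nat
  have ht2 : ∀ x : ℂ, Filter.Tendsto (fun n => η n ^ 2 + ‖x‖ ^ 2) Filter.atTop
      (nhds (‖x‖ ^ 2)) := fun x => by
    simpa using (hηt.pow 2).add_const (‖x‖ ^ 2)
  have hne : ∀ᵐ x : ℂ, x ≠ 0 := by
    rw [ae_iff]; simp
  have hΔ := hφ.planeLaplacian
  have hΔc := hc.planeLaplacian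
  have hD : Continuous fun x : ℂ => fderiv ℝ φ x := hφ.continuous_fderiv (by simp)
  have hlim1 : Filter.Tendsto
      (fun n => ∫ x : ℂ, (Real.log (η n ^ 2 + ‖x‖ ^ 2) / 2) • planeLaplacian φ x) Filter.atTop
      (nhds (∫ x : ℂ, Real.log ‖x‖ • planeLaplacian φ x)) := by
    -- For `η ≤ 1` the regularized logarithm lies between `log ‖x‖` and `1 + ‖x‖²`, hence a locally
    -- integrable bound uniform in `η`.
    refine tendsto_integral_of_dominated_convergence
      (fun x => (|Real.log ‖x‖| + (1 + ‖x‖ ^ 2)) • ‖planeLaplacian φ x‖) (fun n => ?_) ?_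
      (fun n => ?_) ?_
    · refine Continuous.aestronglyMeasurable ?_
      refine Continuous.smul (Continuous.div_const (Continuous.log (by fun_prop) fun x => ?_) 2)
        hΔ.continuous
      have := hη n
      positivity
    · refine LocallyIntegrable.integrable_smul_right_of_hasCompactSupport ?_
        hΔ.continuous.norm hΔc.norm
      exact LocallyIntegrable.add (fun x => (locallyIntegrable_log_norm x).norm) (by fun_prop : Continuous fun x : ℂ =>
        (1 : ℝ) + ‖x‖ ^ 2).locallyIntegrable
    · filter_upwards [hne] with x hx
      rw [norm_smul, smul_eq_mul]
      refine mul_le_mul_of_nonneg_right ?_ (norm_nonneg _)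
      have hx0 : 0 < ‖x‖ := norm_pos_iff.2 hx
      have hl1 : Real.log (‖x‖ ^ 2) ≤ Real.log (η n ^ 2 + ‖x‖ ^ 2) :=
        Real.log_le_log (by positivity) (by nlinarith [hη n])
      have hl2 : Real.log (η n ^ 2 + ‖x‖ ^ 2) ≤ 1 + ‖x‖ ^ 2 := by
        refine (Real.log_le_self (by positivity)).trans ?_
        nlinarith [hη n, hη1 n]
      rw [Real.log_pow] at hl1
      push_cast at hl1
      rw [Real.norm_eq_abs, abs_le]
      have := neg_abs_le (Real.log ‖x‖)
      have := abs_nonneg (Real.log ‖x‖)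
      have : 0 ≤ ‖x‖ ^ 2 := by positivity
      constructor <;> linarith
    · filter_upwards [hne] with x hx
      have hx0 : 0 < ‖x‖ := norm_pos_iff.2 hx
      have h1 := (((ht2 x).log (by positivity)).div_const 2).smul_const (planeLaplacian φ x)
      rw [Real.log_pow] at h1
      convert h1 using 3
      push_cast; ring
  have hlim2 : Filter.Tendsto
      (fun n => -∫ x : ℂ, (η n ^ 2 + ‖x‖ ^ 2)⁻¹ • fderiv ℝ φ x x) Filter.atTop
      (nhds (-∫ x : ℂ, (‖x‖ ^ 2)⁻¹ • fderiv ℝ φ x x)) := by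
    refine (tendsto_integral_of_dominated_convergence
      (fun x => ‖x‖⁻¹ • ‖fderiv ℝ φ x‖) (fun n => ?_) ?_ (fun n => ?_) ?_).neg
    · refine Continuous.aestronglyMeasurable (Continuous.smul (Continuous.inv₀
        (by fun_prop : Continuous fun x : ℂ => η n ^ 2 + ‖x‖ ^ 2) fun x => ?_) (by fun_prop))
      have := hη n
      positivity
    · exact locallyIntegrable_inv_norm.integrable_smul_right_of_hasCompactSupport hD.norm
        (hc.fderiv ℝ).norm
    · filter_upwards [hne] with x hx
      have hx0 : 0 < ‖x‖ := norm_pos_iff.2 hx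
      rw [norm_smul, smul_eq_mul, Real.norm_of_nonneg (by have := hη n; positivity)]
      calc (η n ^ 2 + ‖x‖ ^ 2)⁻¹ * ‖fderiv ℝ φ x x‖
          ≤ (‖x‖ ^ 2)⁻¹ * (‖fderiv ℝ φ x‖ * ‖x‖) := by
            gcongr
            · nlinarith [hη n]
            · exact ContinuousLinearMap.le_opNorm _ _
        _ = ‖x‖⁻¹ * ‖fderiv ℝ φ x‖ := by field_simp
    · filter_upwards [hne] with x hx
      have hx0 : 0 < ‖x‖ := norm_pos_iff.2 hx
      exact ((ht2 x).inv₀ (by positivity)).smul_const _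
  rw [integral_fderiv_self_div_sq hφ hc] at hlim2
  refine tendsto_nhds_unique hlim1 ?_
  have : (2 * Real.pi * φ 0 : ℂ) = -(-(2 * Real.pi) * φ 0) := by ring
  rw [this]
  refine hlim2.congr fun n => ?_
  exact (integral_regularized_log_mul_planeLaplacian hφ hc (hη n)).symm

theorem dirDeriv_comp_add_right {E : Type*} [NormedAddCommGroup E] [NormedSpace ℝ E] (v a : E)
    (G : E → ℂ) : dirDeriv v (fun x => G (x + a)) = fun x => dirDeriv v G (x + a) := by
  funext x
  simp only [dirDeriv]
  rw [fderiv_comp_add_right]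

theorem integral_log_norm_sub_smul_planeLaplacian {φ : ℂ → ℂ} (hφ : ContDiff ℝ (⊤ : ℕ∞) φ)
    (hc : HasCompactSupport φ) (ζ : ℂ) :
    ∫ x : ℂ, Real.log ‖x - ζ‖ • planeLaplacian φ x = 2 * Real.pi * φ ζ := by
  have h := integral_log_norm_smul_planeLaplacian (φ := fun x => φ (x + ζ))
    (hφ.comp (contDiff_id.add contDiff_const)) (hc.comp_homeomorph (Homeomorph.addRight ζ))
  rw [zero_add] at h
  rw [← h, ← integral_add_right_eq_self (fun x => Real.log ‖x - ζ‖ • planeLaplacian φ x) ζ]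
  simp only [add_sub_cancel_right, planeLaplacian, dirDeriv_comp_add_right]

/-- The real part of a complex affine function is harmonic: its gradient is constant, and a
derivative of a compactly supported function integrates to zero. This is what permits a change of
the logarithmic potential by such a function. -/
theorem integral_affine_smul_planeLaplacian {φ : ℂ → ℂ} (hφ : ContDiff ℝ (⊤ : ℕ∞) φ)
    (hc : HasCompactSupport φ) (a b : ℂ) :
    ∫ x : ℂ, (a + b * x).re • planeLaplacian φ x = 0 := by
  let F : ℂ → ℝ := fun x => (a + b * x).re
  have hF : ∀ x : ℂ, HasFDerivAt F (Complex.reCLM.comp (b • ContinuousLinearMap.id ℝ ℂ)) x := by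
    intro x
    have h1 : HasFDerivAt (fun x : ℂ => a + b * x) (b • ContinuousLinearMap.id ℝ ℂ) x :=
      ((hasFDerivAt_id x).const_mul b).const_add a
    exact Complex.reCLM.hasFDerivAt.comp x h1
  have hFd : Differentiable ℝ F := fun x => (hF x).differentiableAt
  have hfd : ∀ x v, fderiv ℝ F x v = (b * v).re := by
    intro x v; rw [(hF x).fderiv]; rfl
  have hint : ∀ (q : ℂ → ℝ) (ψ : ℂ → ℂ), Continuous q → Continuous ψ → HasCompactSupport ψ →
      Integrable fun x => q x • ψ x := fun q ψ hq hψ hs =>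
    (hq.smul hψ).integrable_of_hasCompactSupport hs.smul_left
  have hzero : ∀ v : ℂ, ∫ x, dirDeriv v φ x = 0 := by
    intro v
    have := integral_smul_fderiv_eq_neg_fderiv_smul_of_integrable (μ := volume)
      (f := fun _ : ℂ => (1 : ℝ)) (g := φ) (v := v) (by simp)
      (hint _ _ continuous_const (hφ.dirDeriv v).continuous (hc.dirDeriv v))
      (hint _ _ continuous_const hφ.continuous hc) (fun x _ => differentiableAt_const _)
      (fun x _ => hφ.differentiable (by simp) x)
    simpa [dirDeriv] using this
  have hparts : ∀ v : ℂ, ∫ x, F x • dirDeriv v (dirDeriv v φ) x = 0 := by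
    intro v
    have hψ := hφ.dirDeriv v
    have hψc := hc.dirDeriv v
    have := integral_smul_fderiv_eq_neg_fderiv_smul_of_integrable (μ := volume)
      (f := F) (g := dirDeriv v φ) (v := v) (by
        simp only [hfd]
        exact hint _ _ continuous_const hψ.continuous hψc)
      (hint _ _ hFd.continuous (hψ.dirDeriv v).continuous (hψc.dirDeriv v))
      (hint _ _ hFd.continuous hψ.continuous hψc) (fun x _ => hFd x)
      (fun x _ => hψ.differentiable (by simp) x)
    simp only [hfd] at this
    rw [integral_smul, hzero, smul_zero, neg_zero] at this
    exact this
  have hsplit : ∀ x, (a + b * x).re • planeLaplacian φ x =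
      F x • dirDeriv 1 (dirDeriv 1 φ) x + F x • dirDeriv Complex.I (dirDeriv Complex.I φ) x :=
    fun x => smul_add _ _ _
  simp only [hsplit]
  rw [integral_add (hint _ _ hFd.continuous ((hφ.dirDeriv _).dirDeriv _).continuous
      ((hc.dirDeriv _).dirDeriv _)) (hint _ _ hFd.continuous ((hφ.dirDeriv _).dirDeriv _).continuous
      ((hc.dirDeriv _).dirDeriv _)), hparts, hparts, add_zero]

theorem locallyIntegrable_log_norm_sub (ζ : ℂ) :
    LocallyIntegrable (fun x : ℂ => Real.log ‖x - ζ‖) := by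
  rw [locallyIntegrable_iff]
  intro K hK
  have h := (locallyIntegrable_iff.1 locallyIntegrable_log_norm)
    (K.image (fun x => x - ζ)) (hK.image (by fun_prop))
  have hmp : MeasurePreserving (fun x : ℂ => x - ζ) := measurePreserving_sub_right volume ζ
  have hinj : Function.Injective fun x : ℂ => x - ζ := sub_left_injective
  have := (hmp.integrableOn_comp_preimage (MeasurableEquiv.subRight ζ).measurableEmbedding).2 h
  rwa [Set.preimage_image_eq _ hinj] at this

/-! ### The logarithmic potential of the zeroes of a polynomial. -/

theorem eval_eq_leadingCoeff_mul_prod (p : Polynomial ℂ) (x : ℂ) :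
    p.eval x = p.leadingCoeff * ∏ t : p.roots.ToType, (x - t.1) := by
  conv_lhs => rw [(IsAlgClosed.splits p).eq_prod_roots]
  rw [Polynomial.eval_mul, Polynomial.eval_C, Polynomial.eval_multiset_prod, Multiset.map_map]
  congr 1
  have h := Multiset.map_univ p.roots (fun a : ℂ => x - a)
  rw [Finset.prod_eq_multiset_prod, h]
  simp

theorem log_norm_eval {p : Polynomial ℂ} (hp : p ≠ 0) {x : ℂ} (hx : p.eval x ≠ 0) :
    Real.log ‖p.eval x‖ =
      Real.log ‖p.leadingCoeff‖ + ∑ t : p.roots.ToType, Real.log ‖x - t.1‖ := by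
  have hx' := hx
  rw [eval_eq_leadingCoeff_mul_prod] at hx' ⊢
  have h2 := right_ne_zero_of_mul hx'
  rw [norm_mul, norm_prod, Real.log_mul (by simpa using hp)
    (by rw [← norm_prod]; exact norm_ne_zero_iff.2 h2), Real.log_prod]
  intro t ht
  exact norm_ne_zero_iff.2 (Finset.prod_ne_zero_iff.1 h2 t ht)

theorem ae_eval_ne_zero {p : Polynomial ℂ} (hp : p ≠ 0) : ∀ᵐ x : ℂ, p.eval x ≠ 0 := by
  rw [ae_iff]
  refine measure_mono_null (t := (p.roots.toFinset : Set ℂ)) (fun x hx => ?_)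
    (Finset.measure_zero _ _)
  simpa [hp] using hx

theorem locallyIntegrable_log_norm_eval {p : Polynomial ℂ} (hp : p ≠ 0) :
    LocallyIntegrable (fun x : ℂ => Real.log ‖p.eval x‖) := by
  have h : LocallyIntegrable (fun x : ℂ => Real.log ‖p.leadingCoeff‖ +
      ∑ t : p.roots.ToType, Real.log ‖x - t.1‖) :=
    (locallyIntegrable_const _).add
      (locallyIntegrable_finsetSum _ fun t _ => locallyIntegrable_log_norm_sub t.1)
  rw [locallyIntegrable_iff] at h ⊢
  intro K hK
  refine (h K hK).congr (ae_restrict_of_ae ?_)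
  filter_upwards [ae_eval_ne_zero hp] with x hx
  exact (log_norm_eval hp hx).symm

/-- Green's formula for the logarithmic potential of the zeroes of a polynomial, up to a harmonic
affine function. -/
theorem integral_log_norm_eval_smul_planeLaplacian {p : Polynomial ℂ} (hp : p ≠ 0) (a b : ℂ)
    {φ : ℂ → ℂ} (hφ : ContDiff ℝ (⊤ : ℕ∞) φ) (hc : HasCompactSupport φ) :
    ∫ x : ℂ, (Real.log ‖p.eval x‖ - (a + b * x).re) • planeLaplacian φ x =
      2 * Real.pi * ∑ t : p.roots.ToType, φ t.1 := by
  have hΔ := hφ.planeLaplacian.continuous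
  have hΔc := hc.planeLaplacian
  have hi : ∀ ζ : ℂ, Integrable fun x => Real.log ‖x - ζ‖ • planeLaplacian φ x := fun ζ =>
    (locallyIntegrable_log_norm_sub ζ).integrable_smul_right_of_hasCompactSupport hΔ hΔc
  have hi2 : ∀ a b : ℂ, Integrable fun x : ℂ => (a + b * x).re • planeLaplacian φ x := fun a b =>
    ((Complex.continuous_re.comp (by fun_prop : Continuous fun x => a + b * x)).smul
      hΔ).integrable_of_hasCompactSupport hΔc.smul_left
  have hae : ∀ᵐ x : ℂ, (Real.log ‖p.eval x‖ - (a + b * x).re) • planeLaplacian φ x =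
      ((∑ t : p.roots.ToType, Real.log ‖x - t.1‖ • planeLaplacian φ x)) +
        ((Real.log ‖p.leadingCoeff‖ - a) + (-b) * x).re • planeLaplacian φ x := by
    filter_upwards [ae_eval_ne_zero hp] with x hx
    rw [log_norm_eval hp hx, ← Finset.sum_smul, ← add_smul]
    congr 1
    simp only [Complex.add_re, Complex.sub_re, Complex.ofReal_re, neg_mul, Complex.neg_re]
    ring
  rw [integral_congr_ae hae, integral_add (integrable_finsetSum _ fun t _ => hi t.1) (hi2 _ _),
    integral_affine_smul_planeLaplacian hφ hc, add_zero,
    integral_finsetSum _ fun t _ => hi t.1, Finset.mul_sum]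
  exact Finset.sum_congr rfl fun t _ => integral_log_norm_sub_smul_planeLaplacian hφ hc t.1

/-! ### Products of Laplacians in several variables. -/

/-- The Laplacian of a function on `ℂ^m` in the variable number `j`. -/
def coordLaplacian {m : ℕ} (j : Fin m) (G : (Fin m → ℂ) → ℂ) : (Fin m → ℂ) → ℂ := fun x =>
  dirDeriv (Pi.single j 1) (dirDeriv (Pi.single j 1) G) x +
    dirDeriv (Pi.single j Complex.I) (dirDeriv (Pi.single j Complex.I) G) x

/-- Iterated Laplacians in the variables of a list. -/
def listLaplacian {m : ℕ} : List (Fin m) → ((Fin m → ℂ) → ℂ) → (Fin m → ℂ) → ℂ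
  | [], G => G
  | j :: l, G => listLaplacian l (coordLaplacian j G)

/-- The product of the Laplacians in all variables. -/
def fullLaplacian {m : ℕ} (G : (Fin m → ℂ) → ℂ) : (Fin m → ℂ) → ℂ :=
  listLaplacian (List.finRange m) G

section Regularity

variable {m : ℕ}

theorem ContDiff.coordLaplacian {G : (Fin m → ℂ) → ℂ} (h : ContDiff ℝ (⊤ : ℕ∞) G) (j : Fin m) :
    ContDiff ℝ (⊤ : ℕ∞) (coordLaplacian j G) :=
  ((h.dirDeriv _).dirDeriv _).add ((h.dirDeriv _).dirDeriv _)

theorem tsupport_dirDeriv_subset {E : Type*} [NormedAddCommGroup E] [NormedSpace ℝ E] (v : E)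
    (G : E → ℂ) : tsupport (dirDeriv v G) ⊆ tsupport G :=
  tsupport_fderiv_apply_subset ℝ v

theorem tsupport_coordLaplacian_subset (G : (Fin m → ℂ) → ℂ) (j : Fin m) :
    tsupport (coordLaplacian j G) ⊆ tsupport G := by
  refine (tsupport_add _ _).trans (Set.union_subset ?_ ?_) <;>
  exact (tsupport_dirDeriv_subset _ _).trans (tsupport_dirDeriv_subset _ _)

theorem contDiff_listLaplacian (l : List (Fin m)) {G : (Fin m → ℂ) → ℂ}
    (h : ContDiff ℝ (⊤ : ℕ∞) G) : ContDiff ℝ (⊤ : ℕ∞) (listLaplacian l G) := by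
  induction l generalizing G with
  | nil => exact h
  | cons j l ih => exact ih (h.coordLaplacian j)

theorem tsupport_listLaplacian_subset (l : List (Fin m)) (G : (Fin m → ℂ) → ℂ) :
    tsupport (listLaplacian l G) ⊆ tsupport G := by
  induction l generalizing G with
  | nil => exact subset_rfl
  | cons j l ih => exact (ih _).trans (tsupport_coordLaplacian_subset G j)

theorem norm_iteratedFDeriv_dirDeriv_le {E : Type*} [NormedAddCommGroup E] [NormedSpace ℝ E]
    {G : E → ℂ} (h : ContDiff ℝ (⊤ : ℕ∞) G) (v : E) (a : ℕ) (x : E) :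
    ‖iteratedFDeriv ℝ a (dirDeriv v G) x‖ ≤ ‖v‖ * ‖iteratedFDeriv ℝ (a + 1) G x‖ := by
  have h1 : ContDiff ℝ (⊤ : ℕ∞) (fderiv ℝ G) := h.fderiv_right (by exact_mod_cast le_top)
  have h2 := ContinuousLinearMap.norm_iteratedFDeriv_comp_left
    (ContinuousLinearMap.apply ℝ ℂ v) (h1.contDiffAt (x := x)) (n := a) (by exact_mod_cast le_top)
  rw [norm_iteratedFDeriv_fderiv] at h2
  refine h2.trans (mul_le_mul_of_nonneg_right ?_ (norm_nonneg _))
  refine ContinuousLinearMap.opNorm_le_bound _ (norm_nonneg _) fun L => ?_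
  rw [mul_comm]
  exact L.le_opNorm v

theorem norm_iteratedFDeriv_coordLaplacian_le {G : (Fin m → ℂ) → ℂ}
    (h : ContDiff ℝ (⊤ : ℕ∞) G) (j : Fin m) (a : ℕ) (x : Fin m → ℂ) :
    ‖iteratedFDeriv ℝ a (coordLaplacian j G) x‖ ≤ 2 * ‖iteratedFDeriv ℝ (a + 2) G x‖ := by
  have hv : ∀ v : Fin m → ℂ, ‖v‖ = 1 →
      ‖iteratedFDeriv ℝ a (dirDeriv v (dirDeriv v G)) x‖ ≤ ‖iteratedFDeriv ℝ (a + 2) G x‖ := by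
    intro v hv
    have h1 := norm_iteratedFDeriv_dirDeriv_le (h.dirDeriv v) v a x
    have h2 := norm_iteratedFDeriv_dirDeriv_le h v (a + 1) x
    rw [hv, one_mul] at h1 h2
    exact h1.trans h2
  have h1 := hv (Pi.single j 1) (by rw [Pi.norm_single, norm_one])
  have h2 := hv (Pi.single j Complex.I) (by rw [Pi.norm_single, Complex.norm_I])
  have hs : coordLaplacian j G = dirDeriv (Pi.single j 1) (dirDeriv (Pi.single j 1) G) +
    dirDeriv (Pi.single j Complex.I) (dirDeriv (Pi.single j Complex.I) G) := rfl
  rw [hs, iteratedFDeriv_add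
    (((h.dirDeriv _).dirDeriv _).of_le (by exact_mod_cast le_top))
    (((h.dirDeriv _).dirDeriv _).of_le (by exact_mod_cast le_top)), Pi.add_apply]
  refine (norm_add_le _ _).trans ?_
  linarith

theorem norm_listLaplacian_le (l : List (Fin m)) {G : (Fin m → ℂ) → ℂ}
    (h : ContDiff ℝ (⊤ : ℕ∞) G) (x : Fin m → ℂ) :
    ‖listLaplacian l G x‖ ≤ 2 ^ l.length * ‖iteratedFDeriv ℝ (2 * l.length) G x‖ := by
  -- The induction has to carry derivatives of every order, since each Laplacian raises the order by
  -- two. The factor 2 per Laplacian counts its two second derivatives along vectors of sup norm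
  -- one.
  have key : ∀ (l : List (Fin m)) (G : (Fin m → ℂ) → ℂ), ContDiff ℝ (⊤ : ℕ∞) G → ∀ a : ℕ,
      ‖iteratedFDeriv ℝ a (listLaplacian l G) x‖ ≤
        2 ^ l.length * ‖iteratedFDeriv ℝ (a + 2 * l.length) G x‖ := by
    intro l
    induction l with
    | nil => intro G _ a; simp [listLaplacian]
    | cons j l ih =>
      intro G hG a
      refine (ih _ (hG.coordLaplacian j) a).trans ?_
      have := norm_iteratedFDeriv_coordLaplacian_le hG j (a + 2 * l.length) x
      rw [List.length_cons, pow_succ, mul_assoc]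
      refine mul_le_mul_of_nonneg_left ?_ (by positivity)
      exact this
  have := key l G h 0
  rwa [norm_iteratedFDeriv_zero, zero_add] at this

theorem norm_fullLaplacian_le {G : (Fin m → ℂ) → ℂ} (h : ContDiff ℝ (⊤ : ℕ∞) G)
    (x : Fin m → ℂ) :
    ‖fullLaplacian G x‖ ≤ 2 ^ m * ‖iteratedFDeriv ℝ (2 * m) G x‖ := by
  have := norm_listLaplacian_le (List.finRange m) h x
  rwa [List.length_finRange] at this

end Regularity

/-! ### Freezing some of the variables. -/

section Slices

variable {m : ℕ}

/-- As a derivative along a line, a directional derivative depends only on the restriction to that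
line, so that it commutes with slicing as soon as the two lines agree. -/
theorem dirDeriv_eq_deriv {E : Type*} [NormedAddCommGroup E] [NormedSpace ℝ E] {G : E → ℂ}
    (h : ContDiff ℝ (⊤ : ℕ∞) G) (v x : E) :
    dirDeriv v G x = deriv (fun t : ℝ => G (x + t • v)) 0 :=
  ((h.differentiable (by simp) x).lineDeriv_eq_fderiv).symm

theorem contDiff_slice_tail {G : (Fin (m + 1) → ℂ) → ℂ} (h : ContDiff ℝ (⊤ : ℕ∞) G) (x : ℂ) :
    ContDiff ℝ (⊤ : ℕ∞) (fun y : Fin m → ℂ => G (Fin.cons x y)) := by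
  refine h.comp (contDiff_pi.2 fun j => ?_)
  refine Fin.cases ?_ (fun j => ?_) j
  · simpa using contDiff_const
  · simpa using contDiff_apply ℝ ℂ j

theorem contDiff_slice_head {G : (Fin (m + 1) → ℂ) → ℂ} (h : ContDiff ℝ (⊤ : ℕ∞) G)
    (y : Fin m → ℂ) : ContDiff ℝ (⊤ : ℕ∞) (fun x : ℂ => G (Fin.cons x y)) := by
  refine h.comp (contDiff_pi.2 fun j => ?_)
  refine Fin.cases ?_ (fun j => ?_) j
  · exact contDiff_id
  · simpa using contDiff_const

theorem hasCompactSupport_slice_tail {G : (Fin (m + 1) → ℂ) → ℂ} (h : HasCompactSupport G)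
    (x : ℂ) : HasCompactSupport (fun y : Fin m → ℂ => G (Fin.cons x y)) := by
  refine HasCompactSupport.intro (K := Fin.tail '' tsupport G)
    (IsCompact.image h (continuous_pi fun j => continuous_apply _)) fun y hy => ?_
  refine image_eq_zero_of_notMem_tsupport fun hmem => hy ⟨_, hmem, ?_⟩
  simp

theorem hasCompactSupport_slice_head {G : (Fin (m + 1) → ℂ) → ℂ} (h : HasCompactSupport G)
    (y : Fin m → ℂ) : HasCompactSupport (fun x : ℂ => G (Fin.cons x y)) := by
  refine HasCompactSupport.intro (K := (fun z : Fin (m + 1) → ℂ => z 0) '' tsupport G)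
    (IsCompact.image h (continuous_apply _)) fun x hx => ?_
  refine image_eq_zero_of_notMem_tsupport fun hmem => hx ⟨_, hmem, ?_⟩
  simp

theorem dirDeriv_slice_tail {G : (Fin (m + 1) → ℂ) → ℂ} (h : ContDiff ℝ (⊤ : ℕ∞) G) (x v : ℂ)
    (j : Fin m) : dirDeriv (Pi.single j v) (fun y : Fin m → ℂ => G (Fin.cons x y)) =
      fun y => dirDeriv (Pi.single j.succ v) G (Fin.cons x y) := by
  funext y
  rw [dirDeriv_eq_deriv (contDiff_slice_tail h x), dirDeriv_eq_deriv h]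
  congr 1
  funext t
  congr 1
  funext i
  refine Fin.cases ?_ (fun i => ?_) i
  · simp
  · by_cases hij : i = j
    · subst hij; simp
    · have : i.succ ≠ j.succ := fun h => hij (Fin.succ_injective _ h)
      simp [hij, this]

theorem dirDeriv_slice_head {G : (Fin (m + 1) → ℂ) → ℂ} (h : ContDiff ℝ (⊤ : ℕ∞) G)
    (y : Fin m → ℂ) (v : ℂ) : dirDeriv v (fun x : ℂ => G (Fin.cons x y)) =
      fun x => dirDeriv (Pi.single 0 v) G (Fin.cons x y) := by
  funext x
  rw [dirDeriv_eq_deriv (contDiff_slice_head h y), dirDeriv_eq_deriv h]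
  congr 1
  funext t
  congr 1
  funext i
  refine Fin.cases ?_ (fun i => ?_) i
  · simp
  · simp

theorem planeLaplacian_slice_head {G : (Fin (m + 1) → ℂ) → ℂ} (h : ContDiff ℝ (⊤ : ℕ∞) G)
    (y : Fin m → ℂ) : planeLaplacian (fun x : ℂ => G (Fin.cons x y)) =
      fun x => coordLaplacian 0 G (Fin.cons x y) := by
  funext x
  simp only [planeLaplacian, coordLaplacian, dirDeriv_slice_head h,
    dirDeriv_slice_head (h.dirDeriv _)]

theorem coordLaplacian_slice_tail {G : (Fin (m + 1) → ℂ) → ℂ} (h : ContDiff ℝ (⊤ : ℕ∞) G)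
    (x : ℂ) (j : Fin m) : coordLaplacian j (fun y : Fin m → ℂ => G (Fin.cons x y)) =
      fun y => coordLaplacian j.succ G (Fin.cons x y) := by
  funext y
  simp only [coordLaplacian, dirDeriv_slice_tail h, dirDeriv_slice_tail (h.dirDeriv _)]

theorem listLaplacian_slice_tail (l : List (Fin m)) {G : (Fin (m + 1) → ℂ) → ℂ}
    (h : ContDiff ℝ (⊤ : ℕ∞) G) (x : ℂ) :
    listLaplacian l (fun y : Fin m → ℂ => G (Fin.cons x y)) =
      fun y => listLaplacian (l.map Fin.succ) G (Fin.cons x y) := by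
  induction l generalizing G with
  | nil => rfl
  | cons j l ih =>
    simp only [listLaplacian, List.map_cons, coordLaplacian_slice_tail h]
    exact ih (h.coordLaplacian _)

/-- The list of indices starts with `0`, so the Laplacian in the first variable is applied
innermost. The rest acts on slices in the other variables, ready for Fubini and induction. -/
theorem fullLaplacian_cons {G : (Fin (m + 1) → ℂ) → ℂ} (h : ContDiff ℝ (⊤ : ℕ∞) G) (x : ℂ)
    (y : Fin m → ℂ) : fullLaplacian G (Fin.cons x y) =
      fullLaplacian (fun y : Fin m → ℂ => coordLaplacian 0 G (Fin.cons x y)) y := by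
  rw [fullLaplacian, fullLaplacian, listLaplacian_slice_tail _ (h.coordLaplacian 0),
    List.finRange_succ]
  rfl

end Slices

/-! ### Green's formula in several variables. -/

theorem integral_fin_succ {m : ℕ} {f : (Fin (m + 1) → ℂ) → ℂ} (hf : Integrable f) :
    ∫ x, f x = ∫ x : ℂ, ∫ y : Fin m → ℂ, f (Fin.cons x y) := by
  have hmp := (volume_preserving_piFinSuccAbove (fun _ : Fin (m + 1) => ℂ) 0).symm
  have hs : ∀ p : ℂ × (Fin m → ℂ), (MeasurableEquiv.piFinSuccAbove (fun _ : Fin (m + 1) => ℂ)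
      0).symm p = Fin.cons p.1 p.2 := fun p => by
    simp [MeasurableEquiv.piFinSuccAbove]
    rfl
  have hi := (hmp.integrable_comp_emb (MeasurableEquiv.measurableEmbedding _)).2 hf
  rw [← hmp.integral_comp', Measure.volume_eq_prod, integral_prod]
  · simp only [hs]
  · exact hi

/-- Each potential may be cut off outside a ball whose polydisc contains the support of `H`; the
cut-off potentials are integrable, hence so is their product. -/
theorem integrable_prod_smul_of_locallyIntegrable {m : ℕ} {U : Fin m → ℂ → ℝ}
    (hU : ∀ j, LocallyIntegrable (U j)) {H : (Fin m → ℂ) → ℂ} (hH : Continuous H)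
    (hc : HasCompactSupport H) :
    Integrable fun x : Fin m → ℂ => (∏ j, U j (x j)) • H x := by
  obtain ⟨R, hR, hKR⟩ := hc.isBounded.subset_ball_lt 0 0
  obtain ⟨M, hM⟩ := hc.exists_bound_of_continuous hH
  let V : Fin m → ℂ → ℝ := fun j => (Metric.closedBall (0 : ℂ) R).indicator (U j)
  have hV : Integrable fun x : Fin m → ℂ => ∏ j, V j (x j) := by
    refine Integrable.fintype_prod fun j => ?_
    exact (((locallyIntegrable_iff.1 (hU j)) _ (isCompact_closedBall 0 R)).integrable_indicator
      Metric.isClosed_closedBall.measurableSet)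
  have h := hV.smul_bdd M hH.aestronglyMeasurable (Filter.Eventually.of_forall hM)
  refine h.congr (Filter.Eventually.of_forall fun x => ?_)
  show (∏ j, V j (x j)) • H x = _
  by_cases hx : x ∈ tsupport H
  · have hb := hKR hx
    rw [mem_ball_zero_iff] at hb
    congr 1
    refine Finset.prod_congr rfl fun j _ => ?_
    refine Set.indicator_of_mem ?_ _
    rw [mem_closedBall_zero_iff]
    exact (norm_le_pi_norm x j).trans hb.le
  · simp only [image_eq_zero_of_notMem_tsupport hx, smul_zero]

/-- Green's formula in several variables, for potentials `U j` that represent the same points. -/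
theorem integral_prod_smul_fullLaplacian {R : Type*} [Fintype R] (ζ : R → ℂ) {m : ℕ}
    (U : Fin m → ℂ → ℝ) (hU : ∀ j, LocallyIntegrable (U j))
    (hgreen : ∀ j (φ : ℂ → ℂ), ContDiff ℝ (⊤ : ℕ∞) φ → HasCompactSupport φ →
      ∫ x, U j x • planeLaplacian φ x = 2 * Real.pi * ∑ r, φ (ζ r))
    {G : (Fin m → ℂ) → ℂ} (hG : ContDiff ℝ (⊤ : ℕ∞) G) (hc : HasCompactSupport G) :
    ∫ x : Fin m → ℂ, (∏ j, U j (x j)) • fullLaplacian G x =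
      (2 * Real.pi) ^ m * ∑ t : Fin m → R, G (fun j => ζ (t j)) := by
  induction m with
  | zero =>
    rw [Measure.volume_pi_eq_dirac, integral_dirac]
    simp only [Finset.univ_eq_empty, Finset.prod_empty, one_smul, pow_zero, one_mul,
      Finset.univ_unique, Finset.sum_singleton]
    show G _ = G _
    congr 1
    exact Subsingleton.elim _ _
  | succ m ih =>
    have hfull : ContDiff ℝ (⊤ : ℕ∞) (fullLaplacian G) := contDiff_listLaplacian _ hG
    have hfc : HasCompactSupport (fullLaplacian G) :=
      hc.mono' ((subset_tsupport _).trans (tsupport_listLaplacian_subset _ G))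
    have h0 := hG.coordLaplacian (0 : Fin (m + 1))
    have h0c : HasCompactSupport (coordLaplacian 0 G) :=
      hc.mono' ((subset_tsupport _).trans (tsupport_coordLaplacian_subset G 0))
    rw [integral_fin_succ (integrable_prod_smul_of_locallyIntegrable hU hfull.continuous hfc)]
    -- The induction hypothesis, applied to the slice of the Laplacian in variable `0`, replaces the
    -- other variables by zeroes. The one-variable formula then handles the outer integral.
    have hinner : ∀ x : ℂ, ∫ y : Fin m → ℂ,
        (∏ j, U j ((Fin.cons x y : Fin (m + 1) → ℂ) j)) • fullLaplacian G (Fin.cons x y) =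
        (2 * Real.pi) ^ m * ∑ t : Fin m → R,
          U 0 x • planeLaplacian (fun x => G (Fin.cons x fun j => ζ (t j))) x := by
      intro x
      have := ih (fun j => U j.succ) (fun j => hU _) (fun j => hgreen _)
        (contDiff_slice_tail h0 x) (hasCompactSupport_slice_tail h0c x)
      simp only [Fin.prod_univ_succ, Fin.cons_zero, Fin.cons_succ, fullLaplacian_cons hG,
        mul_smul, planeLaplacian_slice_head hG]
      rw [integral_smul, this, ← Finset.smul_sum, mul_smul_comm]
    have hi : ∀ t : Fin m → R, Integrable fun x =>
        U 0 x • planeLaplacian (fun x => G (Fin.cons x fun j => ζ (t j))) x := fun t =>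
      (hU 0).integrable_smul_right_of_hasCompactSupport
        (contDiff_slice_head hG _).planeLaplacian.continuous
        (hasCompactSupport_slice_head hc _).planeLaplacian
    simp only [hinner]
    rw [integral_const_mul, integral_finsetSum _ fun t _ => hi t]
    have : ∀ t : Fin m → R, ∫ x, U 0 x • planeLaplacian
        (fun x => G (Fin.cons x fun j => ζ (t j))) x =
        2 * Real.pi * ∑ r, G (Fin.cons (ζ r) fun j => ζ (t j)) := fun t =>
      hgreen 0 _ (contDiff_slice_head hG _) (hasCompactSupport_slice_head hc _)
    simp only [this]
    rw [← Finset.mul_sum, ← mul_assoc, ← pow_succ, Finset.sum_comm]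
    congr 1
    rw [← (Fin.consEquiv fun _ : Fin (m + 1) => R).sum_comp, Fintype.sum_prod_type]
    refine Finset.sum_congr rfl fun r _ => Finset.sum_congr rfl fun t _ => ?_
    congr 1
    funext j
    refine Fin.cases ?_ (fun j => ?_) j <;> simp [Fin.consEquiv]

theorem integral_prod_log_smul_fullLaplacian {p : Polynomial ℂ} (hp : p ≠ 0) {m : ℕ}
    (a b : Fin m → ℂ) {G : (Fin m → ℂ) → ℂ} (hG : ContDiff ℝ (⊤ : ℕ∞) G)
    (hc : HasCompactSupport G) :
    ∫ x : Fin m → ℂ, (∏ j, (Real.log ‖p.eval (x j)‖ - (a j + b j * x j).re)) •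
        fullLaplacian G x =
      (2 * Real.pi) ^ m * ∑ t : Fin m → p.roots.ToType, G (fun j => (t j).1) := by
  refine integral_prod_smul_fullLaplacian (fun t : p.roots.ToType => t.1)
    (fun j x => Real.log ‖p.eval x‖ - (a j + b j * x).re) (fun j => ?_)
    (fun j φ hφ hc => integral_log_norm_eval_smul_planeLaplacian hp (a j) (b j) hφ hc) hG hc
  exact (locallyIntegrable_log_norm_eval hp).sub (Continuous.locallyIntegrable
    (Complex.continuous_re.comp (by fun_prop : Continuous fun x => a j + b j * x)))

/-! ### Tuples of zeroes with and without repeated indices. -/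

/-- The sum of `G` over the `m`-tuples of roots of `p` with distinct indices. -/
def distinctRootSum {m : ℕ} (G : (Fin m → ℂ) → ℂ) (p : Polynomial ℂ) : ℂ :=
  ∑ s : Fin m ↪ p.roots.ToType, G fun j => (s j).1

/-- The sum of `G` over all `m`-tuples of roots of `p`. -/
def rootSum {m : ℕ} (G : (Fin m → ℂ) → ℂ) (p : Polynomial ℂ) : ℂ :=
  ∑ t : Fin m → p.roots.ToType, G fun j => (t j).1

instance setoidFintype (α : Type) [Fintype α] : Fintype (Setoid α) :=
  have : Finite (Setoid α) := Finite.of_injective (fun r a b => r.r a b) fun r s h => by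
    ext a b
    exact iff_of_eq (congrFun (congrFun h a) b)
  Fintype.ofFinite _

section SetoidSums

variable {α R : Type} [Fintype α] [Fintype R]

/-- Maps with a given kernel are embeddings of the quotient. -/
def kerEqEquivEmbedding (r : Setoid α) : {t : α → R // Setoid.ker t = r} ≃ (Quotient r ↪ R) where
  toFun t := ⟨Quotient.lift t.1 fun a b hab => by
      have h : Setoid.ker t.1 a b := by rw [t.2]; exact hab
      exact h, by
    rintro ⟨a⟩ ⟨b⟩ hab
    refine Quotient.sound (s := r) ?_
    have h : Setoid.ker t.1 a b := hab
    rw [t.2] at h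
    exact h⟩
  invFun s := ⟨fun a => s (Quotient.mk r a), by
    ext a b
    rw [Setoid.ker_def]
    exact ⟨fun h => Quotient.exact (s.injective h), fun h => congrArg s (Quotient.sound h)⟩⟩
  left_inv t := rfl
  right_inv s := by
    ext x
    induction x using Quotient.inductionOn
    rfl

theorem sum_eq_sum_setoid_sum_embedding [DecidableEq α]
    [∀ r : Setoid α, Fintype (Quotient r ↪ R)] (g : (α → R) → ℂ) :
    ∑ t, g t = ∑ r : Setoid α, ∑ s : Quotient r ↪ R, g fun a => s (Quotient.mk r a) := by
  classical
  rw [← Finset.sum_fiberwise Finset.univ (fun t : α → R => Setoid.ker t) g]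
  refine Finset.sum_congr rfl fun r _ => ?_
  rw [← Finset.sum_subtype_eq_sum_filter, Finset.subtype_univ]
  exact Fintype.sum_equiv (kerEqEquivEmbedding r) _ _ fun t => rfl

end SetoidSums

/-- A tuple of indices is an injective map on the quotient by its coincidence relation. The trivial
relation gives the sum over distinct indices; every other relation has fewer than `m` classes, so
the correction consists of sums of the same kind in fewer variables. Surjectivity of `q` means that
each new variable stands for one of the old ones and inherits its localization. The data do not
depend on the polynomial. -/
theorem exists_rootSum_eq_distinctRootSum_add (m : ℕ) :
    ∃ (S : Type) (_ : Fintype S) (d : S → ℕ) (q : ∀ s, Fin m → Fin (d s)),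
      (∀ s, d s < m) ∧ (∀ s, Function.Surjective (q s)) ∧
      ∀ (G : (Fin m → ℂ) → ℂ) (p : Polynomial ℂ), rootSum G p = distinctRootSum G p +
        ∑ s, distinctRootSum (fun w : Fin (d s) → ℂ => G fun j => w (q s j)) p := by
  classical
  have hcard : ∀ r : Setoid (Fin m), r ≠ ⊥ → Fintype.card (Quotient r) < m := by
    intro r hr
    have h1 : Function.Surjective (Quotient.mk r) := Quotient.mk_surjective
    have h2 := Fintype.card_le_of_surjective _ h1
    rw [Fintype.card_fin] at h2
    refine lt_of_le_of_ne h2 fun heq => hr ?_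
    have hb : Function.Bijective (Quotient.mk r) :=
      (Fintype.bijective_iff_surjective_and_card _).2 ⟨h1, by rw [heq, Fintype.card_fin]⟩
    ext a b
    rw [Setoid.bot_def]
    exact ⟨fun h => hb.1 (Quotient.sound h), fun h => h ▸ r.refl a⟩
  refine ⟨{r : Setoid (Fin m) // r ≠ ⊥}, inferInstance, fun r => Fintype.card (Quotient r.1),
    fun r j => Fintype.equivFin _ (Quotient.mk r.1 j), fun r => hcard r.1 r.2,
    fun r => (Fintype.equivFin _).surjective.comp Quotient.mk_surjective, fun G p => ?_⟩
  refine (sum_eq_sum_setoid_sum_embedding (fun t : Fin m → p.roots.ToType =>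
    G fun j => (t j).1)).trans ?_
  rw [Fintype.sum_eq_add_sum_subtype_ne _ (⊥ : Setoid (Fin m))]
  congr 1
  · let e : Quotient (⊥ : Setoid (Fin m)) ≃ Fin m :=
      { toFun := Quotient.lift id fun a b h => h
        invFun := Quotient.mk _
        left_inv := by rintro ⟨a⟩; rfl
        right_inv := fun a => rfl }
    exact Fintype.sum_equiv (Equiv.embeddingCongr e (Equiv.refl _)) _ _ fun s => rfl
  · refine Finset.sum_congr rfl fun r _ => ?_
    refine Fintype.sum_equiv (Equiv.embeddingCongr (Fintype.equivFin _) (Equiv.refl _)) _ _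
      fun s => ?_
    congr 1
    funext j
    simp [Equiv.embeddingCongr]

theorem card_roots_toType_le {p : Polynomial ℂ} {n : ℕ} (hp : p.natDegree ≤ n) :
    Fintype.card p.roots.ToType ≤ n := by
  rw [Multiset.card_coe]
  exact (Polynomial.card_roots' _).trans hp

/-- A deterministic bound, polynomial in `n`, for use on events of small probability and for bounded
`n`. -/
theorem norm_rootSum_le {m n : ℕ} {G : (Fin m → ℂ) → ℂ} {K : ℝ} (hK : ∀ w, ‖G w‖ ≤ K)
    {p : Polynomial ℂ} (hp : p.natDegree ≤ n) : ‖rootSum G p‖ ≤ K * (n : ℝ) ^ m := by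
  have hK0 : 0 ≤ K := (norm_nonneg _).trans (hK 0)
  refine (norm_sum_le_of_le _ fun t _ => hK _).trans ?_
  rw [Finset.sum_const, nsmul_eq_mul, Finset.card_univ, Fintype.card_fun, Fintype.card_fin,
    mul_comm]
  refine mul_le_mul_of_nonneg_left ?_ hK0
  exact_mod_cast Nat.pow_le_pow_left (card_roots_toType_le hp) m

theorem norm_distinctRootSum_le {m n : ℕ} {G : (Fin m → ℂ) → ℂ} {K : ℝ} (hK : ∀ w, ‖G w‖ ≤ K)
    {p : Polynomial ℂ} (hp : p.natDegree ≤ n) : ‖distinctRootSum G p‖ ≤ K * (n : ℝ) ^ m := by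
  have hK0 : 0 ≤ K := (norm_nonneg _).trans (hK 0)
  refine (norm_sum_le_of_le _ fun t _ => hK _).trans ?_
  rw [Finset.sum_const, nsmul_eq_mul, Finset.card_univ, Fintype.card_embedding_eq,
    Fintype.card_fin, mul_comm]
  refine mul_le_mul_of_nonneg_left ?_ hK0
  exact_mod_cast (Nat.descFactorial_le_pow _ _).trans
    (Nat.pow_le_pow_left (card_roots_toType_le hp) m)

theorem integral_zeroTupleMeasure {m : ℕ} (G : (Fin m → ℂ) → ℂ) (p : Polynomial ℂ) :
    ∫ x, G x ∂(zeroTupleMeasure m p) = distinctRootSum G p := by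
  rw [zeroTupleMeasure, integral_finsetSum_measure]
  · simp only [integral_dirac]; rfl
  · intro s _
    exact integrable_dirac (by simp)

theorem natDegree_flatPolynomial_le (n : ℕ) (a : Fin (n + 1) → ℂ) :
    (flatPolynomial n a).natDegree ≤ n := by
  unfold flatPolynomial coeffPolynomial
  refine Polynomial.natDegree_sum_le_of_forall_le _ _ fun i _ => ?_
  exact (Polynomial.natDegree_C_mul_X_pow_le _ _).trans (by omega)

/-- The index set of the sum varies with the coefficients, so measurability is read off from the sum
being the integral of `G` against a finite kernel. -/
theorem stronglyMeasurable_distinctRootSum (n : ℕ) {m : ℕ} {G : (Fin m → ℂ) → ℂ}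
    (hG : Continuous G) :
    StronglyMeasurable fun a : Fin (n + 1) → ℂ => distinctRootSum G (flatPolynomial n a) := by
  have hmeas : Measurable fun a : Fin (n + 1) → ℂ => zeroTupleMeasure m (flatPolynomial n a) := by
    unfold flatPolynomial coeffPolynomial
    have h : Measurable fun (a : Fin (n + 1) → ℂ) i => flatCoeff n i * a i :=
      measurable_pi_iff.2 fun i => (measurable_pi_apply i).const_mul _
    exact (measurable_zeroTupleMeasure n m).comp h
  let κ : Kernel (Fin (n + 1) → ℂ) (Fin m → ℂ) :=
    ⟨fun a => zeroTupleMeasure m (flatPolynomial n a), hmeas⟩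
  have hfin : IsFiniteKernel κ := by
    refine ⟨⟨((n ^ m : ℕ) : ℝ≥0∞), ENNReal.natCast_lt_top _, fun a => ?_⟩⟩
    show zeroTupleMeasure m (flatPolynomial n a) Set.univ ≤ _
    simp only [zeroTupleMeasure, Measure.finsetSum_apply, measure_univ, Finset.sum_const,
      Finset.card_univ, nsmul_eq_mul, mul_one, Fintype.card_embedding_eq, Fintype.card_fin]
    rw [Nat.cast_le]
    exact (Nat.descFactorial_le_pow _ _).trans
      (Nat.pow_le_pow_left (card_roots_toType_le (natDegree_flatPolynomial_le n a)) m)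
  have h : StronglyMeasurable fun a => ∫ x, G x ∂κ a :=
    hG.stronglyMeasurable.integral_kernel
  convert h using 2 with a
  exact (integral_zeroTupleMeasure G _).symm

/-- `H` has second order Taylor expansions with uniform bounds at scale `B⁻¹`. -/
def TaylorBound {V : Type*} [NormedAddCommGroup V] [NormedSpace ℝ V] (A B p : ℝ) (H : V → ℝ) :
    Prop :=
  ∀ u, ∃ (l : V →ₗ[ℝ] ℝ) (b : V →ₗ[ℝ] V →ₗ[ℝ] ℝ), ∀ v,
    |l v| ≤ A * (B * ‖v‖) ∧ |b v v| ≤ A * (B * ‖v‖) ^ 2 ∧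
      |H (u + v) - H u - l v - b v v| ≤ A * (B * ‖v‖) ^ p

/-! ### Calculus of second order Taylor bounds with a remainder of order `p`. -/

namespace TaylorBound

variable {V : Type*} [NormedAddCommGroup V] [NormedSpace ℝ V] {A B p : ℝ} {H : V → ℝ}

theorem const (hA : 0 ≤ A) (hB : 0 ≤ B) (c : ℝ) : TaylorBound A B p (fun _ : V => c) :=
  fun u => ⟨0, 0, fun v => by
    have h1 : 0 ≤ A * (B * ‖v‖) := by positivity
    have h2 : 0 ≤ A * (B * ‖v‖) ^ 2 := by positivity
    have h3 : 0 ≤ A * (B * ‖v‖) ^ p := by positivity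
    simpa using ⟨h1, h2, h3⟩⟩

theorem mono {A' B' : ℝ} (h : TaylorBound A B p H) (hA : 0 ≤ A) (hB : 0 ≤ B) (hp : 0 ≤ p)
    (hAA : A ≤ A') (hBB : B ≤ B') : TaylorBound A' B' p H := by
  intro u
  obtain ⟨l, b, hlb⟩ := h u
  refine ⟨l, b, fun v => ?_⟩
  obtain ⟨h1, h2, h3⟩ := hlb v
  have hX : B * ‖v‖ ≤ B' * ‖v‖ := by gcongr
  have hX0 : 0 ≤ B * ‖v‖ := by positivity
  have hA' := hA.trans hAA
  refine ⟨h1.trans (by gcongr), h2.trans (by gcongr), h3.trans ?_⟩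
  exact mul_le_mul hAA (Real.rpow_le_rpow hX0 hX hp) (by positivity) hA'

theorem sub {A' : ℝ} {H' : V → ℝ} (h : TaylorBound A B p H) (h' : TaylorBound A' B p H') :
    TaylorBound (A + A') B p (fun u => H u - H' u) := by
  intro u
  obtain ⟨l, b, hlb⟩ := h u
  obtain ⟨l', b', hlb'⟩ := h' u
  refine ⟨l - l', b - b', fun v => ?_⟩
  obtain ⟨h1, h2, h3⟩ := hlb v
  obtain ⟨h1', h2', h3'⟩ := hlb' v
  simp only [LinearMap.sub_apply, add_mul]
  refine ⟨(abs_sub _ _).trans (add_le_add h1 h1'), (abs_sub _ _).trans (add_le_add h2 h2'), ?_⟩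
  refine le_trans (le_of_eq ?_) ((abs_sub _ _).trans (add_le_add h3 h3'))
  congr 1
  ring

theorem const_add (h : TaylorBound A B p H) (c : ℝ) : TaylorBound A B p (fun u => c + H u) := by
  intro u
  obtain ⟨l, b, hlb⟩ := h u
  refine ⟨l, b, fun v => ⟨(hlb v).1, (hlb v).2.1, ?_⟩⟩
  rw [add_sub_add_left_eq_sub]
  exact (hlb v).2.2

theorem comp_linear {W : Type*} [NormedAddCommGroup W] [NormedSpace ℝ W]
    (h : TaylorBound A B p H) (hA : 0 ≤ A) (hB : 0 ≤ B) (hp : 0 ≤ p) (T : W →ₗ[ℝ] V) {s : ℝ}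
    (hs : ∀ w, ‖T w‖ ≤ s * ‖w‖) : TaylorBound A (B * s) p (fun w => H (T w)) := by
  intro u
  obtain ⟨l, b, hlb⟩ := h (T u)
  refine ⟨l.comp T, b.compl₁₂ T T, fun v => ?_⟩
  obtain ⟨h1, h2, h3⟩ := hlb (T v)
  have hX : B * ‖T v‖ ≤ B * s * ‖v‖ := by rw [mul_assoc]; gcongr; exact hs v
  have hX0 : 0 ≤ B * ‖T v‖ := by positivity
  simp only [LinearMap.comp_apply, LinearMap.compl₁₂_apply, map_add]
  refine ⟨h1.trans (by gcongr), h2.trans (by gcongr), h3.trans ?_⟩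
  exact mul_le_mul_of_nonneg_left (Real.rpow_le_rpow hX0 hX hp) hA

/-- The Taylor polynomials are multiplied and cut at order two; the bilinear form need not be
symmetric, so the product of the linear parts may be added as it is. With `X = B‖v‖`: if `X ≤ 1`,
the leftover terms are `O(X^p)` or `O(X³)`, and `X³ ≤ X^p` as `p ≤ 3`; if `X ≥ 1`, every term is at
most `X² ≤ X^p`, as `p ≥ 2`. In both cases the coefficients add up to 7. -/
theorem mul {A' : ℝ} {H' : V → ℝ} (h : TaylorBound A B p H) (h' : TaylorBound A' B p H')
    (hB : 0 ≤ B) (hp2 : 2 ≤ p) (hp3 : p ≤ 3) (hH : ∀ u, |H u| ≤ A) (hH' : ∀ u, |H' u| ≤ A') :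
    TaylorBound (7 * (A * A')) B p (fun u => H u * H' u) := by
  intro u
  have hA : 0 ≤ A := (abs_nonneg _).trans (hH u)
  have hA' : 0 ≤ A' := (abs_nonneg _).trans (hH' u)
  obtain ⟨l, b, hlb⟩ := h u
  obtain ⟨l', b', hlb'⟩ := h' u
  refine ⟨H u • l' + H' u • l, H u • b' + H' u • b + l.smulRight l', fun v => ?_⟩
  obtain ⟨h1, h2, h3⟩ := hlb v
  obtain ⟨h1', h2', h3'⟩ := hlb' v
  have hX0 : 0 ≤ B * ‖v‖ := by positivity
  set X := B * ‖v‖ with hX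
  simp only [LinearMap.add_apply, LinearMap.smul_apply, smul_eq_mul, LinearMap.smulRight_apply]
  have hh := hH u
  have hh' := hH' u
  have hs := hH (u + v)
  have hs' := hH' (u + v)
  set x := H u
  set x' := H' u
  set y := H (u + v)
  set y' := H' (u + v)
  set q := b v v
  set q' := b' v v
  set k := l v
  set k' := l' v
  have hAA : 0 ≤ A * A' := mul_nonneg hA hA'
  have mm : ∀ {α β a a' : ℝ}, |α| ≤ A * a → |β| ≤ A' * a' → 0 ≤ a → 0 ≤ a' →
      |α * β| ≤ A * A' * (a * a') := by
    intro α β a a' hα hβ ha ha'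
    rw [abs_mul, mul_mul_mul_comm]
    exact mul_le_mul hα hβ (abs_nonneg _) (by positivity)
  rw [← mul_one A] at hh hs
  rw [← mul_one A'] at hh' hs'
  have e1 := mm hh h1' zero_le_one hX0
  have e2 := mm h1 hh' hX0 zero_le_one
  have e3 := mm hh h2' zero_le_one (by positivity)
  have e4 := mm h2 hh' (by positivity) zero_le_one
  have e5 := mm h1 h1' hX0 hX0
  have hXX : 0 ≤ A * A' * X := by positivity
  have hX2 : 0 ≤ A * A' * X ^ 2 := by positivity
  rw [one_mul] at e1 e3
  rw [mul_one] at e2 e4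
  rw [abs_le] at e1 e2 e3 e4 e5
  refine ⟨?_, ?_, ?_⟩
  · rw [abs_le]; constructor <;> linarith
  · have : A * A' * (X * X) = A * A' * X ^ 2 := by ring
    rw [abs_le]; constructor <;> linarith
  · rcases le_total X 1 with hX1 | hX1
    · have hpow : X ^ 3 ≤ X ^ p := by
        rcases hX0.eq_or_lt with h0 | h0
        · rw [← h0, zero_pow (by norm_num)]; positivity
        · rw [← Real.rpow_natCast]
          exact Real.rpow_le_rpow_of_exponent_ge h0 hX1 (by exact_mod_cast hp3)
      have hPp : 0 ≤ X ^ p := by positivity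
      generalize X ^ p = Y at *
      clear_value X x x' y y' q q' k k'
      have hP' : |x' + k' + q'| ≤ A' * 3 := by
        have : X ^ 2 ≤ 1 := by nlinarith
        calc |x' + k' + q'| ≤ |x'| + |k'| + |q'| := abs_add_three _ _ _
          _ ≤ A' * 1 + A' * X + A' * X ^ 2 := add_le_add (add_le_add hh' h1') h2'
          _ = A' * (1 + X + X ^ 2) := by ring
          _ ≤ A' * 3 := mul_le_mul_of_nonneg_left (by linarith) hA'
      have f1 := mm hs h3' zero_le_one hPp
      have f2 := mm h3 hP' hPp (by norm_num)
      have f3 := mm h1 h2' hX0 (by positivity)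
      have f4 := mm h2 h1' (by positivity) hX0
      have f5 := mm h2 h2' (by positivity) (by positivity)
      have g3 : A * A' * (X * X ^ 2) ≤ A * A' * Y :=
        mul_le_mul_of_nonneg_left (le_trans (by ring_nf; rfl) hpow) hAA
      have g4 : A * A' * (X ^ 2 * X) ≤ A * A' * Y :=
        mul_le_mul_of_nonneg_left (le_trans (by ring_nf; rfl) hpow) hAA
      have g5 : A * A' * (X ^ 2 * X ^ 2) ≤ A * A' * Y := by
        refine mul_le_mul_of_nonneg_left (le_trans ?_ hpow) hAA
        nlinarith [pow_nonneg hX0 3]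
      have key : y * y' - x * x' - (x * k' + x' * k) - (x * q' + x' * q + k * k') =
          y * (y' - x' - k' - q') + (y - x - k - q) * (x' + k' + q') + k * q' + q * k' +
            q * q' := by ring
      rw [key]
      rw [abs_le] at f1 f2 f3 f4 f5 ⊢
      constructor <;> linarith
    · have hpow : X ^ 2 ≤ X ^ p := by
        rw [← Real.rpow_natCast]
        exact Real.rpow_le_rpow_of_exponent_le hX1 (by exact_mod_cast hp2)
      have f1 := mm hs hs' zero_le_one zero_le_one
      have f2 := mm hh hh' zero_le_one zero_le_one
      have g1 : A * A' * X ≤ A * A' * X ^ p :=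
        mul_le_mul_of_nonneg_left (le_trans (by nlinarith) hpow) hAA
      have g2 : A * A' * X ^ 2 ≤ A * A' * X ^ p := mul_le_mul_of_nonneg_left hpow hAA
      have g0 : A * A' ≤ A * A' * X := le_mul_of_one_le_right hAA hX1
      have g3 : A * A' * (X * X) = A * A' * X ^ 2 := by ring
      rw [mul_one, mul_one] at f1 f2
      rw [abs_le] at f1 f2 ⊢
      constructor <;> linarith

theorem prod {ι : Type*} (s : Finset ι) {F : ι → V → ℝ} (h : ∀ i, TaylorBound A B p (F i))
    (hB : 0 ≤ B) (hp2 : 2 ≤ p) (hp3 : p ≤ 3) (hA : 0 ≤ A) (hF : ∀ i u, |F i u| ≤ A) :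
    TaylorBound ((7 * A) ^ s.card) B p (fun u => ∏ i ∈ s, F i u) ∧
      ∀ u, |∏ i ∈ s, F i u| ≤ (7 * A) ^ s.card := by
  classical
  induction s using Finset.induction_on with
  | empty => simpa using const (p := p) zero_le_one hB 1
  | insert a s ha ih =>
    simp only [Finset.prod_insert ha, Finset.card_insert_of_notMem ha]
    have hc : (7 * A) ^ (s.card + 1) = 7 * (A * (7 * A) ^ s.card) := by ring
    rw [hc]
    refine ⟨(h a).mul ih.1 hB hp2 hp3 (hF a) ih.2, fun u => ?_⟩
    rw [abs_mul]
    have : |F a u| * |∏ i ∈ s, F i u| ≤ A * (7 * A) ^ s.card :=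
      mul_le_mul (hF a u) (ih.2 u) (abs_nonneg _) hA
    have : 0 ≤ A * (7 * A) ^ s.card := by positivity
    linarith

end TaylorBound

/-! ### Regularized and truncated logarithms. -/

/-- A smooth regularization of `log ‖u‖` at scale one. -/
def smoothLog (u : ℂ) : ℝ := Real.log (1 + ‖u‖ ^ 2) / 2

theorem continuous_smoothLog : Continuous smoothLog :=
  (Continuous.log (by fun_prop) fun u => by positivity).div_const 2

/-- From `1 + ‖u + v‖² ≤ (1 + ‖u‖²)(1 + ‖v‖)²`, by taking half of the logarithm. -/
theorem smoothLog_add_sub_le (u v : ℂ) : smoothLog (u + v) - smoothLog u ≤ ‖v‖ := by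
  have h : 1 + ‖u + v‖ ^ 2 ≤ (1 + ‖u‖ ^ 2) * (1 + ‖v‖) ^ 2 := by
    have h1 : ‖u + v‖ ^ 2 ≤ (‖u‖ + ‖v‖) ^ 2 := by gcongr; exact norm_add_le u v
    nlinarith [norm_nonneg u, norm_nonneg v, mul_nonneg (sq_nonneg (‖u‖ - 1)) (norm_nonneg v),
      mul_nonneg (sq_nonneg ‖u‖) (sq_nonneg ‖v‖)]
  have h2 := Real.log_le_log (by positivity) h
  rw [Real.log_mul (by positivity) (by positivity), Real.log_pow] at h2
  have h3 := Real.log_le_sub_one_of_pos (show 0 < 1 + ‖v‖ by positivity)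
  push_cast at h2
  unfold smoothLog
  linarith

theorem abs_smoothLog_add_sub_le (u v : ℂ) : |smoothLog (u + v) - smoothLog u| ≤ ‖v‖ := by
  rw [abs_le]
  have h := smoothLog_add_sub_le (u + v) (-v)
  rw [add_neg_cancel_right, norm_neg] at h
  exact ⟨by linarith, smoothLog_add_sub_le u v⟩

/-- With `s = 1 + ‖u‖²` the increment is `log(1 + y)/2`, where `y = (2⟨u,v⟩ + ‖v‖²)/s`. As `‖u‖ ≤
s/2`, `y = O(‖v‖)` uniformly in `u`, so for small `v` the second order expansion of the logarithm
suffices. For `‖v‖ ≥ 1/4` the Lipschitz bound and the sizes of the linear and quadratic parts are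
all `O(‖v‖²)`. -/
theorem taylorBound_smoothLog {p : ℝ} (hp2 : 2 ≤ p) (hp3 : p ≤ 3) :
    TaylorBound 36 1 p smoothLog := by
  intro u
  let L : ℂ →ₗ[ℝ] ℝ := (innerSL ℝ u : ℂ →L[ℝ] ℝ).toLinearMap
  let I2 : ℂ →ₗ[ℝ] ℂ →ₗ[ℝ] ℝ := innerₗ ℂ
  set s : ℝ := 1 + ‖u‖ ^ 2 with hs
  have hs1 : 1 ≤ s := by rw [hs]; nlinarith [sq_nonneg ‖u‖]
  have hs0 : 0 < s := by linarith
  -- These are the terms of order one and two in `v` of `y/2 - y²/4`.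
  refine ⟨s⁻¹ • L, (2 * s)⁻¹ • I2 - (s ^ 2)⁻¹ • L.smulRight L, fun v => ?_⟩
  have hL : L v = inner ℝ u v := rfl
  have hI : I2 v v = ‖v‖ ^ 2 := real_inner_self_eq_norm_sq v
  simp only [LinearMap.sub_apply, LinearMap.smul_apply, smul_eq_mul, LinearMap.smulRight_apply,
    hL, hI, one_mul]
  set X := ‖v‖ with hX
  have hX0 : 0 ≤ X := norm_nonneg v
  set k : ℝ := inner ℝ u v
  have hk : |k| ≤ ‖u‖ * X := abs_real_inner_le_norm u v
  have hus : ‖u‖ ≤ s / 2 := by rw [hs]; nlinarith [sq_nonneg (‖u‖ - 1)]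
  have hks : |s⁻¹ * k| ≤ X / 2 := by
    rw [abs_mul, abs_of_pos (inv_pos.2 hs0), inv_mul_le_iff₀ hs0]
    nlinarith
  set r := s⁻¹ * k with hr
  set w := s⁻¹ with hw
  have hw1 : w ≤ 1 := inv_le_one_of_one_le₀ hs1
  have hw0 : 0 < w := inv_pos.2 hs0
  have hq : (2 * s)⁻¹ * X ^ 2 - (s ^ 2)⁻¹ * (k * k) = w * X ^ 2 / 2 - r ^ 2 := by
    rw [hr, hw]; field_simp
  have hr2 : r ^ 2 ≤ X ^ 2 / 4 := by
    rw [← sq_abs]; nlinarith [abs_nonneg r]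
  have hwX : w * X ^ 2 ≤ X ^ 2 := mul_le_of_le_one_left (sq_nonneg X) hw1
  have hwX0 : 0 ≤ w * X ^ 2 := by positivity
  have hr0 := sq_nonneg r
  have hb : |w * X ^ 2 / 2 - r ^ 2| ≤ X ^ 2 := by
    rw [abs_le]; constructor <;> linarith
  rw [hq]
  refine ⟨by linarith, by linarith [sq_nonneg X], ?_⟩
  clear hL hI
  rcases le_total X (1 / 4) with h4 | h4
  · have hpow : X ^ 3 ≤ X ^ p := by
      rcases hX0.eq_or_lt with h0 | h0
      · rw [← h0, zero_pow (by norm_num)]; positivity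
      · rw [← Real.rpow_natCast]
        exact Real.rpow_le_rpow_of_exponent_ge h0 (by linarith) (by exact_mod_cast hp3)
    set y : ℝ := 2 * r + w * X ^ 2 with hy
    have hyX : |y| ≤ 5 / 4 * X := by
      rw [abs_le] at hks ⊢
      constructor <;> nlinarith
    have hy1 : |y| ≤ 1 / 2 := by linarith
    have hlog : smoothLog (u + v) - smoothLog u = Real.log (1 + y) / 2 := by
      have h1 : 1 + ‖u + v‖ ^ 2 = s * (1 + y) := by
        rw [norm_add_sq_real, hy, hr, hw]
        field_simp
        rw [hs]; ring
      have h2 : 0 < 1 + y := by linarith [(abs_le.1 hy1).1]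
      unfold smoothLog
      rw [h1, ← hs, Real.log_mul hs0.ne' h2.ne']
      ring
    have hE := Real.abs_log_sub_add_sum_range_le (x := -y) (by rw [abs_neg]; linarith) 2
    rw [abs_neg, sub_neg_eq_add] at hE
    simp only [Finset.sum_range_succ, Finset.range_zero, Finset.sum_empty] at hE
    have hE2 : |y| ^ (2 + 1) / (1 - |y|) ≤ 4 * X ^ 3 := by
      rw [div_le_iff₀ (by linarith)]
      have h5 : |y| ^ 3 ≤ (5 / 4 * X) ^ 3 := by gcongr
      have h3 : 0 ≤ X ^ 3 := by positivity
      have h6 : X ^ 3 * (1 / 2) ≤ X ^ 3 * (1 - |y|) :=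
        mul_le_mul_of_nonneg_left (by linarith) h3
      have h7 : (5 / 4 * X) ^ 3 = 125 / 64 * X ^ 3 := by ring
      norm_num
      linarith
    have hE3 := hE.trans hE2
    have hrX : |r * X ^ 2| ≤ X ^ 3 / 2 := by
      rw [abs_mul, abs_of_nonneg (sq_nonneg X)]
      have := mul_le_mul_of_nonneg_right hks (sq_nonneg X)
      linarith [show X / 2 * X ^ 2 = X ^ 3 / 2 by ring]
    have hrw : |w * (r * X ^ 2)| ≤ X ^ 3 / 2 := by
      rw [abs_mul, abs_of_pos hw0]
      exact (mul_le_of_le_one_left (abs_nonneg _) hw1).trans hrX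
    have hw4 : w ^ 2 * X ^ 4 ≤ X ^ 3 := by
      have h1 : w ^ 2 ≤ 1 := pow_le_one₀ hw0.le hw1
      have h2 : X ^ 4 ≤ X ^ 3 := pow_le_pow_of_le_one hX0 (by linarith) (by norm_num)
      exact (mul_le_of_le_one_left (by positivity) h1).trans h2
    have hw40 : 0 ≤ w ^ 2 * X ^ 4 := by positivity
    have h3 : 0 ≤ X ^ 3 := by positivity
    clear_value y r w X
    have hy2 : y ^ 2 = 4 * r ^ 2 + 4 * (w * (r * X ^ 2)) + w ^ 2 * X ^ 4 := by rw [hy]; ring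
    rw [hlog]
    generalize Real.log (1 + y) = g at *
    have hE4 : |-y + y ^ 2 / 2 + g| ≤ 4 * X ^ 3 := by
      refine le_trans (le_of_eq ?_) hE3
      congr 1
      push_cast
      ring
    rw [abs_le] at hE4 hrw ⊢
    constructor <;> linarith
  · have hpow : X ^ 2 / 4 ≤ X ^ p := by
      rcases le_total X 1 with h1 | h1
      · have : X ^ 3 ≤ X ^ p := by
          rw [← Real.rpow_natCast]
          exact Real.rpow_le_rpow_of_exponent_ge (by linarith) h1 (by exact_mod_cast hp3)
        nlinarith [sq_nonneg X]
      · have : X ^ 2 ≤ X ^ p := by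
          rw [← Real.rpow_natCast]
          exact Real.rpow_le_rpow_of_exponent_le h1 (by exact_mod_cast hp2)
        nlinarith [sq_nonneg X]
    have hd := abs_smoothLog_add_sub_le u v
    rw [← hX] at hd
    have hXX : X ≤ 4 * X ^ 2 := by nlinarith
    rw [abs_le] at hd hks hb ⊢
    constructor <;> linarith

/-- `log ‖u‖` regularized at scale `η` near zero and at scale `B` near infinity. -/
def truncLog (η B : ℝ) (u : ℂ) : ℝ :=
  Real.log η + (smoothLog ((η⁻¹ : ℝ) • u) - smoothLog ((B⁻¹ : ℝ) • u))

theorem continuous_truncLog (η B : ℝ) : Continuous (truncLog η B) := by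
  have := continuous_smoothLog
  unfold truncLog
  fun_prop

theorem truncLog_eq {η B : ℝ} (hη : 0 < η) (u : ℂ) :
    truncLog η B u = Real.log (η ^ 2 + ‖u‖ ^ 2) / 2 - Real.log (1 + (‖u‖ / B) ^ 2) / 2 := by
  unfold truncLog smoothLog
  have h1 : 1 + ‖(η⁻¹ : ℝ) • u‖ ^ 2 = (η ^ 2 + ‖u‖ ^ 2) / η ^ 2 := by
    rw [norm_smul, Real.norm_eq_abs, mul_pow, sq_abs]; field_simp
  have h2 : 1 + ‖(B⁻¹ : ℝ) • u‖ ^ 2 = 1 + (‖u‖ / B) ^ 2 := by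
    rw [norm_smul, Real.norm_eq_abs, mul_pow, sq_abs]; field_simp
  rw [h1, h2, Real.log_div (by positivity) (by positivity), Real.log_pow]
  push_cast
  ring

/-- Two rescaled copies of the same function, with constant 36 each; the copy at the larger scale
`B` also obeys the bounds at scale `η`. -/
theorem taylorBound_truncLog {p η B : ℝ} (hp2 : 2 ≤ p) (hp3 : p ≤ 3) (hη : 0 < η) (hηB : η ≤ B) :
    TaylorBound 72 η⁻¹ p (truncLog η B) := by
  have hs : ∀ c : ℝ, 0 < c → TaylorBound 36 c⁻¹ p (fun u : ℂ => smoothLog ((c⁻¹ : ℝ) • u)) := by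
    intro c hc
    have := (taylorBound_smoothLog hp2 hp3).comp_linear (W := ℂ) (by norm_num) zero_le_one
      (by linarith) ((c⁻¹ : ℝ) • LinearMap.id) (s := c⁻¹) (fun w => by
        simp [abs_of_pos hc])
    simpa using this
  have h := (hs η hη).sub ((hs B (hη.trans_le hηB)).mono (by norm_num)
    (inv_nonneg.2 (hη.le.trans hηB)) (by linarith) le_rfl (inv_anti₀ hη hηB))
  norm_num at h
  unfold truncLog
  simpa using h.const_add (Real.log η)

/-- The truncated logarithm takes values between `log η` and `log B`, so it stays logarithmic in `n`
when both scales are powers of `n`. -/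
theorem abs_truncLog_le {η B M : ℝ} (hη : 0 < η) (hηB : η ≤ B) (h1 : -Real.log η ≤ M)
    (h2 : Real.log B ≤ M) (u : ℂ) : |truncLog η B u| ≤ M := by
  have hB : 0 < B := hη.trans_le hηB
  rw [truncLog_eq hη]
  have h3 : η ^ 2 ≤ B ^ 2 := by gcongr
  have e1 : η ^ 2 * (1 + (‖u‖ / B) ^ 2) ≤ η ^ 2 + ‖u‖ ^ 2 := by
    have : η ^ 2 * (‖u‖ / B) ^ 2 ≤ ‖u‖ ^ 2 := by
      rw [div_pow, mul_div_assoc', div_le_iff₀ (by positivity)]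
      nlinarith [sq_nonneg ‖u‖]
    linarith
  have e2 : η ^ 2 + ‖u‖ ^ 2 ≤ B ^ 2 * (1 + (‖u‖ / B) ^ 2) := by
    have : B ^ 2 * (‖u‖ / B) ^ 2 = ‖u‖ ^ 2 := by field_simp
    linarith
  have l1 := Real.log_le_log (by positivity) e1
  have l2 := Real.log_le_log (by positivity) e2
  rw [Real.log_mul (by positivity) (by positivity), Real.log_pow] at l1 l2
  push_cast at l1 l2
  rw [abs_le]
  constructor <;> linarith

/-! ### Product measures, moments and the Lindeberg exchange. -/

section ProductMeasure

variable (μ : Measure ℂ) [IsProbabilityMeasure μ] (N : ℕ)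

/-- The law of `N` independent complex random variables with law `μ`. -/
abbrev iidMeasure : Measure (Fin N → ℂ) := Measure.pi fun _ => μ

theorem measurePreserving_cons : MeasurePreserving
    (fun p : ℂ × (Fin N → ℂ) => (Fin.cons p.1 p.2 : Fin (N + 1) → ℂ))
    (μ.prod (iidMeasure μ N)) (iidMeasure μ (N + 1)) := by
  have h := (measurePreserving_piFinSuccAbove (fun _ : Fin (N + 1) => μ) 0).symm
  convert h using 1
  funext p
  simp [MeasurableEquiv.piFinSuccAbove]
  rfl

variable {N}

theorem integral_iidMeasure_succ {E : Type*} [NormedAddCommGroup E] [NormedSpace ℝ E]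
    {f : (Fin (N + 1) → ℂ) → E} (hf : Integrable f (iidMeasure μ (N + 1))) :
    ∫ x, f x ∂(iidMeasure μ (N + 1)) = ∫ x, ∫ y, f (Fin.cons x y) ∂(iidMeasure μ N) ∂μ := by
  have h := measurePreserving_cons μ N
  rw [← h.map_eq, integral_map h.measurable.aemeasurable (by rw [h.map_eq]; exact hf.1),
    integral_prod]
  exact h.integrable_comp_of_integrable hf

theorem iidMeasure_succ_apply {S : Set (Fin (N + 1) → ℂ)} (hS : MeasurableSet S) :
    iidMeasure μ (N + 1) S = ∫⁻ x, iidMeasure μ N {y | Fin.cons x y ∈ S} ∂μ := by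
  have h := measurePreserving_cons μ N
  rw [← h.map_eq, Measure.map_apply h.measurable hS, Measure.prod_apply (h.measurable hS)]
  rfl

theorem iidMeasure_succ_apply_symm {S : Set (Fin (N + 1) → ℂ)} (hS : MeasurableSet S) :
    iidMeasure μ (N + 1) S = ∫⁻ y, μ {x | Fin.cons x y ∈ S} ∂(iidMeasure μ N) := by
  have h := measurePreserving_cons μ N
  rw [← h.map_eq, Measure.map_apply h.measurable hS, Measure.prod_apply_symm (h.measurable hS)]
  rfl

end ProductMeasure

section Moments

variable {μ ν : Measure ℂ}

theorem IsNormalizedAtom.integrable_sq (h : IsNormalizedAtom μ) :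
    Integrable (fun x : ℂ => ‖x‖ ^ 2) μ :=
  h.memLp.integrable_norm_pow (by norm_num)

theorem integrable_moment [IsProbabilityMeasure μ] (h : Integrable (fun x : ℂ => ‖x‖ ^ 2) μ)
    {a b : ℕ} (hab : a + b ≤ 2) : Integrable (fun x : ℂ => x.re ^ a * x.im ^ b) μ := by
  refine ((integrable_const (1 : ℝ)).add h : Integrable (fun x : ℂ => 1 + ‖x‖ ^ 2) μ).mono'
    (by fun_prop) (Filter.Eventually.of_forall fun x => ?_)
  rw [Real.norm_eq_abs, abs_mul, abs_pow, abs_pow]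
  have h1 := Complex.abs_re_le_norm x
  have h2 := Complex.abs_im_le_norm x
  calc |x.re| ^ a * |x.im| ^ b ≤ ‖x‖ ^ a * ‖x‖ ^ b := by gcongr
    _ = ‖x‖ ^ (a + b) := (pow_add _ _ _).symm
    _ ≤ 1 + ‖x‖ ^ 2 := by
      rcases le_total ‖x‖ 1 with h | h
      · have := pow_le_one₀ (n := a + b) (norm_nonneg x) h
        have := sq_nonneg ‖x‖
        linarith
      · have := pow_le_pow_right₀ h hab
        linarith

/-- A real polynomial of degree at most two on `ℂ = ℝ²`. -/
def quadraticPoly (c : Fin 6 → ℝ) (x : ℂ) : ℝ :=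
  c 0 * (x.re ^ 0 * x.im ^ 0) + c 1 * (x.re ^ 1 * x.im ^ 0) + c 2 * (x.re ^ 0 * x.im ^ 1) +
    c 3 * (x.re ^ 2 * x.im ^ 0) + c 4 * (x.re ^ 1 * x.im ^ 1) + c 5 * (x.re ^ 0 * x.im ^ 2)

theorem integrable_quadraticPoly [IsProbabilityMeasure μ]
    (h : Integrable (fun x : ℂ => ‖x‖ ^ 2) μ) (c : Fin 6 → ℝ) :
    Integrable (quadraticPoly c) μ :=
  ((((((integrable_moment h (by norm_num)).const_mul _).add
    ((integrable_moment h (by norm_num)).const_mul _)).add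
    ((integrable_moment h (by norm_num)).const_mul _)).add
    ((integrable_moment h (by norm_num)).const_mul _)).add
    ((integrable_moment h (by norm_num)).const_mul _)).add
    ((integrable_moment h (by norm_num)).const_mul _)

theorem integral_quadraticPoly [IsProbabilityMeasure μ]
    (h : Integrable (fun x : ℂ => ‖x‖ ^ 2) μ) (c : Fin 6 → ℝ) :
    ∫ x, quadraticPoly c x ∂μ =
      c 0 * (∫ x : ℂ, x.re ^ 0 * x.im ^ 0 ∂μ) + c 1 * (∫ x : ℂ, x.re ^ 1 * x.im ^ 0 ∂μ) +
      c 2 * (∫ x : ℂ, x.re ^ 0 * x.im ^ 1 ∂μ) + c 3 * (∫ x : ℂ, x.re ^ 2 * x.im ^ 0 ∂μ) +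
      c 4 * (∫ x : ℂ, x.re ^ 1 * x.im ^ 1 ∂μ) + c 5 * (∫ x : ℂ, x.re ^ 0 * x.im ^ 2 ∂μ) := by
  have hi : ∀ {a b : ℕ} (k : ℝ), a + b ≤ 2 →
      Integrable (fun x : ℂ => k * (x.re ^ a * x.im ^ b)) μ := fun k hab =>
    (integrable_moment h hab).const_mul k
  have i0 := hi (a := 0) (b := 0) (c 0) (by norm_num)
  have i1 := hi (a := 1) (b := 0) (c 1) (by norm_num)
  have i2 := hi (a := 0) (b := 1) (c 2) (by norm_num)
  have i3 := hi (a := 2) (b := 0) (c 3) (by norm_num)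
  have i4 := hi (a := 1) (b := 1) (c 4) (by norm_num)
  have i5 := hi (a := 0) (b := 2) (c 5) (by norm_num)
  have i01 := i0.add i1
  have i02 := i01.add i2
  have i03 := i02.add i3
  have i04 := i03.add i4
  have e5 := integral_add i04 i5
  have e4 := integral_add i03 i4
  have e3 := integral_add i02 i3
  have e2 := integral_add i01 i2
  have e1 := integral_add i0 i1
  simp only [Pi.add_apply, integral_const_mul] at e1 e2 e3 e4 e5
  rw [← e1, ← e2, ← e3, ← e4, ← e5]
  rfl

/-- This is where the matching of moments enters: expectations of real quadratic polynomials in an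
atom agree. -/
theorem integral_quadraticPoly_eq [IsProbabilityMeasure μ] [IsProbabilityMeasure ν]
    (hμ : Integrable (fun x : ℂ => ‖x‖ ^ 2) μ) (hν : Integrable (fun x : ℂ => ‖x‖ ^ 2) ν)
    (h : MatchMoments 2 μ ν) (c : Fin 6 → ℝ) :
    ∫ x, quadraticPoly c x ∂μ = ∫ x, quadraticPoly c x ∂ν := by
  rw [integral_quadraticPoly hμ, integral_quadraticPoly hν, h 0 0 (by norm_num),
    h 1 0 (by norm_num), h 0 1 (by norm_num), h 2 0 (by norm_num), h 1 1 (by norm_num),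
    h 0 2 (by norm_num)]

end Moments

section Lindeberg

variable {V : Type*} [NormedAddCommGroup V] [NormedSpace ℂ V]

/-- Only the direction `c` and its multiple by the imaginary unit matter: real linearity turns the
expansion into a polynomial in the two real coordinates of `x`. -/
theorem exists_quadraticPoly_eq (h : ℝ) (l : V →ₗ[ℝ] ℝ) (b : V →ₗ[ℝ] V →ₗ[ℝ] ℝ) (c : V) :
    ∃ k : Fin 6 → ℝ, ∀ x : ℂ, h + l (x • c) + b (x • c) (x • c) = quadraticPoly k x := by
  refine ⟨![h, l c, l (Complex.I • c), b c c, b c (Complex.I • c) + b (Complex.I • c) c,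
    b (Complex.I • c) (Complex.I • c)], fun x => ?_⟩
  have hx : x • c = x.re • c + x.im • (Complex.I • c) := by
    conv_lhs => rw [← Complex.re_add_im x, add_smul, mul_smul]
    rw [Complex.coe_smul, Complex.coe_smul]
  rw [hx]
  simp only [map_add, map_smul, LinearMap.add_apply, LinearMap.smul_apply, smul_eq_mul]
  simp [quadraticPoly]
  ring

/-- Replacing one atom in a smooth function. -/
theorem abs_integral_sub_integral_le {A B p M : ℝ} {H : V → ℝ} (hH : TaylorBound A B p H)
    (hHc : Continuous H) (hB : 0 ≤ B) {K : ℝ} (hK : ∀ u, |H u| ≤ K)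
    {μ ν : Measure ℂ} [IsProbabilityMeasure μ] [IsProbabilityMeasure ν]
    (hμ : Integrable (fun x : ℂ => ‖x‖ ^ 2) μ) (hν : Integrable (fun x : ℂ => ‖x‖ ^ 2) ν)
    (hm : MatchMoments 2 μ ν)
    (hμp : Integrable (fun x : ℂ => ‖x‖ ^ p) μ) (hνp : Integrable (fun x : ℂ => ‖x‖ ^ p) ν)
    (hμM : ∫ x, ‖x‖ ^ p ∂μ ≤ M) (hνM : ∫ x, ‖x‖ ^ p ∂ν ≤ M) (hA : 0 ≤ A) (u c : V) :
    |(∫ x, H (u + x • c) ∂μ) - ∫ x, H (u + x • c) ∂ν| ≤ 2 * (A * (B * ‖c‖) ^ p * M) := by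
  obtain ⟨l, b, hlb⟩ := hH u
  obtain ⟨k, hk⟩ := exists_quadraticPoly_eq (H u) l b c
  -- Both laws are compared with one and the same quadratic polynomial; the difference is the
  -- integrated Taylor remainder.
  have key : ∀ (ρ : Measure ℂ) [IsProbabilityMeasure ρ],
      Integrable (fun x : ℂ => ‖x‖ ^ 2) ρ → Integrable (fun x : ℂ => ‖x‖ ^ p) ρ →
      ∫ x, ‖x‖ ^ p ∂ρ ≤ M →
      |(∫ x, H (u + x • c) ∂ρ) - ∫ x, quadraticPoly k x ∂ρ| ≤ A * (B * ‖c‖) ^ p * M := by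
    intro ρ _ h2 hp hM
    have hi : Integrable (fun x : ℂ => H (u + x • c)) ρ :=
      Integrable.of_bound (hHc.comp (by fun_prop)).aestronglyMeasurable K
        (Filter.Eventually.of_forall fun x => hK _)
    rw [← integral_sub hi (integrable_quadraticPoly h2 k), ← Real.norm_eq_abs]
    refine (norm_integral_le_of_norm_le (hp.const_mul (A * (B * ‖c‖) ^ p))
      (Filter.Eventually.of_forall fun x => ?_)).trans ?_
    · rw [← hk, Real.norm_eq_abs]
      have := (hlb (x • c)).2.2
      rw [norm_smul, ← mul_assoc, mul_right_comm, Real.mul_rpow (by positivity) (norm_nonneg _),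
        ← mul_assoc] at this
      convert this using 2
      ring
    · rw [integral_const_mul]
      exact mul_le_mul_of_nonneg_left hM (by positivity)
  have h1 := key μ hμ hμp hμM
  have h2 := key ν hν hνp hνM
  rw [integral_quadraticPoly_eq hμ hν hm] at h1
  rw [abs_le] at h1 h2 ⊢
  constructor <;> linarith

/-- The Lindeberg exchange method for a smooth function of a sum of independent vectors. -/
theorem lindeberg {A B p M : ℝ} {H : V → ℝ} (hH : TaylorBound A B p H)
    (hHc : Continuous H) (hB : 0 ≤ B) {K : ℝ} (hK : ∀ u, |H u| ≤ K)
    {μ ν : Measure ℂ} [IsProbabilityMeasure μ] [IsProbabilityMeasure ν]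
    (hμ : Integrable (fun x : ℂ => ‖x‖ ^ 2) μ) (hν : Integrable (fun x : ℂ => ‖x‖ ^ 2) ν)
    (hm : MatchMoments 2 μ ν)
    (hμp : Integrable (fun x : ℂ => ‖x‖ ^ p) μ) (hνp : Integrable (fun x : ℂ => ‖x‖ ^ p) ν)
    (hμM : ∫ x, ‖x‖ ^ p ∂μ ≤ M) (hνM : ∫ x, ‖x‖ ^ p ∂ν ≤ M) (hA : 0 ≤ A) {N : ℕ} (c : Fin N → V)
    (u : V) :
    |(∫ x, H (u + ∑ i, x i • c i) ∂(iidMeasure μ N)) -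
        ∫ x, H (u + ∑ i, x i • c i) ∂(iidMeasure ν N)| ≤
      ∑ i, 2 * (A * (B * ‖c i‖) ^ p * M) := by
  induction N generalizing u with
  | zero =>
    have h : ∀ (ρ : Measure ℂ) [IsProbabilityMeasure ρ],
        ∫ x, H (u + ∑ i, x i • c i) ∂(iidMeasure ρ 0) = H u := fun ρ _ => by simp
    rw [h μ, h ν]
    simp
  | succ N ih =>
    have hc : ∀ (n : ℕ) (c : Fin n → V) (u : V),
        Continuous fun x : Fin n → ℂ => H (u + ∑ i, x i • c i) := fun n c u =>
      hHc.comp (by fun_prop)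
    have hi : ∀ (n : ℕ) (c : Fin n → V) (u : V) (ρ : Measure ℂ) [IsProbabilityMeasure ρ],
        Integrable (fun x : Fin n → ℂ => H (u + ∑ i, x i • c i)) (iidMeasure ρ n) :=
      fun n c u ρ _ => Integrable.of_bound (hc n c u).aestronglyMeasurable K
        (Filter.Eventually.of_forall fun x => hK _)
    have hsum : ∀ (x : ℂ) (y : Fin N → ℂ),
        u + ∑ i, (Fin.cons x y : Fin (N + 1) → ℂ) i • c i =
          (u + x • c 0) + ∑ i, y i • c i.succ := fun x y => by
      rw [Fin.sum_univ_succ, ← add_assoc]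
      simp only [Fin.cons_zero, Fin.cons_succ]
    rw [integral_iidMeasure_succ μ (hi _ _ _ μ), integral_iidMeasure_succ ν (hi _ _ _ ν),
      Fin.sum_univ_succ]
    simp only [hsum]
    let c' : Fin N → V := fun i => c i.succ
    have hpair : ∀ (ρ σ : Measure ℂ) [IsProbabilityMeasure ρ] [IsProbabilityMeasure σ],
        Integrable (Function.uncurry fun (x : ℂ) (y : Fin N → ℂ) =>
          H ((u + x • c 0) + ∑ i, y i • c' i)) (ρ.prod (iidMeasure σ N)) := fun ρ σ _ _ =>
      Integrable.of_bound (Continuous.aestronglyMeasurable (hHc.comp (by fun_prop))) K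
        (Filter.Eventually.of_forall fun x => hK _)
    -- The hybrid law, with first atom `μ` and all others `ν`, stands in the middle. Here the first
    -- atom is frozen and absorbed into the base point, so the induction hypothesis applies.
    have step1 : |(∫ x, ∫ y, H ((u + x • c 0) + ∑ i, y i • c' i) ∂(iidMeasure μ N) ∂μ) -
        ∫ x, ∫ y, H ((u + x • c 0) + ∑ i, y i • c' i) ∂(iidMeasure ν N) ∂μ| ≤
        ∑ i, 2 * (A * (B * ‖c' i‖) ^ p * M) := by
      have e := integral_sub (hpair μ μ).integral_prod_left (hpair μ ν).integral_prod_left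
      simp only [Function.uncurry_apply_pair] at e
      rw [← e, ← Real.norm_eq_abs]
      refine (norm_integral_le_of_norm_le_const (C := ∑ i, 2 * (A * (B * ‖c' i‖) ^ p * M))
        (Filter.Eventually.of_forall fun x => ?_)).trans (by simp)
      exact ih c' (u + x • c 0)
    -- After Fubini the other atoms are frozen and only the first one is exchanged.
    have step2 : |(∫ x, ∫ y, H ((u + x • c 0) + ∑ i, y i • c' i) ∂(iidMeasure ν N) ∂μ) -
        ∫ x, ∫ y, H ((u + x • c 0) + ∑ i, y i • c' i) ∂(iidMeasure ν N) ∂ν| ≤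
        2 * (A * (B * ‖c 0‖) ^ p * M) := by
      have e := integral_sub (hpair μ ν).integral_prod_right (hpair ν ν).integral_prod_right
      simp only [Function.uncurry_apply_pair] at e
      rw [integral_integral_swap (hpair μ ν), integral_integral_swap (hpair ν ν), ← e,
        ← Real.norm_eq_abs]
      refine (norm_integral_le_of_norm_le_const (C := 2 * (A * (B * ‖c 0‖) ^ p * M))
        (Filter.Eventually.of_forall fun y => ?_)).trans (by simp)
      have := abs_integral_sub_integral_le hH hHc hB hK hμ hν hm hμp hνp hμM hνM hA
        (u + ∑ i, y i • c' i) (c 0)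
      simp only [add_right_comm u _ (_ • c 0)] at this
      exact this
    rw [abs_le] at step1 step2 ⊢
    constructor <;> linarith

end Lindeberg

/-! ### Concentration of sums with lacunary coefficients. -/

section Concentration

/-- The concentration function at scale `ρ` of the sum `∑_{i < N} c_{t + i} ξ_i` of independent
variables is at most `q`. -/
def ConcentrationBound (μ : Measure ℂ) (c : ℕ → ℂ) (t N : ℕ) (ρ : ℝ) (q : ℝ≥0∞) : Prop :=
  ∀ u : ℂ, Measure.pi (fun _ : Fin N => μ) {x | ‖∑ i : Fin N, x i * c (t + i) - u‖ ≤ ρ} ≤ q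

variable {μ : Measure ℂ} [IsProbabilityMeasure μ] {c : ℕ → ℂ} {t N : ℕ} {ρ : ℝ} {q : ℝ≥0∞}

theorem sum_cons_mul_shift (x : ℂ) (y : Fin N → ℂ) :
    ∑ i : Fin (N + 1), (Fin.cons x y : Fin (N + 1) → ℂ) i * c (t + i) =
      x * c t + ∑ i : Fin N, y i * c (t + 1 + i) := by
  rw [Fin.sum_univ_succ]
  simp only [Fin.cons_zero, Fin.cons_succ, Fin.val_zero, add_zero, Fin.val_succ]
  congr 1
  refine Finset.sum_congr rfl fun i _ => ?_
  congr 2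
  ring

theorem measurableSet_norm_sum_sub_le (c : ℕ → ℂ) (t N : ℕ) (ρ : ℝ) (u : ℂ) :
    MeasurableSet {x : Fin N → ℂ | ‖∑ i : Fin N, x i * c (t + i) - u‖ ≤ ρ} :=
  (isClosed_le (by fun_prop) continuous_const).measurableSet

/-- Conditioning on an additional independent term only moves the centre of the ball, and the bound
is uniform in the centre. -/
theorem ConcentrationBound.skip (h : ConcentrationBound μ c (t + 1) N ρ q) :
    ConcentrationBound μ c t (N + 1) ρ q := by
  intro u
  rw [iidMeasure_succ_apply μ (measurableSet_norm_sum_sub_le c t (N + 1) ρ u)]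
  calc ∫⁻ x, iidMeasure μ N {y | Fin.cons x y ∈
        {x : Fin (N + 1) → ℂ | ‖∑ i, x i * c (t + i) - u‖ ≤ ρ}} ∂μ
      ≤ ∫⁻ _, q ∂μ := by
        refine lintegral_mono fun x => ?_
        refine le_trans (measure_mono fun y hy => ?_) (h (u - x * c t))
        rw [Set.mem_ofPred_eq, Set.mem_ofPred_eq, sum_cons_mul_shift] at hy
        rw [Set.mem_ofPred_eq]
        convert hy using 2
        ring
    _ = q := by simp

theorem ConcentrationBound.skip_many (h : ConcentrationBound μ c (t + s) N ρ q) :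
    ConcentrationBound μ c t (N + s) ρ q := by
  induction s generalizing t N with
  | zero => exact h
  | succ s ih =>
    rw [show t + (s + 1) = t + s + 1 by ring] at h
    rw [show N + (s + 1) = N + 1 + s by ring]
    exact ih h.skip

/-- Conditioning on the later terms. If their sum is within `ρ'` of `u`, an event of probability at
most `q`, the current atom must still fall in a given ball of radius `r`, which costs `κ`. Otherwise
the current term has to compensate a distance larger than `(r + K)‖c t‖`, which forces the atom to
exceed `K`. -/
theorem ConcentrationBound.use {r K ρ' : ℝ} {κ : ℝ≥0∞}
    (h : ConcentrationBound μ c (t + 1) N ρ' q) (hκ : ∀ u : ℂ, μ {x | ‖x - u‖ ≤ r} ≤ κ)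
    (hc : c t ≠ 0) (hρ : (r + K) * ‖c t‖ ≤ ρ') :
    ConcentrationBound μ c t (N + 1) (r * ‖c t‖) (κ * q + μ {x | K < ‖x‖}) := by
  intro u
  have hc0 : 0 < ‖c t‖ := norm_pos_iff.2 hc
  rw [iidMeasure_succ_apply_symm μ (measurableSet_norm_sum_sub_le c t (N + 1) _ u)]
  set S : Set (Fin N → ℂ) := {y | ‖∑ i : Fin N, y i * c (t + 1 + i) - u‖ ≤ ρ'} with hS
  have hSm : MeasurableSet S := measurableSet_norm_sum_sub_le c (t + 1) N ρ' u
  calc ∫⁻ y, μ {x | Fin.cons x y ∈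
        {x : Fin (N + 1) → ℂ | ‖∑ i, x i * c (t + i) - u‖ ≤ r * ‖c t‖}} ∂(iidMeasure μ N)
      ≤ ∫⁻ y, (S.indicator (fun _ => κ) y + μ {x | K < ‖x‖}) ∂(iidMeasure μ N) := by
        refine lintegral_mono fun y => ?_
        simp only [Set.mem_ofPred_eq, sum_cons_mul_shift]
        by_cases hy : y ∈ S
        · rw [Set.indicator_of_mem hy]
          refine le_trans (le_trans (measure_mono fun x hx => ?_)
            (hκ ((u - ∑ i : Fin N, y i * c (t + 1 + i)) / c t))) le_self_add
          rw [Set.mem_ofPred_eq] at hx ⊢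
          rw [← mul_le_mul_iff_left₀ hc0, ← norm_mul, sub_mul, div_mul_cancel₀ _ hc]
          rwa [sub_sub_eq_add_sub]
        · rw [Set.indicator_of_notMem hy, zero_add]
          refine measure_mono fun x hx => ?_
          rw [Set.mem_ofPred_eq] at hx ⊢
          rw [hS, Set.mem_ofPred_eq, not_le] at hy
          have h1 : ‖∑ i : Fin N, y i * c (t + 1 + i) - u‖ ≤ r * ‖c t‖ + ‖x‖ * ‖c t‖ := by
            have e : ∑ i : Fin N, y i * c (t + 1 + i) - u =
              (x * c t + ∑ i : Fin N, y i * c (t + 1 + i) - u) - x * c t := by ring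
            rw [e, ← norm_mul]
            exact (norm_sub_le _ _).trans (by linarith)
          have h2 : K * ‖c t‖ < ‖x‖ * ‖c t‖ := by nlinarith
          exact lt_of_mul_lt_mul_right h2 hc0.le
    _ = κ * iidMeasure μ N S + μ {x | K < ‖x‖} := by
        rw [lintegral_add_right _ measurable_const, lintegral_indicator_const hSm,
          lintegral_const, measure_univ, mul_one]
    _ ≤ κ * q + μ {x | K < ‖x‖} := by
        gcongr
        exact h u

theorem concentrationBound_one (ρ : ℝ) : ConcentrationBound μ c t N ρ 1 := fun _ => prob_le_one

/-- Sums with a lacunary sequence of coefficients have small concentration. -/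
theorem concentrationBound_of_lacunary {n i₀ s m : ℕ} {r K : ℝ} {κ : ℝ≥0∞} (hκ1 : κ ≤ 1)
    (hκ : ∀ u : ℂ, μ {x | ‖x - u‖ ≤ r} ≤ κ) (hs : 1 ≤ s) (hi : i₀ ≤ n) (hms : m * s ≤ i₀)
    (hc : ∀ i, c i ≠ 0)
    (hratio : ∀ i, i + s ≤ i₀ → (r + K) * ‖c i‖ ≤ r * ‖c (i + s)‖) :
    ConcentrationBound μ c 0 (n + 1) (r * ‖c (i₀ - m * s)‖)
      (κ ^ (m + 1) + (m + 1) * μ {x | K < ‖x‖}) := by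
  set τ := μ {x | K < ‖x‖}
  -- Backward induction from the largest coefficient: the current atom is used, the `s - 1`
  -- following ones are skipped. The ratio hypothesis makes the radius reached at `t + s` large
  -- enough for the step at `t`.
  have key : ∀ b t N : ℕ, t + b * s = i₀ → t + N = n + 1 →
      ConcentrationBound μ c t N (r * ‖c t‖) (κ ^ (b + 1) + (b + 1) * τ) := by
    intro b
    induction b with
    | zero =>
      intro t N ht hN
      obtain ⟨N, rfl⟩ : ∃ M, N = M + 1 := ⟨N - 1, by omega⟩
      have := (concentrationBound_one (μ := μ) (c := c) (t := t + 1) (N := N)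
        ((r + K) * ‖c t‖)).use hκ (hc t) le_rfl
      simpa using this
    | succ b ih =>
      intro t N ht hN
      have hbs : (b + 1) * s = b * s + s := by ring
      obtain ⟨M, rfl⟩ : ∃ M, N = M + s := ⟨N - s, by omega⟩
      have h1 := ih (t + s) M (by omega) (by omega)
      obtain ⟨s', rfl⟩ : ∃ s', s = s' + 1 := ⟨s - 1, by omega⟩
      rw [show t + (s' + 1) = t + 1 + s' by ring] at h1
      have h2 := (ConcentrationBound.skip_many h1).use hκ (hc t)
        (K := K) (by
          have := hratio t (by omega)
          rwa [show t + (s' + 1) = t + 1 + s' by ring] at this)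
      rw [show M + (s' + 1) = M + s' + 1 by ring]
      intro u
      refine (h2 u).trans ?_
      push_cast
      calc κ * (κ ^ (b + 1) + (b + 1) * τ) + τ = κ ^ (b + 1 + 1) + κ * ((b + 1) * τ) + τ := by ring
        _ ≤ κ ^ (b + 1 + 1) + 1 * ((b + 1) * τ) + τ := by gcongr
        _ = _ := by ring
  have h1 := key m (i₀ - m * s) (n + 1 - (i₀ - m * s)) (by omega) (by omega)
  have h2 := ConcentrationBound.skip_many (t := 0) (s := i₀ - m * s) (by rwa [zero_add])
  rwa [show n + 1 - (i₀ - m * s) + (i₀ - m * s) = n + 1 by omega] at h2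

end Concentration

/-! ### Uniform nondegeneracy of a single atom. -/

section Nondegeneracy

theorem lintegral_rpow_eq {μ : Measure ℂ} {s : ℝ} (hs : 0 ≤ s) :
    ∫⁻ x : ℂ, ENNReal.ofReal (‖x‖ ^ s) ∂μ = ∫⁻ x : ℂ, ‖x‖ₑ ^ s ∂μ := by
  refine lintegral_congr fun x => ?_
  rw [← ENNReal.ofReal_rpow_of_nonneg (norm_nonneg x) hs, ofReal_norm]

theorem integrable_rpow_of_lintegral_le {μ : Measure ℂ} {s C : ℝ} (hs : 0 ≤ s)
    (h : ∫⁻ x : ℂ, ‖x‖ₑ ^ s ∂μ ≤ ENNReal.ofReal C) : Integrable (fun x : ℂ => ‖x‖ ^ s) μ := by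
  refine ⟨by fun_prop, ?_⟩
  rw [hasFiniteIntegral_iff_ofReal (Filter.Eventually.of_forall fun x => by positivity),
    lintegral_rpow_eq hs]
  exact h.trans_lt ENNReal.ofReal_lt_top

theorem integral_rpow_le_of_lintegral_le {μ : Measure ℂ} {s C : ℝ} (hs : 0 ≤ s) (hC : 0 ≤ C)
    (h : ∫⁻ x : ℂ, ‖x‖ₑ ^ s ∂μ ≤ ENNReal.ofReal C) : ∫ x : ℂ, ‖x‖ ^ s ∂μ ≤ C := by
  rw [integral_eq_lintegral_of_nonneg_ae (Filter.Eventually.of_forall fun x => by positivity)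
    (by fun_prop), lintegral_rpow_eq hs]
  exact ENNReal.toReal_le_of_le_ofReal hC h

/-- A normalized atom with a bounded moment of order larger than two is not concentrated near any
point. -/
theorem exists_nondegenerate {ε C : ℝ} (hε : 0 < ε) (hC : 0 < C) :
    ∃ κ : ℝ, 0 < κ ∧ κ < 1 ∧ ∀ μ : Measure ℂ, IsNormalizedAtom μ →
      ∫⁻ x, ‖x‖ₑ ^ (2 + ε) ∂μ ≤ ENNReal.ofReal C →
      ∀ u : ℂ, μ {x | ‖x - u‖ ≤ 1 / 2} ≤ ENNReal.ofReal (1 - κ) := by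
  -- `K` is so large that the part of `E‖x - u‖²` coming from `‖x‖ > K` is at most `1/4`, if `‖u‖ ≤
  -- 2`.
  obtain ⟨K, hK2, hKC⟩ : ∃ K : ℝ, 2 ≤ K ∧ 4 * C * K ^ (-ε) ≤ 1 / 4 := by
    have h1 := (tendsto_rpow_neg_atTop hε).const_mul (4 * C)
    rw [mul_zero] at h1
    obtain ⟨K, hK, hK'⟩ := ((Filter.eventually_ge_atTop (2 : ℝ)).and
      (h1.eventually (ge_mem_nhds (show (0 : ℝ) < 1 / 4 by norm_num)))).exists
    exact ⟨K, hK, hK'⟩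
  have hK0 : 0 < K := by linarith
  refine ⟨1 / (2 * (K + 2) ^ 2), by positivity, ?_, fun μ hμ hmom u => ?_⟩
  · rw [div_lt_one (by positivity)]; nlinarith
  have := hμ.isProbabilityMeasure
  set κ := 1 / (2 * (K + 2) ^ 2) with hκ
  have hsq := hμ.integrable_sq
  have hint := hμ.memLp.integrable (by norm_num)
  have hpi := integrable_rpow_of_lintegral_le (by linarith) hmom
  have hpm := integral_rpow_le_of_lintegral_le (by linarith) hC.le hmom
  set S : Set ℂ := {x | ‖x - u‖ ≤ 1 / 2} with hS
  have hSm : MeasurableSet S := (isClosed_le (by fun_prop) continuous_const).measurableSet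
  -- A ball about a far point lies in `‖x‖² ≥ 2`, which has probability at most `1/2` because the
  -- second moment is one.
  by_cases hu : 2 < ‖u‖
  · have h1 : 1 * μ.real S ≤ 1 / 2 := by
      have h2 : ∀ x, (S.indicator (fun _ => (2 : ℝ))) x ≤ ‖x‖ ^ 2 := by
        intro x
        by_cases hx : x ∈ S
        · rw [Set.indicator_of_mem hx]
          have h3 : ‖x - u‖ ≤ 1 / 2 := hx
          have h4 : ‖u‖ ≤ ‖x‖ + ‖x - u‖ := by
            have := norm_sub_le x (x - u)
            rwa [sub_sub_cancel] at this
          nlinarith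
        · rw [Set.indicator_of_notMem hx]; positivity
      have h3 := integral_mono ((integrable_const (2 : ℝ)).indicator hSm) hsq h2
      rw [integral_indicator_const _ hSm, hμ.variance_eq_one, smul_eq_mul] at h3
      linarith
    rw [← ofReal_measureReal]
    refine ENNReal.ofReal_le_ofReal ?_
    have : κ ≤ 1 / 2 := by
      rw [hκ]
      exact one_div_le_one_div_of_le (by norm_num) (by nlinarith)
    linarith
  · rw [not_lt] at hu
    -- As the mean vanishes, the left side has mean `1 + ‖u‖² ≥ 1`. On the right the ball and the
    -- tail contribute at most `1/4` each, so the complement of the ball must have probability at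
    -- least `1/(2(K + 2)²)`.
    have hb : ∀ x : ℂ, ‖x‖ ^ 2 + (-2) * (x * (starRingEnd ℂ) u).re + ‖u‖ ^ 2 ≤
        1 / 4 + (K + 2) ^ 2 * Sᶜ.indicator (fun _ => (1 : ℝ)) x +
          4 * K ^ (-ε) * ‖x‖ ^ (2 + ε) := by
      intro x
      have e : ‖x‖ ^ 2 + (-2) * (x * (starRingEnd ℂ) u).re + ‖u‖ ^ 2 = ‖x - u‖ ^ 2 := by
        rw [← Complex.normSq_eq_norm_sq, ← Complex.normSq_eq_norm_sq, ← Complex.normSq_eq_norm_sq,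
          Complex.normSq_sub]
        ring
      rw [e]
      have hn : ‖x - u‖ ≤ ‖x‖ + ‖u‖ := norm_sub_le x u
      have hpos : 0 ≤ 4 * K ^ (-ε) * ‖x‖ ^ (2 + ε) := by positivity
      by_cases hx : x ∈ S
      · have : Sᶜ.indicator (fun _ => (1 : ℝ)) x = 0 := Set.indicator_of_notMem (by simpa) _
        rw [this]
        have h3 : ‖x - u‖ ≤ 1 / 2 := hx
        nlinarith [norm_nonneg (x - u)]
      · have : Sᶜ.indicator (fun _ => (1 : ℝ)) x = 1 := Set.indicator_of_mem (by simpa) _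
        rw [this]
        rcases le_total ‖x‖ K with hxK | hxK
        · nlinarith [norm_nonneg (x - u)]
        · have h4 : ‖x‖ ^ 2 ≤ K ^ (-ε) * ‖x‖ ^ (2 + ε) := by
            have hx0 : 0 < ‖x‖ := by linarith
            rw [Real.rpow_add hx0, Real.rpow_neg hK0.le, Real.rpow_two, ← div_eq_inv_mul,
              le_div_iff₀ (by positivity)]
            gcongr
          nlinarith [norm_nonneg (x - u), sq_nonneg (K + 2)]
    have hcre : Integrable (fun x : ℂ => (x * (starRingEnd ℂ) u).re) μ :=
      (hint.mul_const _).re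
    have hl : Integrable (fun x : ℂ => ‖x‖ ^ 2 + (-2) * (x * (starRingEnd ℂ) u).re + ‖u‖ ^ 2) μ :=
      (hsq.add (hcre.const_mul _)).add (integrable_const _)
    have hi1 : Integrable (Sᶜ.indicator (fun _ => (1 : ℝ))) μ :=
      (integrable_const (1 : ℝ)).indicator hSm.compl
    have h1 := integral_mono hl ((((integrable_const (1 / 4 : ℝ)).add
      (hi1.const_mul ((K + 2) ^ 2))).add (hpi.const_mul (4 * K ^ (-ε))))) hb
    have hre0 : ∫ x : ℂ, (x * (starRingEnd ℂ) u).re ∂μ = 0 := by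
      have h2 : ∫ x : ℂ, (x * (starRingEnd ℂ) u) ∂μ = 0 := by
        rw [integral_mul_const, hμ.mean_eq_zero, zero_mul]
      have h3 := integral_re (hint.mul_const ((starRingEnd ℂ) u))
      rw [h2] at h3
      simpa using h3
    have e1 : ∫ x : ℂ, (‖x‖ ^ 2 + (-2) * (x * (starRingEnd ℂ) u).re + ‖u‖ ^ 2) ∂μ =
        1 + ‖u‖ ^ 2 := by
      have a1 := integral_add (hsq.add (hcre.const_mul (-2))) (integrable_const (μ := μ) (‖u‖ ^ 2))
      have a2 := integral_add hsq (hcre.const_mul (-2))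
      simp only [Pi.add_apply] at a1 a2
      rw [a1, a2, integral_const_mul, hre0, hμ.variance_eq_one]
      simp
    have e2 : ∫ x : ℂ, (1 / 4 + (K + 2) ^ 2 * Sᶜ.indicator (fun _ => (1 : ℝ)) x +
          4 * K ^ (-ε) * ‖x‖ ^ (2 + ε)) ∂μ =
        1 / 4 + (K + 2) ^ 2 * μ.real Sᶜ + 4 * K ^ (-ε) * ∫ x : ℂ, ‖x‖ ^ (2 + ε) ∂μ := by
      have a1 := integral_add ((integrable_const (μ := μ) (1 / 4 : ℝ)).add
        (hi1.const_mul ((K + 2) ^ 2))) (hpi.const_mul (4 * K ^ (-ε)))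
      have a2 := integral_add (integrable_const (μ := μ) (1 / 4 : ℝ))
        (hi1.const_mul ((K + 2) ^ 2))
      simp only [Pi.add_apply] at a1 a2
      rw [a1, a2, integral_const_mul, integral_const_mul, integral_indicator_const _ hSm.compl]
      simp
    simp only [Pi.add_apply] at h1
    rw [e1, e2] at h1
    have h5 : 4 * K ^ (-ε) * ∫ x : ℂ, ‖x‖ ^ (2 + ε) ∂μ ≤ 1 / 4 :=
      le_trans (mul_le_mul_of_nonneg_left hpm (by positivity)) (by linarith)
    have h6 : 1 / 2 ≤ (K + 2) ^ 2 * μ.real Sᶜ := by nlinarith [sq_nonneg ‖u‖]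
    have h7 : κ ≤ μ.real Sᶜ := by
      rw [hκ, div_le_iff₀ (by positivity)]
      linarith
    rw [← ofReal_measureReal]
    refine ENNReal.ofReal_le_ofReal ?_
    have h8 := probReal_add_probReal_compl (μ := μ) hSm
    linarith

end Nondegeneracy

/-! ### A small ball estimate from characteristic functions. -/

section CharacteristicFunction

/-- For `|y| ≤ 1` the cubic remainder is at most `|y|^p` up to a constant, since `p ≤ 3`; for `|y| ≥
1` each term separately is at most `|y|² ≤ |y|^p`. -/
theorem norm_exp_mul_I_sub_taylor_le {p : ℝ} (hp2 : 2 ≤ p) (hp3 : p ≤ 3) (y : ℝ) :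
    ‖Complex.exp (y * Complex.I) - (1 + y * Complex.I - y ^ 2 / 2)‖ ≤ 4 * |y| ^ p := by
  have hy0 := abs_nonneg y
  rcases le_total |y| 1 with h | h
  · have hn : ‖(y * Complex.I : ℂ)‖ = |y| := by simp
    have h1 := Complex.exp_bound' (x := y * Complex.I) (n := 3) (by
      rw [hn, div_le_iff₀ (by positivity)]
      norm_num
      linarith)
    have e : ∑ m ∈ Finset.range 3, (y * Complex.I : ℂ) ^ m / m.factorial =
        1 + y * Complex.I - y ^ 2 / 2 := by
      simp only [Finset.sum_range_succ, Finset.range_zero, Finset.sum_empty, mul_pow,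
        Complex.I_sq]
      norm_num [Nat.factorial]
      ring
    rw [e, hn] at h1
    refine h1.trans ?_
    have hpow : |y| ^ 3 ≤ |y| ^ p := by
      rcases hy0.eq_or_lt with h0 | h0
      · rw [← h0, zero_pow (by norm_num)]; positivity
      · rw [← Real.rpow_natCast]
        exact Real.rpow_le_rpow_of_exponent_ge h0 h (by exact_mod_cast hp3)
    norm_num [Nat.factorial]
    have : 0 ≤ |y| ^ 3 := by positivity
    linarith
  · have h2 : |y| ^ 2 ≤ |y| ^ p := by
      rw [← Real.rpow_natCast]
      exact Real.rpow_le_rpow_of_exponent_le h (by exact_mod_cast hp2)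
    have h3 : ‖(1 + y * Complex.I - y ^ 2 / 2 : ℂ)‖ ≤ 1 + |y| + |y| ^ 2 / 2 := by
      refine (norm_sub_le _ _).trans (add_le_add ((norm_add_le _ _).trans ?_) ?_)
      · simp
      · simp
    have h4 := norm_sub_le (Complex.exp (y * Complex.I)) (1 + y * Complex.I - y ^ 2 / 2)
    rw [Complex.norm_exp_ofReal_mul_I] at h4
    nlinarith

/-- The characteristic function of a complex random variable, as a function of `w : ℂ` paired with
the variable through `Re (w x)`. -/
def complexCharFun (μ : Measure ℂ) (w : ℂ) : ℂ :=
  ∫ x : ℂ, Complex.exp ((w * x).re * Complex.I) ∂μ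

theorem norm_complexCharFun_le_one (μ : Measure ℂ) [IsProbabilityMeasure μ] (w : ℂ) :
    ‖complexCharFun μ w‖ ≤ 1 := by
  refine (norm_integral_le_of_norm_le_const (C := 1) (Filter.Eventually.of_forall fun x => ?_)).trans
    (by simp)
  rw [Complex.norm_exp_ofReal_mul_I]

theorem sq_re_eq (z : ℂ) : z.re ^ 2 = ‖z‖ ^ 2 / 2 + (z ^ 2).re / 2 := by
  rw [← Complex.normSq_eq_norm_sq, Complex.normSq_apply, sq z, Complex.mul_re]
  ring

theorem IsNormalizedAtom.integrable_sq_complex {μ : Measure ℂ} (h : IsNormalizedAtom μ) :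
    Integrable (fun x : ℂ => x ^ 2) μ := by
  refine h.integrable_sq.mono' (by fun_prop) (Filter.Eventually.of_forall fun x => ?_)
  rw [norm_pow]

/-- The second term, coming from `E ξ²`, may cancel the first, for instance for a real atom and
imaginary `w`. This is why a rotation is chosen in the small ball estimate. -/
theorem integral_sq_re {μ : Measure ℂ} (h : IsNormalizedAtom μ) (w : ℂ) :
    ∫ x : ℂ, (w * x).re ^ 2 ∂μ = ‖w‖ ^ 2 / 2 + (w ^ 2 * ∫ x, x ^ 2 ∂μ).re / 2 := by
  simp only [sq_re_eq, norm_mul, mul_pow]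
  have h1 : Integrable (fun x : ℂ => ‖w‖ ^ 2 * ‖x‖ ^ 2 / 2) μ :=
    (h.integrable_sq.const_mul _).div_const 2
  have h2 : Integrable (fun x : ℂ => w ^ 2 * x ^ 2) μ := h.integrable_sq_complex.const_mul _
  have h3 : Integrable (fun x : ℂ => (w ^ 2 * x ^ 2).re / 2) μ := h2.re.div_const 2
  have h4 := integral_re h2
  simp only [RCLike.re_to_complex] at h4
  rw [integral_add h1 h3, integral_div, integral_div, integral_const_mul, h.variance_eq_one,
    h4, integral_const_mul, mul_one]

/-- The mean vanishes, so the characteristic function is `1 - σ/2` up to `4M‖w‖^p`, where `σ` is the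
variance of `Re (w ξ)`; `‖w‖ ≤ 1` ensures `σ ≤ 1`. The exponential form makes bounds multiply over
independent atoms. -/
theorem norm_complexCharFun_le {μ : Measure ℂ} (h : IsNormalizedAtom μ) {p M : ℝ} (hp2 : 2 ≤ p)
    (hp3 : p ≤ 3) (hp : Integrable (fun x : ℂ => ‖x‖ ^ p) μ) (hM : ∫ x, ‖x‖ ^ p ∂μ ≤ M) {w : ℂ}
    (hw : ‖w‖ ≤ 1) :
    ‖complexCharFun μ w‖ ≤
      Real.exp (-((‖w‖ ^ 2 / 2 + (w ^ 2 * ∫ x, x ^ 2 ∂μ).re / 2) / 2) + 4 * M * ‖w‖ ^ p) := by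
  have := h.isProbabilityMeasure
  have hint := h.memLp.integrable (by norm_num)
  set σ := ‖w‖ ^ 2 / 2 + (w ^ 2 * ∫ x, x ^ 2 ∂μ).re / 2 with hσ
  have hσ' : ∫ x : ℂ, (w * x).re ^ 2 ∂μ = σ := integral_sq_re h w
  have hσ1 : σ ≤ 1 := by
    have h1 : ‖∫ x, x ^ 2 ∂μ‖ ≤ 1 := by
      refine (norm_integral_le_integral_norm _).trans ?_
      simp only [norm_pow]
      rw [h.variance_eq_one]
    have h2 : (w ^ 2 * ∫ x, x ^ 2 ∂μ).re ≤ ‖w‖ ^ 2 * ‖∫ x, x ^ 2 ∂μ‖ := by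
      refine (Complex.re_le_norm _).trans ?_
      rw [norm_mul, norm_pow]
    have h3 : ‖w‖ ^ 2 ≤ 1 := pow_le_one₀ (norm_nonneg _) hw
    have h4 : ‖w‖ ^ 2 * ‖∫ x, x ^ 2 ∂μ‖ ≤ 1 := mul_le_one₀ h3 (norm_nonneg _) h1
    linarith
  have hI1 : Integrable (fun x : ℂ => (w * x).re) μ := (hint.const_mul w).re
  have hI1' : Integrable (fun x : ℂ => ((w * x).re : ℂ)) μ := hI1.ofReal
  have hI2 : Integrable (fun x : ℂ => (w * x).re ^ 2) μ := by
    refine (h.integrable_sq.const_mul (‖w‖ ^ 2)).mono' (by fun_prop)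
      (Filter.Eventually.of_forall fun x => ?_)
    rw [Real.norm_eq_abs, abs_pow, ← mul_pow, ← norm_mul]
    exact pow_le_pow_left₀ (abs_nonneg _) (Complex.abs_re_le_norm _) 2
  have hI2' : Integrable (fun x : ℂ => ((w * x).re ^ 2 : ℂ)) μ := by
    simpa using hI2.ofReal (𝕜 := ℂ)
  have hm : ∫ x : ℂ, (w * x).re ∂μ = 0 := by
    have h3 := integral_re (hint.const_mul w)
    rw [integral_const_mul, h.mean_eq_zero, mul_zero] at h3
    simpa using h3
  have hT : ∫ x : ℂ, (1 + (w * x).re * Complex.I - (w * x).re ^ 2 / 2 : ℂ) ∂μ =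
      ((1 - σ / 2 : ℝ) : ℂ) := by
    have a1 := integral_sub ((integrable_const (μ := μ) (1 : ℂ)).add (hI1'.mul_const Complex.I))
      (hI2'.div_const 2)
    have a2 := integral_add (integrable_const (μ := μ) (1 : ℂ)) (hI1'.mul_const Complex.I)
    simp only [Pi.add_apply] at a1 a2
    rw [a1, a2, integral_mul_const, integral_div, integral_complex_ofReal, hm]
    simp only [← Complex.ofReal_pow]
    rw [integral_complex_ofReal, hσ']
    simp
  have hTi : Integrable (fun x : ℂ => (1 + (w * x).re * Complex.I - (w * x).re ^ 2 / 2 : ℂ)) μ :=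
    ((integrable_const (μ := μ) (1 : ℂ)).add (hI1'.mul_const Complex.I)).sub (hI2'.div_const 2)
  have hEi : Integrable (fun x : ℂ => Complex.exp ((w * x).re * Complex.I)) μ :=
    Integrable.of_bound (by fun_prop) 1 (Filter.Eventually.of_forall fun x => by
      rw [Complex.norm_exp_ofReal_mul_I])
  have hR : ‖complexCharFun μ w - ((1 - σ / 2 : ℝ) : ℂ)‖ ≤ 4 * M * ‖w‖ ^ p := by
    rw [← hT, complexCharFun, ← integral_sub hEi hTi]
    refine (norm_integral_le_of_norm_le (hp.const_mul (4 * ‖w‖ ^ p))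
      (Filter.Eventually.of_forall fun x => ?_)).trans ?_
    · refine (norm_exp_mul_I_sub_taylor_le hp2 hp3 _).trans ?_
      rw [mul_assoc, ← Real.mul_rpow (norm_nonneg _) (norm_nonneg _), ← norm_mul]
      refine mul_le_mul_of_nonneg_left ?_ (by norm_num)
      exact Real.rpow_le_rpow (abs_nonneg _) (Complex.abs_re_le_norm _) (by linarith)
    · rw [integral_const_mul]
      have : 0 ≤ 4 * ‖w‖ ^ p := by positivity
      nlinarith [mul_le_mul_of_nonneg_left hM this]
  have h5 : ‖complexCharFun μ w‖ ≤ (1 - σ / 2) + 4 * M * ‖w‖ ^ p := by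
    have := norm_le_norm_add_norm_sub ((1 - σ / 2 : ℝ) : ℂ) (complexCharFun μ w)
    rw [Complex.norm_real, Real.norm_of_nonneg (by linarith), norm_sub_rev] at this
    linarith
  refine h5.trans ?_
  have := Real.add_one_le_exp (-(σ / 2) + 4 * M * ‖w‖ ^ p)
  linarith

/-- The Gaussian is its own Fourier transform. A Gaussian majorant of an indicator thus becomes a
Gaussian average of characteristic functions. -/
theorem exp_neg_sq_eq_integral_gaussianReal (t : ℝ) :
    ((Real.exp (-t ^ 2 / 2) : ℝ) : ℂ) =
      ∫ g : ℝ, Complex.exp ((g * t : ℝ) * Complex.I) ∂(gaussianReal 0 1) := by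
  have h := charFun_gaussianReal (μ := 0) (v := 1) t
  rw [charFun_apply_real] at h
  simp only [Complex.ofReal_mul]
  simp only [mul_comm (_ : ℂ) (t : ℂ)]
  rw [h]
  push_cast
  congr 1
  simp
  ring

theorem integral_exp_neg_mul_sq_gaussianReal_le {b : ℝ} (hb : 0 < b) :
    ∫ g : ℝ, Real.exp (-b * g ^ 2) ∂(gaussianReal 0 1) ≤ 1 / √b := by
  rw [integral_gaussianReal_eq_integral_smul one_ne_zero]
  have hpi : 0 < √(2 * Real.pi) := Real.sqrt_pos.2 (by positivity)
  calc ∫ g : ℝ, gaussianPDFReal 0 1 g • Real.exp (-b * g ^ 2)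
      ≤ ∫ g : ℝ, (√(2 * Real.pi))⁻¹ * Real.exp (-b * g ^ 2) := by
        refine integral_mono_of_nonneg (Filter.Eventually.of_forall fun g => ?_)
          ((integrable_exp_neg_mul_sq hb).const_mul _) (Filter.Eventually.of_forall fun g => ?_)
        · exact mul_nonneg (gaussianPDFReal_nonneg _ _ _) (Real.exp_pos _).le
        · refine mul_le_mul_of_nonneg_right ?_ (Real.exp_pos _).le
          rw [gaussianPDFReal_def]
          simp only [NNReal.coe_one, mul_one, sub_zero]
          refine mul_le_of_le_one_right (by positivity) (Real.exp_le_one_iff.2 ?_)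
          have := sq_nonneg g
          linarith
    _ = (√(2 * Real.pi))⁻¹ * √(Real.pi / b) := by rw [integral_const_mul, integral_gaussian]
    _ ≤ 1 / √b := by
        rw [Real.sqrt_div Real.pi_pos.le, ← mul_div_assoc]
        refine div_le_div_of_nonneg_right ?_ (Real.sqrt_nonneg b)
        rw [inv_mul_le_iff₀ hpi, mul_one]
        exact Real.sqrt_le_sqrt (by linarith [Real.pi_pos])

theorem integral_sq_gaussianReal : ∫ g : ℝ, g ^ 2 ∂(gaussianReal 0 1) = 1 := by
  have h := variance_id_gaussianReal (μ := 0) (v := 1)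
  rw [variance_eq_integral measurable_id.aemeasurable] at h
  simpa [integral_id_gaussianReal] using h

theorem exists_unit_sq_mul_re_nonneg (z : ℂ) : ∃ θ : ℂ, ‖θ‖ = 1 ∧ 0 ≤ (θ ^ 2 * z).re := by
  refine ⟨Complex.exp ((-(z.arg / 2) : ℝ) * Complex.I), Complex.norm_exp_ofReal_mul_I _, ?_⟩
  have h : Complex.exp ((-(z.arg / 2) : ℝ) * Complex.I) ^ 2 * z = ‖z‖ := by
    have hz : Complex.exp ((-(z.arg / 2) : ℝ) * Complex.I) ^ 2 * z =
        Complex.exp ((-(z.arg / 2) : ℝ) * Complex.I) ^ 2 *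
          (‖z‖ * Complex.exp (z.arg * Complex.I)) := by
      rw [Complex.norm_mul_exp_arg_mul_I]
    rw [hz, ← Complex.exp_nat_mul, mul_left_comm, ← Complex.exp_add]
    have : ((2 : ℕ) : ℂ) * ((-(z.arg / 2) : ℝ) * Complex.I) + z.arg * Complex.I = 0 := by
      push_cast; ring
    rw [this, Complex.exp_zero, mul_one]
  rw [h]
  simp

/-- A small ball estimate for sums of independent atoms with small coefficients. -/
theorem exists_smallBall_bound {p M : ℝ} (hp2 : 2 < p) (hp3 : p ≤ 3) :
    ∃ K : ℝ, 0 < K ∧ ∀ μ : Measure ℂ, IsNormalizedAtom μ →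
      Integrable (fun x : ℂ => ‖x‖ ^ p) μ → ∫ x, ‖x‖ ^ p ∂μ ≤ M →
      ∀ (N : ℕ) (c : Fin N → ℂ) (κ β r : ℝ), 0 < κ → κ ≤ ∑ i, ‖c i‖ ^ 2 → (∀ i, ‖c i‖ ≤ β) →
        0 < r → (Measure.pi fun _ : Fin N => μ).real {x | ‖∑ i, x i * c i‖ ≤ r} ≤
          K * (r / √κ + (β / r) ^ 2) := by
  -- For `‖w‖ ≤ g₀` the remainder `4M‖w‖^p` is at most `‖w‖²/8`, half of what the variance gives; `p
  -- > 2` makes such a `g₀` possible.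
  obtain ⟨g₀, hg0, hg1, hgM⟩ : ∃ g₀ : ℝ, 0 < g₀ ∧ g₀ ≤ 1 ∧ 4 * M * g₀ ^ (p - 2) ≤ 1 / 8 := by
    have h1 : Filter.Tendsto (fun g : ℝ => 4 * M * g ^ (p - 2)) (nhdsWithin 0 (Set.Ioi 0))
        (nhds (4 * M * 0 ^ (p - 2))) := by
      refine (((Real.continuousAt_rpow_const 0 (p - 2) (Or.inr (by linarith))).tendsto).const_mul
        (4 * M)).mono_left nhdsWithin_le_nhds
    rw [Real.zero_rpow (by linarith), mul_zero] at h1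
    obtain ⟨g, hg, hg'⟩ := ((h1.eventually (ge_mem_nhds (show (0 : ℝ) < 1 / 8 by norm_num))).and
      (Ioc_mem_nhdsGT (show (0 : ℝ) < 1 by norm_num))).exists
    exact ⟨g, hg'.1, hg'.2, hg⟩
  refine ⟨2 * (3 + (1 / g₀) ^ 2), by positivity, fun μ hμ hpi hpM N c κ β r hκ hκc hβ hr => ?_⟩
  have := hμ.isProbabilityMeasure
  have hM0 : 0 ≤ M := le_trans (integral_nonneg fun x => by positivity) hpM
  set S := ∑ i, ‖c i‖ ^ 2 with hS
  have hN : 0 ≤ β := by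
    by_contra hneg
    have : ∀ i, False := fun i => by linarith [hβ i, norm_nonneg (c i)]
    have : S = 0 := Finset.sum_eq_zero fun i _ => (this i).elim
    linarith
  -- One rotation for the whole sum: it makes the total contribution of `E ξ²` to the variance of
  -- the rotated real part nonnegative, though single terms may be negative.
  obtain ⟨θ, hθ, hθ2⟩ := exists_unit_sq_mul_re_nonneg ((∑ i, c i ^ 2) * ∫ x, x ^ 2 ∂μ)
  let Y : (Fin N → ℂ) → ℝ := fun x => (θ * ∑ i, x i * c i).re
  have hYc : Continuous Y := Complex.continuous_re.comp (by fun_prop)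
  let w : ℝ → Fin N → ℂ := fun g i => (g / r : ℝ) * θ * c i
  have hw : ∀ g i, ‖w g i‖ = |g| / r * ‖c i‖ := by
    intro g i
    simp only [w, norm_mul, hθ, mul_one, Complex.norm_real, Real.norm_eq_abs, abs_div,
      abs_of_pos hr]
  set γ := gaussianReal 0 1
  have hexp : ∀ g : ℝ, ∫ x, Complex.exp ((g * (Y x / r) : ℝ) * Complex.I)
      ∂(Measure.pi fun _ : Fin N => μ) = ∏ i, complexCharFun μ (w g i) := by
    intro g
    simp only [complexCharFun]
    rw [← integral_fintype_prod_eq_prod]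
    refine integral_congr_ae (Filter.Eventually.of_forall fun x => ?_)
    simp only [← Complex.exp_sum, ← Finset.sum_mul, ← Complex.ofReal_sum, ← Complex.re_sum]
    congr 3
    have : ∑ i, w g i * x i = (g / r : ℝ) * (θ * ∑ i, x i * c i) := by
      rw [Finset.mul_sum, Finset.mul_sum]
      exact Finset.sum_congr rfl fun i _ => by simp only [w]; ring
    rw [this, Complex.re_ofReal_mul]
    simp only [Y]
    ring
  -- When all arguments are within `g₀`, the product decays like a Gaussian in `g`. Otherwise the
  -- last term already exceeds the trivial bound 1.
  have hbound : ∀ g : ℝ, ‖∏ i, complexCharFun μ (w g i)‖ ≤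
      Real.exp (-(κ / (8 * r ^ 2)) * g ^ 2) + (β / (g₀ * r)) ^ 2 * g ^ 2 := by
    intro g
    rw [norm_prod]
    have hexp0 := Real.exp_pos (-(κ / (8 * r ^ 2)) * g ^ 2)
    have hsq0 : 0 ≤ (β / (g₀ * r)) ^ 2 * g ^ 2 := by positivity
    by_cases hg : |g| / r * β ≤ g₀
    · have hwi : ∀ i, ‖w g i‖ ≤ g₀ := fun i => by
        rw [hw]
        exact le_trans (mul_le_mul_of_nonneg_left (hβ i) (by positivity)) hg
      have h1 : ∏ i, ‖complexCharFun μ (w g i)‖ ≤ ∏ i, Real.exp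
          (-((‖w g i‖ ^ 2 / 2 + (w g i ^ 2 * ∫ x, x ^ 2 ∂μ).re / 2) / 2) +
            ‖w g i‖ ^ 2 / 8) := by
        refine Finset.prod_le_prod (fun i _ => norm_nonneg _) fun i _ => ?_
        refine (norm_complexCharFun_le hμ hp2.le hp3 hpi hpM ((hwi i).trans hg1)).trans ?_
        refine Real.exp_le_exp.2 (add_le_add le_rfl ?_)
        rcases (norm_nonneg (w g i)).eq_or_lt with h0 | h0
        · rw [← h0, Real.zero_rpow (by linarith)]; simp
        · have e : ‖w g i‖ ^ p = ‖w g i‖ ^ (p - 2) * ‖w g i‖ ^ 2 := by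
            rw [← Real.rpow_natCast, ← Real.rpow_add h0]
            congr 1
            norm_num
          have h2 : ‖w g i‖ ^ (p - 2) ≤ g₀ ^ (p - 2) :=
            Real.rpow_le_rpow h0.le (hwi i) (by linarith)
          calc 4 * M * ‖w g i‖ ^ p = (4 * M * ‖w g i‖ ^ (p - 2)) * ‖w g i‖ ^ 2 := by rw [e]; ring
            _ ≤ (1 / 8) * ‖w g i‖ ^ 2 := by
                refine mul_le_mul_of_nonneg_right (le_trans ?_ hgM) (by positivity)
                exact mul_le_mul_of_nonneg_left h2 (by positivity)
            _ = _ := by ring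
      refine h1.trans (le_add_of_le_of_nonneg ?_ hsq0)
      rw [← Real.exp_sum]
      refine Real.exp_le_exp.2 ?_
      have e1 : ∑ i, ‖w g i‖ ^ 2 = (g / r) ^ 2 * S := by
        rw [hS, Finset.mul_sum]
        refine Finset.sum_congr rfl fun i _ => ?_
        rw [hw, mul_pow, div_pow, sq_abs, div_pow]
      have e2 : 0 ≤ ∑ i, (w g i ^ 2 * ∫ x, x ^ 2 ∂μ).re := by
        have : ∑ i, (w g i ^ 2 * ∫ x, x ^ 2 ∂μ).re =
            (g / r) ^ 2 * (θ ^ 2 * ((∑ i, c i ^ 2) * ∫ x, x ^ 2 ∂μ)).re := by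
          rw [← Complex.re_sum, ← Complex.re_ofReal_mul, Finset.sum_mul, Finset.mul_sum,
            Finset.mul_sum]
          congr 1
          refine Finset.sum_congr rfl fun i _ => ?_
          simp only [w]
          push_cast
          ring
        rw [this]
        exact mul_nonneg (sq_nonneg _) hθ2
      have e3 : ∑ i, (-((‖w g i‖ ^ 2 / 2 + (w g i ^ 2 * ∫ x, x ^ 2 ∂μ).re / 2) / 2) +
            ‖w g i‖ ^ 2 / 8) =
          -(1 / 8) * ∑ i, ‖w g i‖ ^ 2 - (1 / 4) * ∑ i, (w g i ^ 2 * ∫ x, x ^ 2 ∂μ).re := by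
        rw [Finset.mul_sum, Finset.mul_sum, ← Finset.sum_sub_distrib]
        exact Finset.sum_congr rfl fun i _ => by ring
      rw [e3, e1]
      have e4 : (g / r) ^ 2 * κ ≤ (g / r) ^ 2 * S := by gcongr
      have e5 : -(κ / (8 * r ^ 2)) * g ^ 2 = -(1 / 8) * ((g / r) ^ 2 * κ) := by
        field_simp
      rw [e5]
      linarith
    · rw [not_le] at hg
      have h1 : ∏ i, ‖complexCharFun μ (w g i)‖ ≤ 1 :=
        Finset.prod_le_one (fun i _ => norm_nonneg _) fun i _ => norm_complexCharFun_le_one μ _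
      have h2 : 1 ≤ (β / (g₀ * r)) ^ 2 * g ^ 2 := by
        have h3 : 1 ≤ β / (g₀ * r) * |g| := by
          rw [div_mul_eq_mul_div, le_div_iff₀ (by positivity), one_mul]
          rw [div_mul_eq_mul_div, lt_div_iff₀ hr] at hg
          linarith
        rw [← sq_abs g, ← mul_pow]
        exact one_le_pow₀ h3
      linarith
  have hfub : ((∫ x, Real.exp (-(Y x / r) ^ 2 / 2) ∂(Measure.pi fun _ : Fin N => μ) : ℝ) : ℂ) =
      ∫ g, ∏ i, complexCharFun μ (w g i) ∂γ := by
    rw [← integral_complex_ofReal]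
    simp only [exp_neg_sq_eq_integral_gaussianReal, ← hexp]
    refine integral_integral_swap ?_
    refine Integrable.of_bound (Continuous.aestronglyMeasurable ?_) 1
      (Filter.Eventually.of_forall fun z => ?_)
    · unfold Function.uncurry
      fun_prop
    · exact (Complex.norm_exp_ofReal_mul_I _).le
  have hE : ∫ x, Real.exp (-(Y x / r) ^ 2 / 2) ∂(Measure.pi fun _ : Fin N => μ) ≤
      3 * (r / √κ) + (1 / g₀) ^ 2 * (β / r) ^ 2 := by
    have hg2i : Integrable (fun g : ℝ => g ^ 2) γ := by
      have := (memLp_id_gaussianReal (μ := 0) (v := 1) 2).integrable_sq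
      simpa using this
    have hgi : Integrable (fun g : ℝ => Real.exp (-(κ / (8 * r ^ 2)) * g ^ 2)) γ :=
      Integrable.of_bound (by fun_prop) 1 (Filter.Eventually.of_forall fun g => by
        rw [Real.norm_of_nonneg (Real.exp_pos _).le]
        refine Real.exp_le_one_iff.2 ?_
        have : 0 ≤ κ / (8 * r ^ 2) * g ^ 2 := by positivity
        linarith)
    have h1 : ‖∫ g, ∏ i, complexCharFun μ (w g i) ∂γ‖ ≤ _ :=
      norm_integral_le_of_norm_le (hgi.add (hg2i.const_mul ((β / (g₀ * r)) ^ 2)))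
        (Filter.Eventually.of_forall hbound)
    rw [← hfub, Complex.norm_real] at h1
    refine (le_trans (Real.le_norm_self _) h1).trans ?_
    have e := integral_add hgi (hg2i.const_mul ((β / (g₀ * r)) ^ 2))
    simp only [Pi.add_apply] at e ⊢
    rw [e, integral_const_mul, integral_sq_gaussianReal, mul_one]
    refine add_le_add ((integral_exp_neg_mul_sq_gaussianReal_le (by positivity)).trans ?_) ?_
    · rw [Real.sqrt_div hκ.le, Real.sqrt_mul (by norm_num), Real.sqrt_sq hr.le, one_div_div,
        mul_div_assoc]
      refine mul_le_mul_of_nonneg_right ?_ (by positivity)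
      rw [Real.sqrt_le_left (by norm_num)]
      norm_num
    · rw [← mul_pow]
      refine le_of_eq ?_
      congr 1
      field_simp
  set T : Set (Fin N → ℂ) := {x | ‖∑ i, x i * c i‖ ≤ r} with hT
  have hTm : MeasurableSet T := (isClosed_le (by fun_prop) continuous_const).measurableSet
  -- On the small ball event the exponent is at least `-1/2`, and `exp(-1/2) ≥ 1/2`.
  have hmk : ∀ x, T.indicator (fun _ => (1 / 2 : ℝ)) x ≤ Real.exp (-(Y x / r) ^ 2 / 2) := by
    intro x
    by_cases hx : x ∈ T
    · rw [Set.indicator_of_mem hx]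
      have hx' : ‖∑ i, x i * c i‖ ≤ r := hx
      have h1 : |Y x| ≤ r := by
        refine (Complex.abs_re_le_norm _).trans ?_
        rwa [norm_mul, hθ, one_mul]
      have h2 : (Y x / r) ^ 2 ≤ 1 := by
        rw [div_pow, div_le_one (by positivity), ← sq_abs]
        gcongr
      have := Real.add_one_le_exp (-(Y x / r) ^ 2 / 2)
      linarith
    · rw [Set.indicator_of_notMem hx]; positivity
  have hEi : Integrable (fun x => Real.exp (-(Y x / r) ^ 2 / 2))
      (Measure.pi fun _ : Fin N => μ) :=
    Integrable.of_bound (by fun_prop) 1 (Filter.Eventually.of_forall fun x => by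
      rw [Real.norm_of_nonneg (Real.exp_pos _).le]
      refine Real.exp_le_one_iff.2 ?_
      have := sq_nonneg (Y x / r)
      linarith)
  have h1 := integral_mono ((integrable_const (1 / 2 : ℝ)).indicator hTm) hEi hmk
  rw [integral_indicator_const _ hTm, smul_eq_mul] at h1
  have h3 : 0 ≤ r / √κ := by positivity
  have h4 : 0 ≤ (β / r) ^ 2 := by positivity
  have h5 : 0 ≤ (1 / g₀) ^ 2 * (r / √κ) := by positivity
  nlinarith

end CharacteristicFunction

/-! ### Upper and lower bounds for Poisson weights. -/

section Poisson

/-- The weights of the Poisson distribution with parameter `l`. -/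
def poissonWeight (l : ℝ) (i : ℕ) : ℝ := Real.exp (-l) * l ^ i / i.factorial

theorem poissonWeight_pos {l : ℝ} (hl : 0 < l) (i : ℕ) : 0 < poissonWeight l i := by
  unfold poissonWeight; positivity

theorem poissonWeight_succ (l : ℝ) (i : ℕ) :
    poissonWeight l (i + 1) = poissonWeight l i * (l / (i + 1)) := by
  unfold poissonWeight
  rw [Nat.factorial_succ, pow_succ]
  push_cast
  field_simp

theorem sum_poissonWeight_le_one {l : ℝ} (hl : 0 ≤ l) (n : ℕ) :
    ∑ i ∈ Finset.range n, poissonWeight l i ≤ 1 := by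
  have h := Real.sum_le_exp_of_nonneg hl n
  simp only [poissonWeight, mul_div_assoc, ← Finset.mul_sum]
  calc Real.exp (-l) * ∑ i ∈ Finset.range n, l ^ i / i.factorial
      ≤ Real.exp (-l) * Real.exp l := by gcongr
    _ = 1 := by rw [← Real.exp_add]; simp

theorem poissonWeight_le_of_le {l : ℝ} (hl : 0 < l) {i j : ℕ} (hij : i ≤ j) (hj : (j : ℝ) ≤ l) :
    poissonWeight l i ≤ poissonWeight l j := by
  induction j, hij using Nat.le_induction with
  | base => exact le_rfl
  | succ j hij ih =>
    push_cast at hj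
    refine (ih (by linarith)).trans ?_
    rw [poissonWeight_succ]
    refine le_mul_of_one_le_right (poissonWeight_pos hl j).le ?_
    rw [le_div_iff₀ (by positivity)]
    linarith

/-- For fixed `i` the weight is largest at `l = i`, and Stirling's lower bound for the factorial
gives the value there. -/
theorem poissonWeight_le_inv_sqrt {l : ℝ} (hl : 0 < l) {i : ℕ} (hi : 1 ≤ i) :
    poissonWeight l i ≤ 1 / √(2 * Real.pi * i) := by
  have hi0 : (0 : ℝ) < i := by exact_mod_cast hi
  have h1 := Stirling.le_factorial_stirling i
  have h2 : l ^ i ≤ Real.exp l * (i / Real.exp 1) ^ i := by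
    have h3 : l ≤ i * Real.exp (l / i - 1) := by
      have := Real.add_one_le_exp (l / i - 1)
      rw [sub_add_cancel, div_le_iff₀ hi0] at this
      linarith
    calc l ^ i ≤ (i * Real.exp (l / i - 1)) ^ i := by gcongr
      _ = Real.exp l * (i / Real.exp 1) ^ i := by
        rw [mul_pow, div_pow, ← Real.exp_nat_mul, ← Real.exp_nat_mul]
        have : (i : ℝ) * (l / i - 1) = l - i * 1 := by field_simp
        rw [this, Real.exp_sub]
        ring
  have hpi := Real.pi_pos
  unfold poissonWeight
  rw [div_le_div_iff₀ (by positivity) (by positivity), one_mul]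
  calc Real.exp (-l) * l ^ i * √(2 * Real.pi * i)
      ≤ Real.exp (-l) * (Real.exp l * (i / Real.exp 1) ^ i) * √(2 * Real.pi * i) := by gcongr
    _ = (Real.exp (-l) * Real.exp l) * (√(2 * Real.pi * i) * (i / Real.exp 1) ^ i) := by ring
    _ = √(2 * Real.pi * i) * (i / Real.exp 1) ^ i := by rw [← Real.exp_add]; simp
    _ ≤ _ := h1

/-- Indices at least `l/4` are covered by the previous bound, because `2π/4 ≥ 1`. Smaller ones are
dominated by the weight at `⌈l/4⌉`, since weights increase up to `l`; `l ≥ 2` keeps that index below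
`l`. -/
theorem poissonWeight_le {l : ℝ} (hl : 2 ≤ l) (i : ℕ) : poissonWeight l i ≤ 1 / √l := by
  have hl0 : 0 < l := by linarith
  have key : ∀ j : ℕ, 1 ≤ j → l / 4 ≤ j → poissonWeight l j ≤ 1 / √l := by
    intro j hj hlj
    refine (poissonWeight_le_inv_sqrt hl0 hj).trans ?_
    refine one_div_le_one_div_of_le (Real.sqrt_pos.2 hl0) (Real.sqrt_le_sqrt ?_)
    nlinarith [Real.pi_gt_three]
  by_cases h : l / 4 ≤ i
  · refine key i ?_ h
    have : (0 : ℝ) < i := by linarith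
    exact_mod_cast this
  · rw [not_le] at h
    have h1 := Nat.le_ceil (l / 4)
    have h2 := Nat.ceil_lt_add_one (show 0 ≤ l / 4 by linarith)
    refine (poissonWeight_le_of_le hl0 (j := ⌈l / 4⌉₊) ?_ (by linarith)).trans (key _ ?_ h1)
    · exact_mod_cast (h.le.trans h1)
    · have : (0 : ℝ) < ⌈l / 4⌉₊ := by linarith
      exact_mod_cast this

theorem factorial_le_stirling {i : ℕ} (hi : 1 ≤ i) :
    (i.factorial : ℝ) ≤ Real.exp 1 * √i * (i / Real.exp 1) ^ i := by
  obtain ⟨k, rfl⟩ : ∃ k, i = k + 1 := ⟨i - 1, by omega⟩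
  have h := Stirling.stirlingSeq'_antitone (Nat.zero_le k)
  simp only [Function.comp_apply, Nat.succ_eq_add_one, zero_add, Stirling.stirlingSeq_one] at h
  rw [Stirling.stirlingSeq, div_le_div_iff₀ (by positivity) (by positivity)] at h
  have h2 : √(2 * ((k + 1 : ℕ) : ℝ)) = √2 * √((k + 1 : ℕ) : ℝ) := Real.sqrt_mul (by norm_num) _
  rw [h2] at h
  have h3 : 0 < √(2 : ℝ) := by positivity
  refine le_of_mul_le_mul_right ?_ h3
  refine h.trans (le_of_eq ?_)
  ring

/-- A Gaussian lower bound to the left of the mode: with `l = i(1 + y)` it follows from Stirling's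
upper bound and `log(1 + y) ≥ y - y²/2`. -/
theorem le_poissonWeight {l : ℝ} {i : ℕ} (hi : 1 ≤ i) (hil : (i : ℝ) ≤ l) :
    Real.exp (-((l - i) ^ 2 / (2 * i))) / (Real.exp 1 * √i) ≤ poissonWeight l i := by
  have hi0 : (0 : ℝ) < i := by exact_mod_cast hi
  have h1 := factorial_le_stirling hi
  set y := (l - i) / i with hy
  have hy0 : 0 ≤ y := div_nonneg (by linarith) hi0.le
  have hl : l = i * (1 + y) := by rw [hy]; field_simp; ring
  have h2 : Real.exp (i * (y - y ^ 2 / 2)) ≤ (1 + y) ^ i := by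
    have h3 : y - y ^ 2 / 2 ≤ Real.log (1 + y) := by
      refine le_trans ?_ (Real.le_log_one_add_of_nonneg hy0)
      rw [le_div_iff₀ (by positivity)]
      nlinarith [pow_nonneg hy0 3]
    calc Real.exp (i * (y - y ^ 2 / 2)) ≤ Real.exp (i * Real.log (1 + y)) := by gcongr
      _ = (1 + y) ^ i := by
        rw [Real.exp_nat_mul, Real.exp_log (by positivity)]
  have h4 : (l - i) ^ 2 / (2 * i) = i * (y ^ 2 / 2) := by rw [hy]; field_simp
  clear_value y
  unfold poissonWeight
  rw [h4, div_le_div_iff₀ (by positivity) (by positivity)]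
  calc Real.exp (-(i * (y ^ 2 / 2))) * i.factorial
      ≤ Real.exp (-(i * (y ^ 2 / 2))) * (Real.exp 1 * √i * (i / Real.exp 1) ^ i) := by gcongr
    _ = Real.exp (-l) * (i ^ i * Real.exp (i * (y - y ^ 2 / 2))) * (Real.exp 1 * √i) := by
        rw [div_pow, ← Real.exp_nat_mul, mul_one]
        have e : Real.exp (-l) * Real.exp (i * (y - y ^ 2 / 2)) =
            Real.exp (-(i * (y ^ 2 / 2))) / Real.exp i := by
          rw [← Real.exp_add, ← Real.exp_sub, hl]
          congr 1
          ring
        calc Real.exp (-(i * (y ^ 2 / 2))) * (Real.exp 1 * √i * (i ^ i / Real.exp i))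
            = (Real.exp (-(i * (y ^ 2 / 2))) / Real.exp i) * (i ^ i * (Real.exp 1 * √i)) := by
              ring
          _ = _ := by rw [← e]; ring
    _ ≤ Real.exp (-l) * (i ^ i * (1 + y) ^ i) * (Real.exp 1 * √i) := by gcongr
    _ = Real.exp (-l) * l ^ i * (Real.exp 1 * √i) := by rw [← mul_pow, ← hl]

/-- Consecutive weights have ratio `(i + 1)/l`, hence geometric growth as long as the index stays
below `b < l`. -/
theorem poissonWeight_le_pow_mul {l b : ℝ} (hl : 0 < l) (i s : ℕ) (hb : ((i + s : ℕ) : ℝ) ≤ b) :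
    poissonWeight l i ≤ (b / l) ^ s * poissonWeight l (i + s) := by
  induction s with
  | zero => simp
  | succ s ih =>
    push_cast at hb ih
    have hb0 : 0 ≤ b := le_trans (by positivity) hb
    refine (ih (by linarith)).trans ?_
    rw [← add_assoc, poissonWeight_succ, pow_succ, mul_assoc]
    refine mul_le_mul_of_nonneg_left ?_ (by positivity)
    have hp := poissonWeight_pos hl (i + s)
    push_cast
    have h1 : 1 ≤ b / l * (l / (i + s + 1)) := by
      have e : b / l * (l / (i + s + 1)) = b / (i + s + 1) := by field_simp
      rw [e, le_div_iff₀ (by positivity)]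
      linarith
    calc poissonWeight l (i + s) ≤ poissonWeight l (i + s) * (b / l * (l / (i + s + 1))) :=
          le_mul_of_one_le_right hp.le h1
      _ = _ := by ring

end Poisson

/-! ### The normalized coefficients of flat polynomials. -/

section WeylCoefficients

/-- The coefficients of `∑ a_i x^i / √i!` as a linear form in `a`, multiplied by a nowhere
vanishing entire function of `x` that makes them of order one for `x` near `z`. -/
def weylCoeff (z x : ℂ) (i : ℕ) : ℂ :=
  x ^ i / (√(i.factorial : ℝ) : ℝ) *
    Complex.exp (-(x * (starRingEnd ℂ) z - (‖z‖ ^ 2 / 2 : ℝ)))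

theorem weylCoeff_ne_zero {z x : ℂ} (hx : x ≠ 0) (i : ℕ) : weylCoeff z x i ≠ 0 := by
  unfold weylCoeff
  refine mul_ne_zero (div_ne_zero (pow_ne_zero _ hx) ?_) (Complex.exp_ne_zero _)
  rw [Complex.ofReal_ne_zero]
  positivity

/-- Completing the square: the exponential factor has squared modulus `exp(‖x - z‖² - ‖x‖²)`. All
size estimates thereby reduce to a Poisson law of parameter `‖x‖²`. -/
theorem norm_weylCoeff_sq (z x : ℂ) (i : ℕ) :
    ‖weylCoeff z x i‖ ^ 2 = poissonWeight (‖x‖ ^ 2) i * Real.exp (‖x - z‖ ^ 2) := by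
  have h1 : ‖x - z‖ ^ 2 = ‖x‖ ^ 2 + ‖z‖ ^ 2 - 2 * (x * (starRingEnd ℂ) z).re := by
    rw [← Complex.normSq_eq_norm_sq, ← Complex.normSq_eq_norm_sq, ← Complex.normSq_eq_norm_sq,
      Complex.normSq_sub]
  unfold weylCoeff poissonWeight
  rw [norm_mul, norm_div, norm_pow, Complex.norm_exp, Complex.norm_real, Real.norm_eq_abs,
    abs_of_nonneg (Real.sqrt_nonneg _), mul_pow, div_pow, Real.sq_sqrt (by positivity),
    ← Real.exp_nat_mul, h1]
  have e : ((2 : ℕ) : ℝ) * (-(x * (starRingEnd ℂ) z - (‖z‖ ^ 2 / 2 : ℝ))).re =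
      -‖x‖ ^ 2 + (‖x‖ ^ 2 + ‖z‖ ^ 2 - 2 * (x * (starRingEnd ℂ) z).re) := by
    simp only [Complex.neg_re, Complex.sub_re, Complex.ofReal_re]
    push_cast
    ring
  rw [e, Real.exp_add]
  ring

variable {z x : ℂ} {C : ℝ}

theorem sum_norm_weylCoeff_sq_le (hx : ‖x - z‖ ≤ C) (n : ℕ) :
    ∑ i : Fin n, ‖weylCoeff z x i‖ ^ 2 ≤ Real.exp (C ^ 2) := by
  simp only [norm_weylCoeff_sq, ← Finset.sum_mul]
  rw [Fin.sum_univ_eq_sum_range (fun i => poissonWeight (‖x‖ ^ 2) i)]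
  have h1 := sum_poissonWeight_le_one (sq_nonneg ‖x‖) n
  calc (∑ i ∈ Finset.range n, poissonWeight (‖x‖ ^ 2) i) * Real.exp (‖x - z‖ ^ 2)
      ≤ 1 * Real.exp (C ^ 2) := by gcongr
    _ = _ := one_mul _

theorem norm_weylCoeff_sq_le (hx : ‖x - z‖ ≤ C) (h2 : 2 ≤ ‖x‖) (i : ℕ) :
    ‖weylCoeff z x i‖ ^ 2 ≤ Real.exp (C ^ 2) / ‖x‖ := by
  rw [norm_weylCoeff_sq]
  have h1 := poissonWeight_le (l := ‖x‖ ^ 2) (by nlinarith) i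
  rw [Real.sqrt_sq (norm_nonneg x)] at h1
  calc poissonWeight (‖x‖ ^ 2) i * Real.exp (‖x - z‖ ^ 2)
      ≤ 1 / ‖x‖ * Real.exp (C ^ 2) := by gcongr
    _ = _ := by ring

/-- An index close to the maximum of the coefficients. -/
theorem exists_index_near_peak {n : ℕ} {R : ℝ} (hR : 0 ≤ R) (hC : 0 ≤ C)
    (hRn : R ≤ √n + 2 * C) :
    ∃ i₀ : ℕ, i₀ ≤ n ∧ (i₀ : ℝ) ≤ R ^ 2 ∧ R ^ 2 ≤ i₀ + 1 + 4 * C * R := by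
  have hn : √(n : ℝ) ^ 2 = n := Real.sq_sqrt (Nat.cast_nonneg n)
  -- In the bulk the mode of the Poisson law is available; at the edge the last index `n` replaces
  -- it, and `R² - n = (R - √n)(R + √n) ≤ 4CR` shows that it is only a bounded number of standard
  -- deviations away.
  by_cases h : R ^ 2 ≤ n
  · refine ⟨⌊R ^ 2⌋₊, ?_, Nat.floor_le (sq_nonneg R), ?_⟩
    · exact Nat.floor_le_of_le h
    · have := Nat.lt_floor_add_one (R ^ 2)
      have : 0 ≤ 4 * C * R := by positivity
      linarith
  · rw [not_le] at h
    refine ⟨n, le_rfl, h.le, ?_⟩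
    have h1 : √(n : ℝ) ≤ R := Real.sqrt_le_left hR |>.2 h.le
    have h2 : (R - √n) * (R + √n) ≤ 2 * C * (2 * R) :=
      mul_le_mul (by linarith) (by linarith) (by positivity) (by positivity)
    nlinarith

/-- An index within `b` standard deviations below the mode. The condition `2b ≤ R` gives `i ≥ R²/2`,
which turns the Gaussian exponent into at most `b²`. -/
theorem le_norm_weylCoeff_sq {R b : ℝ} (hR : ‖x‖ = R) (hR1 : 2 ≤ R) {i : ℕ}
    (hi : (i : ℝ) ≤ R ^ 2) (hib : R ^ 2 ≤ i + b * R) (_hb0 : 0 ≤ b) (hb : 2 * b ≤ R) :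
    Real.exp (-b ^ 2) / (Real.exp 1 * R) ≤ ‖weylCoeff z x i‖ ^ 2 := by
  have hi2 : R ^ 2 / 2 ≤ i := by nlinarith
  have hi1 : (1 : ℝ) ≤ i := by nlinarith
  rw [norm_weylCoeff_sq, hR]
  have h1 := le_poissonWeight (l := R ^ 2) (by exact_mod_cast hi1) hi
  have h2 : (R ^ 2 - i) ^ 2 / (2 * i) ≤ b ^ 2 := by
    rw [div_le_iff₀ (by linarith)]
    have : (R ^ 2 - i) ^ 2 ≤ (b * R) ^ 2 := by
      refine pow_le_pow_left₀ (by linarith) (by linarith) 2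
    nlinarith [sq_nonneg b, mul_nonneg (sq_nonneg b) (sq_nonneg R)]
  have h3 : √(i : ℝ) ≤ R := Real.sqrt_le_left (by linarith) |>.2 hi
  calc Real.exp (-b ^ 2) / (Real.exp 1 * R)
      ≤ Real.exp (-((R ^ 2 - i) ^ 2 / (2 * i))) / (Real.exp 1 * √i) := by
        have : 0 < √(i : ℝ) := Real.sqrt_pos.2 (by linarith)
        gcongr
    _ ≤ poissonWeight (R ^ 2) i * 1 := by rw [mul_one]; exact h1
    _ ≤ _ := by
        refine mul_le_mul_of_nonneg_left (Real.one_le_exp (sq_nonneg _)) ?_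
        exact (poissonWeight_pos (by positivity) i).le

/-- About `R` indices just below the near-peak index each contribute a constant over `R`. The lower
bound for the variance is therefore independent of `n`, even at the edge. -/
theorem le_sum_norm_weylCoeff_sq {n : ℕ} {R : ℝ} (hR : ‖x‖ = R) (hR2 : 2 * (4 * C + 3) ≤ R)
    (hC : 0 ≤ C) (hRn : R ≤ √n + 2 * C) :
    Real.exp (-(4 * C + 3) ^ 2) / (2 * Real.exp 1) ≤
      ∑ i : Fin (n + 1), ‖weylCoeff z x i‖ ^ 2 := by
  have hR0 : 2 ≤ R := by linarith
  obtain ⟨i₀, hi0n, hi0, hi0'⟩ := exists_index_near_peak (by linarith) hC hRn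
  set h := ⌊R⌋₊ with hh
  have hhR : (h : ℝ) ≤ R := Nat.floor_le (by linarith)
  have hh1 : R < h + 1 := Nat.lt_floor_add_one R
  have hi0h : h ≤ i₀ := by
    have : (h : ℝ) ≤ i₀ := by nlinarith
    exact_mod_cast this
  have hterm : ∀ i ∈ Finset.Ico (i₀ - h) i₀,
      Real.exp (-(4 * C + 3) ^ 2) / (Real.exp 1 * R) ≤ ‖weylCoeff z x i‖ ^ 2 := by
    intro i hi
    rw [Finset.mem_Ico] at hi
    have h1 : (i : ℝ) ≤ i₀ := by exact_mod_cast hi.2.le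
    have h2 : (i₀ : ℝ) ≤ i + h := by exact_mod_cast (by omega : i₀ ≤ i + h)
    exact le_norm_weylCoeff_sq hR hR0 (by linarith) (by nlinarith) (by linarith) hR2
  rw [Fin.sum_univ_eq_sum_range (fun i => ‖weylCoeff z x i‖ ^ 2)]
  have hsub : Finset.Ico (i₀ - h) i₀ ⊆ Finset.range (n + 1) := by
    intro i hi
    rw [Finset.mem_Ico] at hi
    rw [Finset.mem_range]
    omega
  refine le_trans ?_ (Finset.sum_le_sum_of_subset_of_nonneg hsub fun _ _ _ => by positivity)
  refine le_trans ?_ (Finset.card_nsmul_le_sum _ _ _ hterm)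
  rw [Nat.card_Ico, nsmul_eq_mul, show i₀ - (i₀ - h) = h by omega, ← mul_div_assoc,
    div_le_div_iff₀ (by positivity) (by positivity)]
  have he := Real.exp_pos (-(4 * C + 3) ^ 2)
  have he1 := Real.exp_pos 1
  have h3 : R ≤ 2 * h := by linarith
  nlinarith [mul_le_mul_of_nonneg_left h3 (mul_pos he he1).le]

end WeylCoefficients

/-! ### Values of a flat polynomial are very rarely tiny. -/

theorem IsNormalizedAtom.measure_lt_norm_le {μ : Measure ℂ} (h : IsNormalizedAtom μ) {K : ℝ}
    (hK : 0 < K) : μ {x | K < ‖x‖} ≤ ENNReal.ofReal (K ^ 2)⁻¹ := by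
  have := h.isProbabilityMeasure
  have h1 := mul_meas_ge_le_integral_of_nonneg (μ := μ) (f := fun x : ℂ => ‖x‖ ^ 2)
    (Filter.Eventually.of_forall fun x => sq_nonneg _) h.integrable_sq (K ^ 2)
  rw [h.variance_eq_one] at h1
  have h2 : μ.real {x : ℂ | K ^ 2 ≤ ‖x‖ ^ 2} ≤ (K ^ 2)⁻¹ := by
    rw [← one_div, le_div_iff₀ (by positivity), mul_comm]
    exact h1
  have h3 : μ {x : ℂ | K < ‖x‖} ≤ μ {x : ℂ | K ^ 2 ≤ ‖x‖ ^ 2} :=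
    measure_mono fun x hx => pow_le_pow_left₀ hK.le (le_of_lt hx) 2
  refine h3.trans ?_
  rw [← ofReal_measureReal]
  exact ENNReal.ofReal_le_ofReal h2

/-- Below the mode, `s` consecutive ratios are each at most `1 - s/R²`, so the squared coefficient
gains `exp(s²/R²) ≥ exp(ℓ²)`. For `ℓ ≥ 4` this beats the cutoff `exp ℓ` for the size of an atom. -/
theorem weylCoeff_ratio {z x : ℂ} {R : ℝ} (hR : ‖x‖ = R) (hR0 : 0 < R) {i s : ℕ} {ℓ : ℝ}
    (hℓ : 4 ≤ ℓ) (hs : R * ℓ ≤ s) (his : ((i + s : ℕ) : ℝ) ≤ R ^ 2 - s) :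
    (1 / 2 + Real.exp ℓ) * ‖weylCoeff z x i‖ ≤ 1 / 2 * ‖weylCoeff z x (i + s)‖ := by
  have hb0 : 0 ≤ R ^ 2 - s := le_trans (Nat.cast_nonneg _) his
  have h1 := poissonWeight_le_pow_mul (l := R ^ 2) (by positivity) i s his
  have h2 : ((R ^ 2 - s) / R ^ 2) ^ s ≤ Real.exp (-ℓ ^ 2) := by
    have h3 : (R ^ 2 - s) / R ^ 2 ≤ Real.exp (-(s / R ^ 2)) := by
      refine le_trans (le_of_eq ?_) (Real.one_sub_le_exp_neg _)
      field_simp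
    refine (pow_le_pow_left₀ (by positivity) h3 s).trans ?_
    rw [← Real.exp_nat_mul]
    refine Real.exp_le_exp.2 ?_
    have h4 : ℓ ^ 2 ≤ s * (s / R ^ 2) := by
      rw [← mul_div_assoc, le_div_iff₀ (by positivity)]
      have := mul_le_mul hs hs (by positivity) (Nat.cast_nonneg s)
      nlinarith
    linarith
  have h5 : ‖weylCoeff z x i‖ ^ 2 ≤ Real.exp (-ℓ ^ 2) * ‖weylCoeff z x (i + s)‖ ^ 2 := by
    rw [norm_weylCoeff_sq, norm_weylCoeff_sq, hR, ← mul_assoc]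
    refine mul_le_mul_of_nonneg_right (h1.trans ?_) (Real.exp_pos _).le
    exact mul_le_mul_of_nonneg_right h2 (poissonWeight_pos (by positivity) _).le
  have h6 : ‖weylCoeff z x i‖ ≤ Real.exp (-ℓ ^ 2 / 2) * ‖weylCoeff z x (i + s)‖ := by
    refine le_of_sq_le_sq ?_ (by positivity)
    rw [mul_pow, ← Real.exp_nat_mul, show ((2 : ℕ) : ℝ) * (-ℓ ^ 2 / 2) = -ℓ ^ 2 by push_cast; ring]
    exact h5
  have h7 : (1 / 2 + Real.exp ℓ) * Real.exp (-ℓ ^ 2 / 2) ≤ 1 / 2 := by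
    have e1 : 1 ≤ Real.exp ℓ := Real.one_le_exp (by linarith)
    have e2 : (4 : ℝ) ≤ Real.exp 2 := by
      have h := Real.exp_one_gt_two
      have e : Real.exp 2 = Real.exp 1 * Real.exp 1 := by
        rw [← Real.exp_add]; norm_num
      nlinarith
    have e3 : Real.exp ℓ * Real.exp 2 * Real.exp (-ℓ ^ 2 / 2) ≤ 1 := by
      rw [← Real.exp_add, ← Real.exp_add]
      refine Real.exp_le_one_iff.2 ?_
      nlinarith
    have e4 := Real.exp_pos (-ℓ ^ 2 / 2)
    have e5 : Real.exp ℓ * 4 * Real.exp (-ℓ ^ 2 / 2) ≤ 1 :=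
      le_trans (by gcongr) e3
    nlinarith
  calc (1 / 2 + Real.exp ℓ) * ‖weylCoeff z x i‖
      ≤ (1 / 2 + Real.exp ℓ) * (Real.exp (-ℓ ^ 2 / 2) * ‖weylCoeff z x (i + s)‖) := by gcongr
    _ = ((1 / 2 + Real.exp ℓ) * Real.exp (-ℓ ^ 2 / 2)) * ‖weylCoeff z x (i + s)‖ := by ring
    _ ≤ _ := by gcongr

/-- The hypothesis is the lower bound for a coefficient lying `3ℓ²` standard deviations below the
mode; `9ℓ⁴ + ℓ + 16 ≤ 10ℓ⁴` absorbs the other factors. -/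
theorem exp_neg_le_half_of_le {ℓ R y : ℝ} (hℓ : 4 ≤ ℓ) (hR0 : 0 < R) (hRℓ : R ≤ Real.exp ℓ)
    (hy : 0 ≤ y) (h : Real.exp (-(3 * ℓ ^ 2) ^ 2) / (Real.exp 1 * R) ≤ y ^ 2) :
    Real.exp (-(5 * ℓ ^ 4)) ≤ 1 / 2 * y := by
  refine le_of_sq_le_sq ?_ (by positivity)
  rw [mul_pow, ← Real.exp_nat_mul]
  have e1 : Real.exp 1 ≤ 4 := by have := Real.exp_one_lt_three; linarith
  have h16 : (16 : ℝ) ≤ Real.exp 16 := by have := Real.add_one_le_exp 16; linarith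
  have e2 : 16 * R ≤ Real.exp (16 + ℓ) := by
    rw [Real.exp_add]
    gcongr
  have hsq : 16 ≤ ℓ ^ 2 := by nlinarith
  have h4 : 16 * ℓ ^ 2 ≤ ℓ ^ 4 := by nlinarith
  have e3 : Real.exp ((2 : ℕ) * -(5 * ℓ ^ 4)) * (16 * R) ≤ Real.exp (-(3 * ℓ ^ 2) ^ 2) := by
    refine (mul_le_mul_of_nonneg_left e2 (Real.exp_pos _).le).trans ?_
    rw [← Real.exp_add]
    refine Real.exp_le_exp.2 ?_
    push_cast
    nlinarith
  refine le_trans ?_ (mul_le_mul_of_nonneg_left h (by norm_num))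
  rw [← mul_div_assoc, le_div_iff₀ (by positivity)]
  have h0 := Real.exp_pos ((2 : ℕ) * -(5 * ℓ ^ 4))
  generalize Real.exp ((2 : ℕ) * -(5 * ℓ ^ 4)) = X at *
  have : X * (Real.exp 1 * R) ≤ X * (4 * R) := by gcongr
  linarith

theorem pow_add_mul_exp_le {κ ℓ : ℝ} (hκ0 : 0 < κ) (hκ1 : κ < 1) (hℓ : 0 ≤ ℓ) {m : ℕ}
    (hm1 : ℓ ≤ m) (hm2 : (m : ℝ) ≤ ℓ + 1) :
    (1 - κ) ^ (m + 1) + (m + 1) * (Real.exp ℓ ^ 2)⁻¹ ≤ 3 * Real.exp (-(κ * ℓ)) := by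
  have g1 : (1 - κ) ^ (m + 1) ≤ Real.exp (-(κ * ℓ)) := by
    refine (pow_le_pow_left₀ (by linarith) (Real.one_sub_le_exp_neg κ) _).trans ?_
    rw [← Real.exp_nat_mul]
    refine Real.exp_le_exp.2 ?_
    push_cast
    nlinarith
  have g2 : ((m : ℝ) + 1) * (Real.exp ℓ ^ 2)⁻¹ ≤ 2 * Real.exp (-(κ * ℓ)) := by
    have k1 : (m : ℝ) + 1 ≤ 2 * Real.exp ℓ := by have := Real.add_one_le_exp ℓ; linarith
    have k2 : Real.exp ℓ * (Real.exp ℓ ^ 2)⁻¹ = Real.exp (-ℓ) := by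
      rw [Real.exp_neg]
      field_simp
    have k3 : Real.exp (-ℓ) ≤ Real.exp (-(κ * ℓ)) := Real.exp_le_exp.2 (by nlinarith)
    calc ((m : ℝ) + 1) * (Real.exp ℓ ^ 2)⁻¹ ≤ 2 * Real.exp ℓ * (Real.exp ℓ ^ 2)⁻¹ := by gcongr
      _ = 2 * Real.exp (-ℓ) := by rw [mul_assoc, k2]
      _ ≤ _ := by gcongr
  linarith

/-- About `ℓ` atoms are used, at indices spaced by about `Rℓ` below the peak. Each costs a factor `1
- κ`, and the probability that one of them exceeds `exp ℓ` is negligible. The chain descends at most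
`2ℓ²R` indices, so the lowest coefficient, which fixes the radius, is still at least of size
`exp(-O(ℓ⁴))`. -/
theorem measure_norm_sum_weylCoeff_le_exp {μ : Measure ℂ} (hμ : IsNormalizedAtom μ) {κ : ℝ}
    (hκ0 : 0 < κ) (hκ1 : κ < 1) (hκ : ∀ u : ℂ, μ {x | ‖x - u‖ ≤ 1 / 2} ≤ ENNReal.ofReal (1 - κ))
    {z x : ℂ} {C ℓ : ℝ} {n : ℕ} (hC : 0 ≤ C) (hℓ : 4 ≤ ℓ) (hCℓ : 1 + 4 * C ≤ ℓ)
    (hR : 6 * ℓ ^ 2 ≤ ‖x‖) (hRn : ‖x‖ ≤ √n + 2 * C) (hRℓ : ‖x‖ ≤ Real.exp ℓ) :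
    (iidMeasure μ (n + 1)).real
      {a | ‖∑ i, a i * weylCoeff z x i‖ ≤ Real.exp (-(5 * ℓ ^ 4))} ≤ 3 * Real.exp (-(κ * ℓ)) := by
  have := hμ.isProbabilityMeasure
  set R := ‖x‖ with hRdef
  have hR96 : 96 ≤ R := by nlinarith
  have hR0 : 0 < R := by linarith
  obtain ⟨i₀, hi0n, hi0, hi0'⟩ := exists_index_near_peak hR0.le hC hRn
  set m := ⌈ℓ⌉₊ with hm
  set s := ⌈R * ℓ⌉₊ with hs
  have hm1 : ℓ ≤ m := Nat.le_ceil _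
  have hm2 : (m : ℝ) ≤ ℓ + 1 := (Nat.ceil_lt_add_one (by linarith)).le
  have hs1 : R * ℓ ≤ s := Nat.le_ceil _
  have hs2 : (s : ℝ) ≤ R * ℓ + 1 := (Nat.ceil_lt_add_one (by positivity)).le
  have hms : ((m : ℝ) + 1) * s ≤ 2 * ℓ ^ 2 * R := by
    have h1 : ((m : ℝ) + 1) * s ≤ (ℓ + 2) * (R * ℓ + 1) :=
      mul_le_mul (by linarith) hs2 (by positivity) (by linarith)
    have h2 : R * ℓ + 1 ≤ R * (ℓ + 1) := by nlinarith
    have h3 : (ℓ + 2) * (ℓ + 1) ≤ 2 * ℓ ^ 2 := by nlinarith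
    calc ((m : ℝ) + 1) * s ≤ (ℓ + 2) * (R * ℓ + 1) := h1
      _ ≤ (ℓ + 2) * (R * (ℓ + 1)) := by gcongr
      _ = ((ℓ + 2) * (ℓ + 1)) * R := by ring
      _ ≤ _ := by gcongr
  have hpeak : R ^ 2 ≤ i₀ + ℓ ^ 2 * R := by
    have : 1 + 4 * C * R ≤ (1 + 4 * C) * R := by nlinarith
    have h2 : (1 + 4 * C) * R ≤ ℓ ^ 2 * R := by
      refine mul_le_mul_of_nonneg_right ?_ hR0.le
      nlinarith
    linarith
  have hmsi : (m + 1) * s ≤ i₀ := by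
    have : ((m : ℝ) + 1) * s ≤ i₀ := by nlinarith
    exact_mod_cast this
  have hmsi' : m * s + s ≤ i₀ := by linarith [add_one_mul m s]
  have hsi : s ≤ i₀ := by omega
  -- The chain starts one step `s` below the near-peak index, because the ratio estimate requires `i
  -- + s ≤ R² - s`.
  have hcons := concentrationBound_of_lacunary (μ := μ) (c := weylCoeff z x) (n := n)
    (i₀ := i₀ - s) (s := s) (m := m) (r := 1 / 2) (K := Real.exp ℓ)
    (κ := ENNReal.ofReal (1 - κ)) (by simpa using hκ0.le) hκ
    (Nat.one_le_iff_ne_zero.2 (by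
      intro h0
      rw [h0] at hs1
      push_cast at hs1
      nlinarith [mul_pos hR0 (show 0 < ℓ by linarith)])) (by omega) (by omega)
    (fun i => weylCoeff_ne_zero (norm_pos_iff.1 hR0) i)
    (fun i hi => weylCoeff_ratio rfl hR0 hℓ hs1 (by
      have : i + s + s ≤ i₀ := by omega
      have : ((i + s : ℕ) : ℝ) + s ≤ i₀ := by exact_mod_cast this
      linarith))
  set t := i₀ - s - m * s with ht
  have hti : t + (m + 1) * s = i₀ := by rw [add_one_mul]; omega
  have hti' : (t : ℝ) + (m + 1) * s = i₀ := by exact_mod_cast hti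
  -- `3ℓ²` is `2ℓ²` for the length of the chain plus `ℓ²` for the gap between the near-peak index
  -- and `R²`.
  have hlow := le_norm_weylCoeff_sq (z := z) (x := x) (R := R) (b := 3 * ℓ ^ 2) rfl (by linarith)
    (i := t) (by nlinarith [mul_nonneg (show (0 : ℝ) ≤ m + 1 by positivity) (Nat.cast_nonneg s)])
    (by linarith) (by positivity) (by linarith)
  have hrad := exp_neg_le_half_of_le hℓ hR0 hRℓ (norm_nonneg _) hlow
  have hc0 := hcons 0
  have hmain : iidMeasure μ (n + 1)
      {a | ‖∑ i, a i * weylCoeff z x i‖ ≤ Real.exp (-(5 * ℓ ^ 4))} ≤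
      ENNReal.ofReal ((1 - κ) ^ (m + 1) + (m + 1) * (Real.exp ℓ ^ 2)⁻¹) := by
    refine le_trans (measure_mono fun a ha => ?_) (hc0.trans ?_)
    · rw [Set.mem_ofPred_eq] at ha ⊢
      simp only [zero_add, sub_zero]
      exact ha.trans hrad
    · rw [ENNReal.ofReal_add (by have : 0 ≤ 1 - κ := by linarith
                                 positivity) (by positivity),
        ENNReal.ofReal_pow (by linarith), ENNReal.ofReal_mul (by positivity)]
      refine add_le_add le_rfl (mul_le_mul' ?_ (hμ.measure_lt_norm_le (Real.exp_pos _)))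
      rw [ENNReal.ofReal_add (by positivity) zero_le_one]
      simp
  rw [measureReal_def]
  have hnn : 0 ≤ (1 - κ) ^ (m + 1) := pow_nonneg (by linarith) _
  refine (ENNReal.toReal_le_of_le_ofReal (by positivity) hmain).trans ?_
  exact pow_add_mul_exp_le hκ0 hκ1 (by linarith) hm1 hm2

open Filter Topology in
theorem eventually_exp_neg_mul_rpow_le {κ a : ℝ} (hκ : 0 < κ) (ha : 0 < a) (A : ℝ) :
    ∀ᶠ n : ℕ in atTop, 3 * Real.exp (-(κ * (n : ℝ) ^ a)) ≤ (n : ℝ) ^ (-A) := by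
  have h1 : Tendsto (fun y : ℝ => y ^ (A / a) * Real.exp (-κ * y)) atTop (𝓝 0) :=
    tendsto_rpow_mul_exp_neg_mul_atTop_nhds_zero (A / a) κ hκ
  have h2 : Tendsto (fun n : ℕ => (n : ℝ) ^ a) atTop atTop :=
    (tendsto_rpow_atTop ha).comp tendsto_natCast_atTop_atTop
  have h3 := (h1.comp h2).eventually (ge_mem_nhds (show (0 : ℝ) < 1 / 3 by norm_num))
  filter_upwards [h3, eventually_ge_atTop 1] with n hn hn1
  have hn0 : (0 : ℝ) < n := by exact_mod_cast hn1
  simp only [Function.comp_apply] at hn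
  rw [← Real.rpow_mul hn0.le, mul_div_cancel₀ _ ha.ne', neg_mul] at hn
  rw [Real.rpow_neg hn0.le, ← one_div, le_div_iff₀ (by positivity)]
  linarith

open Filter Topology in
/-- The values of a random flat polynomial are rarely very small. -/
theorem eventually_measure_norm_sum_weylCoeff_le {ε C δ : ℝ} (hε : 0 < ε) (hC : 0 < C)
    (hδ : 0 < δ) (A : ℝ) : ∀ᶠ n : ℕ in atTop, ∀ μ : Measure ℂ, IsNormalizedAtom μ →
      ∫⁻ x, ‖x‖ₑ ^ (2 + ε) ∂μ ≤ ENNReal.ofReal C →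
      ∀ z x : ℂ, (n : ℝ) ^ ε ≤ ‖z‖ → ‖z‖ ≤ √n + C → ‖x - z‖ ≤ C →
        (iidMeasure μ (n + 1)).real
          {a | ‖∑ i, a i * weylCoeff z x i‖ ≤ Real.exp (-(n : ℝ) ^ δ)} ≤ (n : ℝ) ^ (-A) := by
  obtain ⟨κ, hκ0, hκ1, hκ⟩ := exists_nondegenerate hε hC
  -- With `ℓ = n^a`, `ℓ⁴ ≤ n^ε` leaves room below the peak for the chain, and `5ℓ⁴ ≤ ℓ⁸ ≤ n^δ` gives
  -- the radius.
  set a := min (ε / 4) (δ / 8) with ha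
  have ha0 : 0 < a := by positivity
  have hat : Tendsto (fun n : ℕ => (n : ℝ) ^ a) atTop atTop :=
    (tendsto_rpow_atTop ha0).comp tendsto_natCast_atTop_atTop
  filter_upwards [eventually_exp_neg_mul_rpow_le hκ0 ha0 A, eventually_ge_atTop 1,
    tendsto_natCast_atTop_atTop.eventually_ge_atTop (2 * C),
    hat.eventually_ge_atTop 6, hat.eventually_ge_atTop (1 + 4 * C),
    eventually_exp_neg_mul_rpow_le one_pos ha0 1]
    with n h1 hn1 hCn h6 hC4 hexp μ hμ hmom z x hz hz' hx
  have hn1' : (1 : ℝ) ≤ n := by exact_mod_cast hn1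
  have hn0 : (0 : ℝ) < n := by linarith
  set ℓ := (n : ℝ) ^ a with hℓ
  have hℓε : ℓ ^ 4 ≤ (n : ℝ) ^ ε := by
    rw [hℓ, ← Real.rpow_natCast, ← Real.rpow_mul hn0.le]
    refine Real.rpow_le_rpow_of_exponent_le hn1' ?_
    have := min_le_left (ε / 4) (δ / 8)
    push_cast
    linarith
  have hℓδ : ℓ ^ 8 ≤ (n : ℝ) ^ δ := by
    rw [hℓ, ← Real.rpow_natCast, ← Real.rpow_mul hn0.le]
    refine Real.rpow_le_rpow_of_exponent_le hn1' ?_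
    have := min_le_right (ε / 4) (δ / 8)
    push_cast
    linarith
  have hxz : ‖z‖ ≤ ‖x‖ + C := by
    have := norm_sub_norm_le z x
    rw [norm_sub_rev] at this
    linarith
  have hxz' : ‖x‖ ≤ ‖z‖ + C := by
    have := norm_sub_norm_le x z
    linarith
  have hsq : 36 ≤ ℓ ^ 2 := by nlinarith
  have h4 : 36 * ℓ ^ 2 ≤ ℓ ^ 4 := by nlinarith
  have hexpn : 3 * (n : ℝ) ≤ Real.exp ℓ := by
    rw [one_mul, Real.exp_neg, Real.rpow_neg_one] at hexp
    rw [← div_eq_mul_inv, div_le_iff₀ (Real.exp_pos _), inv_mul_eq_div,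
      le_div_iff₀ hn0] at hexp
    exact hexp
  have hsqrt : √(n : ℝ) ≤ n := by
    rw [Real.sqrt_le_left hn0.le]
    nlinarith
  have key := measure_norm_sum_weylCoeff_le_exp hμ hκ0 hκ1 (hκ μ hμ hmom) (z := z) (x := x)
    (ℓ := ℓ) (n := n) hC.le (by linarith) hC4 (by nlinarith) (by linarith) (by linarith)
  refine le_trans ?_ (key.trans h1)
  have := hμ.isProbabilityMeasure
  refine measureReal_mono fun y hy => ?_
  rw [Set.mem_ofPred_eq] at hy ⊢
  refine hy.trans (Real.exp_le_exp.2 ?_)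
  have : 5 * ℓ ^ 4 ≤ ℓ ^ 8 := by nlinarith [pow_pos (show 0 < ℓ by linarith) 4]
  linarith

/-! ### The normalized field and moments of its logarithm. -/

section WeylField

/-- The value at `x` of the flat polynomial with coefficients `a`, multiplied by a nowhere vanishing
entire function of `x`. -/
def weylField {n : ℕ} (z : ℂ) (a : Fin (n + 1) → ℂ) (x : ℂ) : ℂ :=
  ∑ i : Fin (n + 1), a i * weylCoeff z x i

variable {n : ℕ} {z x : ℂ} {a : Fin (n + 1) → ℂ}

theorem weylField_eq (z x : ℂ) (a : Fin (n + 1) → ℂ) :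
    weylField z a x = (flatPolynomial n a).eval x *
      Complex.exp (-(x * (starRingEnd ℂ) z - (‖z‖ ^ 2 / 2 : ℝ))) := by
  unfold weylField flatPolynomial coeffPolynomial flatCoeff weylCoeff
  rw [Polynomial.eval_finsetSum, Finset.sum_mul]
  refine Finset.sum_congr rfl fun i _ => ?_
  simp only [Polynomial.eval_mul, Polynomial.eval_C, Polynomial.eval_pow, Polynomial.eval_X]
  push_cast
  ring

theorem continuous_weylField (z : ℂ) :
    Continuous fun q : (Fin (n + 1) → ℂ) × ℂ => weylField z q.1 q.2 := by
  unfold weylField weylCoeff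
  fun_prop

theorem weylField_ne_zero_iff :
    weylField z a x ≠ 0 ↔ (flatPolynomial n a).eval x ≠ 0 := by
  rw [weylField_eq]
  simp [Complex.exp_ne_zero]

/-- The normalization changes the logarithm by the real part of an affine function, which Green's
formula does not see. -/
theorem log_norm_weylField (h : (flatPolynomial n a).eval x ≠ 0) :
    Real.log ‖weylField z a x‖ = Real.log ‖(flatPolynomial n a).eval x‖ -
      (-(‖z‖ ^ 2 / 2 : ℝ) + (starRingEnd ℂ) z * x).re := by
  rw [weylField_eq, norm_mul, Real.log_mul (norm_ne_zero_iff.2 h)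
    (norm_ne_zero_iff.2 (Complex.exp_ne_zero _)), Complex.norm_exp, Real.log_exp,
    mul_comm ((starRingEnd ℂ) z) x]
  simp only [Complex.neg_re, Complex.add_re, Complex.sub_re, Complex.ofReal_re]
  ring

/-- Each variable may use the normalization at its own reference point. The identity of logarithms
holds off the zeroes only, a null set. -/
theorem integral_prod_log_weylField {m : ℕ} {z : Fin m → ℂ} (hp : flatPolynomial n a ≠ 0)
    {G : (Fin m → ℂ) → ℂ} (hG : ContDiff ℝ (⊤ : ℕ∞) G) (hc : HasCompactSupport G) :
    ∫ x : Fin m → ℂ, (∏ j, Real.log ‖weylField (z j) a (x j)‖) • fullLaplacian G x =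
      (2 * Real.pi) ^ m * rootSum G (flatPolynomial n a) := by
  have h := integral_prod_log_smul_fullLaplacian hp (fun j => -((‖z j‖ ^ 2 / 2 : ℝ) : ℂ))
    (fun j => (starRingEnd ℂ) (z j)) hG hc
  rw [rootSum, ← h]
  have hae : ∀ᵐ x : Fin m → ℂ, ∀ j, (flatPolynomial n a).eval (x j) ≠ 0 := by
    rw [ae_all_iff]
    intro j
    exact (Measure.tendsto_eval_ae_ae (μ := fun _ : Fin m => (volume : Measure ℂ)) (i := j)).eventually
      (ae_eval_ne_zero hp)
  refine integral_congr_ae ?_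
  filter_upwards [hae] with x hx
  congr 1
  exact Finset.prod_congr rfl fun j _ => log_norm_weylField (hx j)

theorem norm_weylField_le {R A : ℝ} (hx : ‖x - z‖ ≤ R) (h2 : 2 ≤ ‖x‖) (ha : ∀ i, ‖a i‖ ≤ A) :
    ‖weylField z a x‖ ≤ (n + 1) * (A * Real.exp (R ^ 2)) := by
  have hA : 0 ≤ A := (norm_nonneg _).trans (ha 0)
  have hc : ∀ i : ℕ, ‖weylCoeff z x i‖ ≤ Real.exp (R ^ 2) := by
    intro i
    have h1 := norm_weylCoeff_sq_le hx h2 i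
    have h3 : Real.exp (R ^ 2) / ‖x‖ ≤ Real.exp (R ^ 2) :=
      div_le_self (Real.exp_pos _).le (by linarith)
    have h4 : 1 ≤ Real.exp (R ^ 2) := Real.one_le_exp (sq_nonneg R)
    refine le_of_sq_le_sq ?_ (by linarith)
    nlinarith
  unfold weylField
  refine (norm_sum_le _ _).trans ?_
  refine (Finset.sum_le_sum (g := fun _ => A * Real.exp (R ^ 2)) fun i _ => ?_).trans ?_
  · rw [norm_mul]
    exact mul_le_mul (ha i) (hc i) (norm_nonneg _) hA
  · simp

/-- One lower bound at the centre controls the logarithm on the disc: comparing the factorizations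
at `z` and `x`, each zero `t` costs at most `log(1 + R/‖x - t‖)`, since `‖z - t‖ ≤ ‖x - t‖ + R`, and
the affine term changes by at most `R‖z‖`. -/
theorem abs_log_norm_weylField_le {R Q : ℝ} (hR : 0 ≤ R) (hx : ‖x - z‖ ≤ R)
    (hz : Real.exp (-Q) ≤ ‖weylField z a z‖) (hp : (flatPolynomial n a).eval x ≠ 0)
    (hxQ : ‖weylField z a x‖ ≤ Real.exp Q) :
    |Real.log ‖weylField z a x‖| ≤ Q + R * ‖z‖ +
      ∑ t : (flatPolynomial n a).roots.ToType, Real.log (1 + R / ‖x - t.1‖) := by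
  have hF0 : 0 < ‖weylField z a x‖ := norm_pos_iff.2 (weylField_ne_zero_iff.2 hp)
  have hpz : (flatPolynomial n a).eval z ≠ 0 := by
    rw [← weylField_ne_zero_iff (z := z), ← norm_pos_iff]
    exact (Real.exp_pos _).trans_le hz
  have hsum : 0 ≤ ∑ t : (flatPolynomial n a).roots.ToType, Real.log (1 + R / ‖x - t.1‖) :=
    Finset.sum_nonneg fun t _ => Real.log_nonneg (le_add_of_nonneg_right (by positivity))
  have hup : Real.log ‖weylField z a x‖ ≤ Q := (Real.log_le_iff_le_exp hF0).2 hxQ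
  have hlow : -Q ≤ Real.log ‖weylField z a z‖ :=
    (Real.le_log_iff_exp_le ((Real.exp_pos _).trans_le hz)).2 hz
  have hRz : 0 ≤ R * ‖z‖ := by positivity
  have hp0 : flatPolynomial n a ≠ 0 := by
    intro h
    rw [h] at hp
    simp at hp
  have hroots : ∀ y : ℂ, (flatPolynomial n a).eval y ≠ 0 →
      ∀ t : (flatPolynomial n a).roots.ToType, 0 < ‖y - t.1‖ := by
    intro y hy t
    rw [norm_pos_iff]
    intro h0
    refine hy ?_
    rw [eval_eq_leadingCoeff_mul_prod, Finset.prod_eq_zero (Finset.mem_univ t) h0, mul_zero]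
  rw [abs_le]
  refine ⟨?_, by linarith⟩
  rw [log_norm_weylField hpz, log_norm_eval hp0 hpz] at hlow
  rw [log_norm_weylField hp, log_norm_eval hp0 hp]
  have hterm : ∑ t : (flatPolynomial n a).roots.ToType, Real.log ‖z - t.1‖ ≤
      ∑ t : (flatPolynomial n a).roots.ToType,
        (Real.log ‖x - t.1‖ + Real.log (1 + R / ‖x - t.1‖)) := by
    refine Finset.sum_le_sum fun t _ => ?_
    have h1 := hroots x hp t
    have h2 := hroots z hpz t
    rw [← Real.log_mul h1.ne' (by positivity)]
    refine Real.log_le_log h2 ?_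
    have : ‖z - t.1‖ ≤ ‖x - t.1‖ + ‖x - z‖ := by
      rw [norm_sub_rev x z]
      calc ‖z - t.1‖ = ‖(x - t.1) + (z - x)‖ := by congr 1; ring
        _ ≤ _ := norm_add_le _ _
    rw [mul_add, mul_one, mul_div_cancel₀ _ h1.ne']
    linarith
  rw [Finset.sum_add_distrib] at hterm
  have hre : ((starRingEnd ℂ) z * x).re - ((starRingEnd ℂ) z * z).re ≤ R * ‖z‖ := by
    rw [← Complex.sub_re, ← mul_sub]
    refine (Complex.re_le_norm _).trans ?_
    rw [norm_mul, RCLike.norm_conj, mul_comm]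
    gcongr
  simp only [Complex.add_re] at hlow ⊢
  linarith

/-- Any power of the logarithm is dominated by a linear function, whose singularity `1/‖x - t‖` is
integrable in the plane. -/
theorem log_one_add_pow_le {y : ℝ} (hy : 0 ≤ y) {r : ℕ} (hr : r ≠ 0) :
    Real.log (1 + y) ^ r ≤ (r : ℝ) ^ r * (1 + y) := by
  have hr0 : (0 : ℝ) < r := by positivity
  have h1 : Real.log (1 + y) ≤ r * (1 + y) ^ ((r : ℝ)⁻¹) := by
    have := Real.log_le_rpow_div (show 0 ≤ 1 + y by linarith) (inv_pos.2 hr0)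
    rwa [div_inv_eq_mul, mul_comm] at this
  refine (pow_le_pow_left₀ (Real.log_nonneg (by linarith)) h1 r).trans ?_
  rw [mul_pow, ← Real.rpow_natCast ((1 + y) ^ ((r : ℝ)⁻¹)), ← Real.rpow_mul (by linarith),
    inv_mul_cancel₀ hr0.ne', Real.rpow_one]

theorem add_sum_pow_le {ι : Type*} [Fintype ι] {N : ℕ} (hN : Fintype.card ι ≤ N) {S : ℝ} (hS : 0 ≤ S)
    {l : ι → ℝ} (hl : ∀ i, 0 ≤ l i) (r : ℕ) :
    (S + ∑ i, l i) ^ (r + 1) ≤ 2 ^ r * (S ^ (r + 1) + (N : ℝ) ^ r * ∑ i, l i ^ (r + 1)) := by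
  have h1 := add_pow_le hS (Finset.sum_nonneg fun i (_ : i ∈ Finset.univ) => hl i) (r + 1)
  rw [Nat.add_sub_cancel] at h1
  refine h1.trans ?_
  have hs : 0 ≤ ∑ i, l i ^ (r + 1) := Finset.sum_nonneg fun i _ => pow_nonneg (hl i) _
  have h2 : (∑ i, l i) ^ (r + 1) ≤ (N : ℝ) ^ r * ∑ i, l i ^ (r + 1) := by
    rcases isEmpty_or_nonempty ι with h | h
    · simp
    · have h3 := pow_sum_div_card_le_sum_pow (s := Finset.univ) (f := l) (n := r)
        (fun i _ => hl i)
      rw [div_le_iff₀ (by simp; positivity), mul_comm] at h3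
      refine h3.trans (mul_le_mul_of_nonneg_right ?_ hs)
      refine pow_le_pow_left₀ (by positivity) ?_ r
      rw [Finset.card_univ]
      exact_mod_cast hN
  gcongr

/-- Moments of the logarithm of a polynomial over a disc, in terms of its value at the centre. -/
theorem lintegral_abs_log_norm_weylField_pow_le {R Q : ℝ} (hR : 0 ≤ R) (hQ : 0 ≤ Q)
    (hz : Real.exp (-Q) ≤ ‖weylField z a z‖)
    (hxQ : ∀ x, ‖x - z‖ ≤ R → ‖weylField z a x‖ ≤ Real.exp Q) (r : ℕ) :
    ∫⁻ x in Metric.closedBall z R, ENNReal.ofReal (|Real.log ‖weylField z a x‖| ^ (r + 1)) ≤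
      ENNReal.ofReal (2 ^ r * ((Q + R * ‖z‖) ^ (r + 1) +
        (n : ℝ) ^ (r + 1) * (r + 1 : ℕ) ^ (r + 1)) * (Real.pi * R ^ 2) +
        n * (2 ^ r * (n : ℝ) ^ r * (r + 1 : ℕ) ^ (r + 1) * R *
          (2 * Real.pi + Real.pi * (R + 1) ^ 2))) := by
  have hp0 : flatPolynomial n a ≠ 0 := by
    intro h
    rw [weylField_eq, h] at hz
    simp only [Polynomial.eval_zero, zero_mul, norm_zero] at hz
    exact absurd (Real.exp_pos (-Q)) (not_lt.2 hz)
  have hcard := card_roots_toType_le (natDegree_flatPolynomial_le n a)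
  set c₁ : ℝ := 2 ^ r * (n : ℝ) ^ r * (r + 1 : ℕ) ^ (r + 1) * R with hc₁
  have hc₁0 : 0 ≤ c₁ := by positivity
  set c₀ : ℝ := 2 ^ r * ((Q + R * ‖z‖) ^ (r + 1) + (n : ℝ) ^ (r + 1) * (r + 1 : ℕ) ^ (r + 1))
    with hc₀
  have hc₀0 : 0 ≤ c₀ := by positivity
  set w : ℝ := 2 * Real.pi + Real.pi * (R + 1) ^ 2 with hw
  have hw0 : 0 ≤ w := by have := Real.pi_pos; positivity
  -- A constant plus one singularity per zero; there are at most `n`, and each integrates to at most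
  -- `w` wherever the zero lies.
  have hpt : ∀ x ∈ Metric.closedBall z R, (flatPolynomial n a).eval x ≠ 0 →
      |Real.log ‖weylField z a x‖| ^ (r + 1) ≤
        c₀ + ∑ t : (flatPolynomial n a).roots.ToType, c₁ * ‖x - t.1‖⁻¹ := by
    intro x hx hpx
    rw [Metric.mem_closedBall, dist_eq_norm] at hx
    have h1 := abs_log_norm_weylField_le hR hx hz hpx (hxQ x hx)
    have h2 : ∀ t : (flatPolynomial n a).roots.ToType, 0 ≤ Real.log (1 + R / ‖x - t.1‖) :=
      fun t => Real.log_nonneg (le_add_of_nonneg_right (by positivity))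
    refine (pow_le_pow_left₀ (abs_nonneg _) h1 _).trans ?_
    refine (add_sum_pow_le hcard (by positivity) h2 r).trans ?_
    have h3 : ∑ t : (flatPolynomial n a).roots.ToType, Real.log (1 + R / ‖x - t.1‖) ^ (r + 1) ≤
        n * ((r + 1 : ℕ) : ℝ) ^ (r + 1) +
          ∑ t : (flatPolynomial n a).roots.ToType, (r + 1 : ℕ) ^ (r + 1) * R * ‖x - t.1‖⁻¹ := by
      calc _ ≤ ∑ t : (flatPolynomial n a).roots.ToType, (((r + 1 : ℕ) : ℝ) ^ (r + 1) +
            (r + 1 : ℕ) ^ (r + 1) * R * ‖x - t.1‖⁻¹) := by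
            refine Finset.sum_le_sum fun t _ => ?_
            refine (log_one_add_pow_le (by positivity) (Nat.succ_ne_zero r)).trans (le_of_eq ?_)
            rw [div_eq_mul_inv, Nat.succ_eq_add_one]
            ring
        _ ≤ _ := by
            rw [Finset.sum_add_distrib]
            gcongr
            rw [Finset.sum_const, nsmul_eq_mul, Finset.card_univ]
            gcongr
    have h4 : (2 : ℝ) ^ r * ((Q + R * ‖z‖) ^ (r + 1) + (n : ℝ) ^ r *
        (n * ((r + 1 : ℕ) : ℝ) ^ (r + 1) +
          ∑ t : (flatPolynomial n a).roots.ToType, (r + 1 : ℕ) ^ (r + 1) * R * ‖x - t.1‖⁻¹)) =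
        c₀ + ∑ t : (flatPolynomial n a).roots.ToType, c₁ * ‖x - t.1‖⁻¹ := by
      rw [hc₀, hc₁, ← Finset.mul_sum, ← Finset.mul_sum]
      ring
    rw [← h4]
    gcongr
  calc ∫⁻ x in Metric.closedBall z R, ENNReal.ofReal (|Real.log ‖weylField z a x‖| ^ (r + 1))
      ≤ ∫⁻ x in Metric.closedBall z R, (ENNReal.ofReal c₀ +
          ∑ t : (flatPolynomial n a).roots.ToType,
            ENNReal.ofReal c₁ * ENNReal.ofReal ‖x - t.1‖⁻¹) := by
        refine lintegral_mono_ae ?_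
        filter_upwards [ae_restrict_mem Metric.isClosed_closedBall.measurableSet,
          ae_restrict_of_ae (ae_eval_ne_zero hp0)] with x hx hpx
        refine (ENNReal.ofReal_le_ofReal (hpt x hx hpx)).trans (le_of_eq ?_)
        rw [ENNReal.ofReal_add hc₀0 (Finset.sum_nonneg fun t _ => by positivity),
          ENNReal.ofReal_sum_of_nonneg fun t _ => by positivity]
        simp only [ENNReal.ofReal_mul hc₁0]
    _ = ENNReal.ofReal c₀ * volume (Metric.closedBall z R) +
          ∑ t : (flatPolynomial n a).roots.ToType, ENNReal.ofReal c₁ *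
            ∫⁻ x in Metric.closedBall z R, ENNReal.ofReal ‖x - t.1‖⁻¹ := by
        rw [lintegral_add_left measurable_const, setLIntegral_const,
          lintegral_finsetSum _ fun t _ => by fun_prop]
        congr 1
        refine Finset.sum_congr rfl fun t _ => ?_
        rw [lintegral_const_mul _ (by fun_prop)]
    _ ≤ ENNReal.ofReal c₀ * ENNReal.ofReal (Real.pi * R ^ 2) +
          ∑ t : (flatPolynomial n a).roots.ToType, ENNReal.ofReal c₁ *
            ENNReal.ofReal w := by
        gcongr with t
        · rw [Complex.volume_closedBall, ENNReal.ofReal_mul Real.pi_pos.le, ENNReal.ofReal_pow hR,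
            mul_comm]
          gcongr
          rw [← NNReal.coe_real_pi, ENNReal.ofReal_coe_nnreal]
        · refine le_trans ?_ (lintegral_inv_norm_sub_ball_le z t.1 (show 0 ≤ R + 1 by linarith))
          exact lintegral_mono_set (Metric.closedBall_subset_ball (by linarith))
    _ ≤ _ := by
        clear_value w c₀ c₁
        rw [Finset.sum_const, nsmul_eq_mul, Finset.card_univ, ENNReal.ofReal_add (by positivity)
          (by positivity), ENNReal.ofReal_mul hc₀0, ENNReal.ofReal_mul (Nat.cast_nonneg n),
          ENNReal.ofReal_mul hc₁0, ENNReal.ofReal_natCast]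
        gcongr

end WeylField

/-! ### Replacing logarithms by truncated ones, pointwise. -/

section PointwiseComparison

theorem abs_prod_sub_prod_le {ι : Type*} (s : Finset ι) {u l w : ι → ℝ} (hw : ∀ i, 1 ≤ w i)
    (hu : ∀ i, |u i| ≤ w i) (hl : ∀ i, |l i| ≤ w i) :
    |∏ i ∈ s, u i - ∏ i ∈ s, l i| ≤ (∑ j ∈ s, |u j - l j|) * ∏ i ∈ s, w i := by
  classical
  induction s using Finset.induction_on with
  | empty => simp
  | insert a s ha ih =>
    rw [Finset.prod_insert ha, Finset.prod_insert ha, Finset.prod_insert ha, Finset.sum_insert ha]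
    have h1 : |∏ i ∈ s, u i| ≤ ∏ i ∈ s, w i := by
      rw [Finset.abs_prod]
      exact Finset.prod_le_prod (fun i _ => abs_nonneg _) fun i _ => hu i
    have h2 : 0 ≤ ∏ i ∈ s, w i := (abs_nonneg _).trans h1
    have h3 : u a * ∏ i ∈ s, u i - l a * ∏ i ∈ s, l i =
        (u a - l a) * ∏ i ∈ s, u i + l a * (∏ i ∈ s, u i - ∏ i ∈ s, l i) := by ring
    rw [h3]
    refine (abs_add_le _ _).trans ?_
    rw [abs_mul, abs_mul]
    calc |u a - l a| * |∏ i ∈ s, u i| + |l a| * |∏ i ∈ s, u i - ∏ i ∈ s, l i|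
        ≤ |u a - l a| * (∏ i ∈ s, w i) * w a +
          w a * ((∑ j ∈ s, |u j - l j|) * ∏ i ∈ s, w i) := by
          refine add_le_add ?_ (mul_le_mul (hl a) ih (abs_nonneg _) (by linarith [hw a]))
          refine le_trans ?_ (le_mul_of_one_le_right (by positivity) (hw a))
          gcongr
      _ = _ := by ring

/-- The difference consists of two halves, `log(1 + (η/‖u‖)²)` and `log(1 + (‖u‖/B)²)`, entering
with opposite signs; in the given range both logarithms lie between `0` and `η`. -/
theorem abs_log_norm_sub_truncLog_le {η B : ℝ} (hη : 0 < η) (hB : 0 < B) {u : ℂ}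
    (h1 : √η ≤ ‖u‖) (h2 : ‖u‖ ≤ √η * B) : |Real.log ‖u‖ - truncLog η B u| ≤ η := by
  have hu : 0 < ‖u‖ := (Real.sqrt_pos.2 hη).trans_le h1
  have hu2 : η ≤ ‖u‖ ^ 2 := (Real.sqrt_le_left hu.le).1 h1
  rw [truncLog_eq hη]
  have e1 : Real.log (η ^ 2 + ‖u‖ ^ 2) = 2 * Real.log ‖u‖ + Real.log (1 + (η / ‖u‖) ^ 2) := by
    rw [show (2 : ℝ) * Real.log ‖u‖ = Real.log (‖u‖ ^ 2) by rw [Real.log_pow]; norm_num,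
      ← Real.log_mul (by positivity) (by positivity)]
    congr 1
    field_simp
    ring
  have e2 : Real.log (1 + (η / ‖u‖) ^ 2) ≤ η := by
    have h3 := Real.log_le_sub_one_of_pos (show 0 < 1 + (η / ‖u‖) ^ 2 by positivity)
    have h4 : (η / ‖u‖) ^ 2 ≤ η := by
      rw [div_pow, div_le_iff₀ (by positivity)]
      nlinarith
    linarith
  have e3 : Real.log (1 + (‖u‖ / B) ^ 2) ≤ η := by
    have h3 := Real.log_le_sub_one_of_pos (show 0 < 1 + (‖u‖ / B) ^ 2 by positivity)
    have h4 : (‖u‖ / B) ^ 2 ≤ η := by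
      rw [← Real.sq_sqrt hη.le]
      refine pow_le_pow_left₀ (by positivity) ?_ 2
      rwa [div_le_iff₀ hB]
    linarith
  have e4 : 0 ≤ Real.log (1 + (η / ‖u‖) ^ 2) :=
    Real.log_nonneg (le_add_of_nonneg_right (sq_nonneg _))
  have e5 : 0 ≤ Real.log (1 + (‖u‖ / B) ^ 2) :=
    Real.log_nonneg (le_add_of_nonneg_right (sq_nonneg _))
  rw [e1, abs_le]
  constructor <;> linarith

/-- Splits a quantity that is large on a rare event: the level `l` is charged to the event, the
square to a moment. -/
theorem le_add_sq_div {x l : ℝ} (hx : 0 ≤ x) (hl : 0 < l) : x ≤ l + x ^ 2 / l := by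
  rcases le_total x l with h | h
  · have : 0 ≤ x ^ 2 / l := by positivity
    linarith
  · have : x ≤ x ^ 2 / l := by
      rw [le_div_iff₀ hl]
      nlinarith
    linarith

/-- An upper bound for the error of replacing a product of logarithms by truncated logarithms, as a
sum of functions of the factors. -/
def logError (α l Λ Q ρ : ℝ) (q : ℕ) (u : ℂ) : ℝ :=
  α * (2 * Q ^ q) + α * Λ * Set.indicator {u : ℂ | ‖u‖ ≤ Real.exp (-Q)} 1 u +
    α / Λ * |Real.log ‖u‖| ^ (2 * q) + l * Set.indicator {u : ℂ | ‖u‖ ≤ ρ} 1 u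

theorem abs_log_pow_le {Q Λ : ℝ} (hQ : 0 ≤ Q) (hΛ : 0 < Λ) (q : ℕ) {u : ℂ} (hu : ‖u‖ ≤ Real.exp Q) :
    |Real.log ‖u‖| ^ q ≤ Q ^ q + Λ * Set.indicator {u : ℂ | ‖u‖ ≤ Real.exp (-Q)} 1 u +
      |Real.log ‖u‖| ^ (2 * q) / Λ := by
  by_cases h : ‖u‖ ≤ Real.exp (-Q)
  · rw [Set.indicator_of_mem (show u ∈ {u : ℂ | ‖u‖ ≤ Real.exp (-Q)} from h)]
    have h1 := le_add_sq_div (show 0 ≤ |Real.log ‖u‖| ^ q by positivity) hΛ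
    rw [← pow_mul, mul_comm q 2] at h1
    have h2 : 0 ≤ Q ^ q := by positivity
    simp only [Pi.one_apply, mul_one]
    linarith
  · rw [Set.indicator_of_notMem (show u ∉ {u : ℂ | ‖u‖ ≤ Real.exp (-Q)} from h)]
    rw [not_le] at h
    have hu0 : 0 < ‖u‖ := (Real.exp_pos _).trans h
    have h1 : |Real.log ‖u‖| ≤ Q := by
      rw [abs_le]
      exact ⟨((Real.lt_log_iff_exp_lt hu0).2 h).le, (Real.log_le_iff_le_exp hu0).2 hu⟩
    have h2 : |Real.log ‖u‖| ^ q ≤ Q ^ q := pow_le_pow_left₀ (abs_nonneg _) h1 q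
    have h3 : 0 ≤ |Real.log ‖u‖| ^ (2 * q) / Λ := by positivity
    linarith

/-- Telescoping leaves one difference of factors times a product of weights `w`. The difference is
at most `η` unless `‖u j‖ ≤ √η`, and on that event `le_add_sq_div` trades the product for `l` plus a
square divided by `l`. Mixed products are then dominated by powers of single factors, so that no
joint law of the values is needed. -/
theorem abs_prod_log_sub_prod_truncLog_le {m : ℕ} {η B Q l Λ : ℝ} (hη : 0 < η) (hB : 0 < B)
    (hQ : 1 ≤ Q) (hl : 0 < l) (hΛ : 0 < Λ) (htr : ∀ v, |truncLog η B v| ≤ Q) {u : Fin m → ℂ}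
    (hu : ∀ j, ‖u j‖ ≤ √η * B) (hu' : ∀ j, ‖u j‖ ≤ Real.exp Q) :
    |∏ j, Real.log ‖u j‖ - ∏ j, truncLog η B (u j)| ≤
      ∑ j, logError (m * (η + 1 / l) * 4 ^ (2 * m + 2)) l Λ Q √η (2 * m + 2) (u j) := by
  rcases isEmpty_or_nonempty (Fin m) with h | h
  · simp
  set q := 2 * m + 2 with hq
  set w : Fin m → ℝ := fun j => |Real.log ‖u j‖| + 2 * Q with hw
  set I : Fin m → ℝ := fun j => Set.indicator {u : ℂ | ‖u‖ ≤ √η} 1 (u j) with hI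
  have hw1 : ∀ j, 1 ≤ w j := fun j => by
    have := abs_nonneg (Real.log ‖u j‖)
    simp only [hw]; linarith
  have hwU : ∀ j, |Real.log ‖u j‖| ≤ w j := fun j => by simp only [hw]; linarith
  have hwL : ∀ j, |truncLog η B (u j)| ≤ w j := fun j => by
    have := htr (u j)
    have := abs_nonneg (Real.log ‖u j‖)
    simp only [hw]; linarith
  have h1 := abs_prod_sub_prod_le Finset.univ hw1 hwU hwL
  set Y := ∏ i, w i with hY
  set Z := ∑ i, w i ^ q with hZ
  have hY1 : 1 ≤ Y := by
    rw [← Finset.prod_const_one (s := (Finset.univ : Finset (Fin m)))]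
    exact Finset.prod_le_prod (fun _ _ => zero_le_one) fun j _ => hw1 j
  -- A product of `m + 1` weights is at most the largest weight to that power; the square explains
  -- the exponent `q = 2m + 2`.
  have hYZ : ∀ j, (w j * Y) ^ 2 ≤ Z := by
    intro j
    obtain ⟨i, -, hi⟩ := Finset.exists_max_image Finset.univ w Finset.univ_nonempty
    have e1 : Y ≤ w i ^ m := by
      have := Finset.prod_le_prod (s := Finset.univ) (f := w) (g := fun _ => w i)
        (fun j _ => zero_le_one.trans (hw1 j)) fun j _ => hi j (Finset.mem_univ j)
      simpa using this
    have e2 : w j * Y ≤ w i ^ (m + 1) := by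
      rw [pow_succ, mul_comm]
      have := hw1 j
      have := hw1 i
      exact mul_le_mul e1 (hi j (Finset.mem_univ j)) (by linarith) (by positivity)
    have e3 : (w j * Y) ^ 2 ≤ w i ^ q := by
      have := hw1 j
      calc (w j * Y) ^ 2 ≤ (w i ^ (m + 1)) ^ 2 := pow_le_pow_left₀ (by positivity) e2 2
        _ = w i ^ q := by rw [← pow_mul]; congr 1; omega
    refine e3.trans (Finset.single_le_sum (f := fun i => w i ^ q) (fun i _ => ?_)
      (Finset.mem_univ i))
    have := hw1 i
    positivity
  have hZ0 : 0 ≤ Z := (sq_nonneg _).trans (hYZ (Classical.arbitrary _))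
  have hterm : ∀ j, |Real.log ‖u j‖ - truncLog η B (u j)| * Y ≤ η * Z + (l * I j + Z / l) := by
    intro j
    have k0 : 1 ≤ w j * Y := by nlinarith [hw1 j]
    have k1 : Y ≤ Z := by
      refine le_trans ?_ (hYZ j)
      nlinarith [hw1 j]
    by_cases hj : ‖u j‖ ≤ √η
    · have hIj : I j = 1 := Set.indicator_of_mem (show u j ∈ {u : ℂ | ‖u‖ ≤ √η} from hj) 1
      have k2 : |Real.log ‖u j‖ - truncLog η B (u j)| ≤ w j := by
        refine (abs_sub _ _).trans ?_
        have := htr (u j)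
        simp only [hw]; linarith
      have k3 := le_add_sq_div (show 0 ≤ w j * Y by linarith) hl
      have k4 : (w j * Y) ^ 2 / l ≤ Z / l := by gcongr; exact hYZ j
      have k5 : |Real.log ‖u j‖ - truncLog η B (u j)| * Y ≤ w j * Y := by gcongr
      have k6 : 0 ≤ η * Z := by positivity
      rw [hIj]
      linarith
    · have k2 := abs_log_norm_sub_truncLog_le hη hB (not_le.1 hj).le (hu j)
      have k3 : 0 ≤ I j := Set.indicator_nonneg (fun _ _ => zero_le_one) _
      have k4 : |Real.log ‖u j‖ - truncLog η B (u j)| * Y ≤ η * Z := by gcongr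
      have k5 : 0 ≤ l * I j + Z / l := by positivity
      linarith
  have hlast : ∀ j, m * (η + 1 / l) * w j ^ q + l * I j ≤
      logError (m * (η + 1 / l) * 4 ^ q) l Λ Q √η q (u j) := by
    intro j
    have e1 : w j ^ q ≤ 4 ^ q * (|Real.log ‖u j‖| ^ q + Q ^ q) := by
      have hx := abs_nonneg (Real.log ‖u j‖)
      refine (add_pow_le hx (show 0 ≤ 2 * Q by linarith) q).trans ?_
      rw [mul_pow]
      have e0 : (2 : ℝ) ^ (q - 1) ≤ 2 ^ q := pow_le_pow_right₀ (by norm_num) (by omega)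
      have e2 : (1 : ℝ) ≤ 2 ^ q := one_le_pow₀ (by norm_num)
      have e3 : (4 : ℝ) ^ q = 2 ^ q * 2 ^ q := by rw [← mul_pow]; norm_num
      calc 2 ^ (q - 1) * (|Real.log ‖u j‖| ^ q + 2 ^ q * Q ^ q)
          ≤ 2 ^ q * (2 ^ q * |Real.log ‖u j‖| ^ q + 2 ^ q * Q ^ q) := by
            gcongr
            exact le_mul_of_one_le_left (by positivity) e2
        _ = _ := by rw [e3]; ring
    have e2 := abs_log_pow_le (by linarith) hΛ q (hu' j)
    have hα : 0 ≤ m * (η + 1 / l) := by positivity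
    calc m * (η + 1 / l) * w j ^ q + l * I j
        ≤ m * (η + 1 / l) * (4 ^ q * ((Q ^ q +
          Λ * Set.indicator {u : ℂ | ‖u‖ ≤ Real.exp (-Q)} 1 (u j) +
          |Real.log ‖u j‖| ^ (2 * q) / Λ) + Q ^ q)) + l * I j := by
          gcongr
          exact e1.trans (by gcongr)
      _ = _ := by
          unfold logError
          ring
  calc |∏ j, Real.log ‖u j‖ - ∏ j, truncLog η B (u j)|
      ≤ ∑ j, |Real.log ‖u j‖ - truncLog η B (u j)| * Y := by rw [← Finset.sum_mul]; exact h1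
    _ ≤ ∑ j, (η * Z + (l * I j + Z / l)) := Finset.sum_le_sum fun j _ => hterm j
    _ = ∑ j, (m * (η + 1 / l) * w j ^ q + l * I j) := by
        simp only [Finset.sum_add_distrib, Finset.sum_const, Finset.card_univ, Fintype.card_fin,
          nsmul_eq_mul, ← Finset.mul_sum]
        rw [← hZ]
        ring
    _ ≤ _ := Finset.sum_le_sum fun j _ => hlast j

end PointwiseComparison

/-! ### Replacing logarithms by truncated ones, in the mean. -/

section IntegratedComparison

variable {E : Type*} [MeasurableSpace E] {P : Measure E} [IsProbabilityMeasure P]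

theorem lintegral_restrict_pi_eval {m : ℕ} (D : Fin m → Set ℂ) (hD : ∀ i, volume (D i) ≠ ∞)
    (j : Fin m) {f : ℂ → ℝ≥0∞} (hf : Measurable f) : ∫⁻ x in Set.univ.pi D, f (x j) =
      (∏ i ∈ Finset.univ.erase j, volume (D i)) * ∫⁻ x in D j, f x := by
  have : ∀ i, IsFiniteMeasure ((volume : Measure ℂ).restrict (D i)) := fun i =>
    ⟨by rw [Measure.restrict_apply_univ]; exact (hD i).lt_top⟩
  have h := Measure.pi_map_eval (μ := fun i => (volume : Measure ℂ).restrict (D i)) j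
  rw [volume_pi, Measure.restrict_pi_pi]
  have h2 : ∫⁻ x, f (Function.eval j x)
      ∂(Measure.pi fun i => (volume : Measure ℂ).restrict (D i)) = ∫⁻ y, f y
      ∂((Measure.pi fun i => (volume : Measure ℂ).restrict (D i)).map (Function.eval j)) :=
    (lintegral_map hf (measurable_pi_apply j)).symm
  rw [h, lintegral_smul_measure] at h2
  simpa using h2

theorem lintegral_lintegral_indicator_le {F : E → ℂ → ℂ}
    (hF : Measurable fun q : E × ℂ => F q.1 q.2) {S : Set E} {D : Set ℂ} {ρ θ : ℝ}
    (hD : MeasurableSet D) (hθ : ∀ x ∈ D, P.real {a | ‖F a x‖ ≤ ρ} ≤ θ) :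
    ∫⁻ a in S, ∫⁻ x in D, Set.indicator {u : ℂ | ‖u‖ ≤ ρ} 1 (F a x) ∂volume ∂P ≤
      ENNReal.ofReal θ * volume D := by
  have hset : MeasurableSet {u : ℂ | ‖u‖ ≤ ρ} :=
    (isClosed_le continuous_norm continuous_const).measurableSet
  have hind : Measurable fun q : E × ℂ =>
      Set.indicator {u : ℂ | ‖u‖ ≤ ρ} (1 : ℂ → ℝ≥0∞) (F q.1 q.2) :=
    (measurable_one.indicator hset).comp hF
  refine (setLIntegral_le_lintegral _ _).trans ?_
  rw [lintegral_lintegral_swap hind.aemeasurable]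
  calc ∫⁻ x in D, ∫⁻ a, Set.indicator {u : ℂ | ‖u‖ ≤ ρ} 1 (F a x) ∂P
      ≤ ∫⁻ _ in D, ENNReal.ofReal θ := by
        refine setLIntegral_mono' hD fun x hx => ?_
        have hFx : Measurable fun a => F a x := hF.comp (by fun_prop : Measurable fun a => (a, x))
        have e : ∀ a, Set.indicator {u : ℂ | ‖u‖ ≤ ρ} (1 : ℂ → ℝ≥0∞) (F a x) =
            Set.indicator {a | ‖F a x‖ ≤ ρ} 1 a := fun a => rfl
        simp only [e]
        have hm : MeasurableSet {a | ‖F a x‖ ≤ ρ} := hFx hset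
        rw [lintegral_indicator_one hm, ← ofReal_measureReal]
        exact ENNReal.ofReal_le_ofReal (hθ x hx)
    _ = _ := by rw [setLIntegral_const]

theorem measurable_logError (α l Λ Q ρ : ℝ) (q : ℕ) : Measurable (logError α l Λ Q ρ q) := by
  have hset : ∀ ρ : ℝ, MeasurableSet {u : ℂ | ‖u‖ ≤ ρ} := fun ρ =>
    (isClosed_le continuous_norm continuous_const).measurableSet
  have h1 : ∀ ρ : ℝ, Measurable (Set.indicator {u : ℂ | ‖u‖ ≤ ρ} (1 : ℂ → ℝ)) := fun ρ =>
    measurable_one.indicator (hset ρ)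
  have h2 := h1 ρ
  have h3 := h1 (Real.exp (-Q))
  unfold logError
  have h4 : Measurable fun u : ℂ => |Real.log ‖u‖| ^ (2 * q) := by fun_prop
  exact ((measurable_const.add (measurable_const.mul h3)).add (measurable_const.mul h4)).add
    (measurable_const.mul h2)

theorem logError_nonneg {α l Λ Q ρ : ℝ} {q : ℕ} (hα : 0 ≤ α) (hl : 0 ≤ l) (hΛ : 0 ≤ Λ)
    (hQ : 0 ≤ Q) (u : ℂ) : 0 ≤ logError α l Λ Q ρ q u := by
  have hi : ∀ r : ℝ, 0 ≤ Set.indicator {u : ℂ | ‖u‖ ≤ r} (1 : ℂ → ℝ) u := fun r =>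
    Set.indicator_nonneg (fun _ _ => zero_le_one) _
  have h1 := hi (Real.exp (-Q))
  have h2 := hi ρ
  unfold logError
  positivity

theorem ofReal_logError {α l Λ Q ρ : ℝ} {q : ℕ} (hα : 0 ≤ α) (hl : 0 ≤ l) (hΛ : 0 < Λ)
    (hQ : 0 ≤ Q) (u : ℂ) : ENNReal.ofReal (logError α l Λ Q ρ q u) =
      ENNReal.ofReal (α * (2 * Q ^ q)) +
      ENNReal.ofReal (α * Λ) * Set.indicator {u : ℂ | ‖u‖ ≤ Real.exp (-Q)} 1 u +
      ENNReal.ofReal (α / Λ) * ENNReal.ofReal (|Real.log ‖u‖| ^ (2 * q)) +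
      ENNReal.ofReal l * Set.indicator {u : ℂ | ‖u‖ ≤ ρ} 1 u := by
  have hi : ∀ r : ℝ, 0 ≤ Set.indicator {u : ℂ | ‖u‖ ≤ r} (1 : ℂ → ℝ) u := fun r =>
    Set.indicator_nonneg (fun _ _ => zero_le_one) _
  have hi2 : ∀ r : ℝ, ENNReal.ofReal (Set.indicator {u : ℂ | ‖u‖ ≤ r} (1 : ℂ → ℝ) u) =
      Set.indicator {u : ℂ | ‖u‖ ≤ r} 1 u := fun r => by
    by_cases h : u ∈ {u : ℂ | ‖u‖ ≤ r}
    · rw [Set.indicator_of_mem h, Set.indicator_of_mem h]; simp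
    · rw [Set.indicator_of_notMem h, Set.indicator_of_notMem h]; simp
  have h1 := hi (Real.exp (-Q))
  have h2 := hi ρ
  unfold logError
  rw [ENNReal.ofReal_add (by positivity) (by positivity),
    ENNReal.ofReal_add (by positivity) (by positivity),
    ENNReal.ofReal_add (by positivity) (by positivity),
    ENNReal.ofReal_mul (p := α * Λ) (by positivity), ENNReal.ofReal_mul (p := α / Λ) (by positivity),
    ENNReal.ofReal_mul hl, hi2, hi2]

/-- The parameter `Λ` plays two roles that balance: it bounds the moment of the logarithm on `S`,
and its inverse bounds the probability of values below `exp(-Q)`. Both middle terms become of size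
`α`. -/
theorem lintegral_lintegral_logError_le {F : E → ℂ → ℂ}
    (hF : Measurable fun q : E × ℂ => F q.1 q.2) {S : Set E} (hS : MeasurableSet S) {D : Set ℂ}
    (hD : MeasurableSet D) {α l Λ Q ρ θ v : ℝ} {q : ℕ} (hα : 0 ≤ α) (hl : 0 ≤ l) (hΛ : 0 < Λ)
    (hQ : 1 ≤ Q) (hv : 0 ≤ v) (hθ : 0 ≤ θ) (hDv : volume D = ENNReal.ofReal v)
    (hmom : ∀ a ∈ S, ∫⁻ x in D, ENNReal.ofReal (|Real.log ‖F a x‖| ^ (2 * q)) ≤ ENNReal.ofReal Λ)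
    (h1 : ∀ x ∈ D, P.real {a | ‖F a x‖ ≤ Real.exp (-Q)} ≤ 1 / Λ)
    (h2 : ∀ x ∈ D, P.real {a | ‖F a x‖ ≤ ρ} ≤ θ) :
    ∫⁻ a in S, ∫⁻ x in D, ENNReal.ofReal (logError α l Λ Q ρ q (F a x)) ∂volume ∂P ≤
      ENNReal.ofReal ((3 * v + 1) * (α * Q ^ q) + v * (l * θ)) := by
  have hset : ∀ ρ : ℝ, MeasurableSet {u : ℂ | ‖u‖ ≤ ρ} := fun ρ =>
    (isClosed_le continuous_norm continuous_const).measurableSet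
  have hind : ∀ ρ : ℝ, Measurable fun q : E × ℂ =>
      Set.indicator {u : ℂ | ‖u‖ ≤ ρ} (1 : ℂ → ℝ≥0∞) (F q.1 q.2) := fun ρ =>
    (measurable_one.indicator (hset ρ)).comp hF
  have hind' : ∀ (ρ : ℝ) (a : E), Measurable fun x : ℂ =>
      Set.indicator {u : ℂ | ‖u‖ ≤ ρ} (1 : ℂ → ℝ≥0∞) (F a x) := fun ρ a =>
    (hind ρ).comp (by fun_prop : Measurable fun x : ℂ => (a, x))
  have hind2 : ∀ ρ : ℝ, Measurable fun a : E => ∫⁻ x in D,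
      Set.indicator {u : ℂ | ‖u‖ ≤ ρ} (1 : ℂ → ℝ≥0∞) (F a x) := fun ρ =>
    (hind ρ).lintegral_prod_right'
  have hFa : ∀ a, Measurable (F a) := fun a => hF.comp (by fun_prop : Measurable fun x : ℂ => (a, x))
  have h4 : Measurable fun u : ℂ => ENNReal.ofReal (|Real.log ‖u‖| ^ (2 * q)) := by fun_prop
  have hlog' : ∀ a : E, Measurable fun x : ℂ => ENNReal.ofReal (|Real.log ‖F a x‖| ^ (2 * q)) :=
    fun a => h4.comp (hFa a)
  have hlog2 : Measurable fun a : E => ∫⁻ x in D, ENNReal.ofReal (|Real.log ‖F a x‖| ^ (2 * q)) :=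
    Measurable.lintegral_prod_right' (h4.comp hF)
  simp only [ofReal_logError hα hl hΛ (show 0 ≤ Q by linarith)]
  have hinner : ∀ a, ∫⁻ x in D, (ENNReal.ofReal (α * (2 * Q ^ q)) +
      ENNReal.ofReal (α * Λ) * Set.indicator {u : ℂ | ‖u‖ ≤ Real.exp (-Q)} 1 (F a x) +
      ENNReal.ofReal (α / Λ) * ENNReal.ofReal (|Real.log ‖F a x‖| ^ (2 * q)) +
      ENNReal.ofReal l * Set.indicator {u : ℂ | ‖u‖ ≤ ρ} 1 (F a x)) =
      ENNReal.ofReal (α * (2 * Q ^ q)) * ENNReal.ofReal v + ENNReal.ofReal (α * Λ) *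
        (∫⁻ x in D, Set.indicator {u : ℂ | ‖u‖ ≤ Real.exp (-Q)} 1 (F a x)) +
      ENNReal.ofReal (α / Λ) * (∫⁻ x in D, ENNReal.ofReal (|Real.log ‖F a x‖| ^ (2 * q))) +
      ENNReal.ofReal l * ∫⁻ x in D, Set.indicator {u : ℂ | ‖u‖ ≤ ρ} 1 (F a x) := by
    intro a
    rw [lintegral_add_right _ ((hind' _ a).const_mul _),
      lintegral_add_right _ ((hlog' a).const_mul _),
      lintegral_add_left measurable_const, setLIntegral_const, hDv,
      lintegral_const_mul _ (hind' _ a), lintegral_const_mul _ (hind' _ a),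
      lintegral_const_mul _ (hlog' a)]
  simp only [hinner]
  rw [lintegral_add_right _ ((hind2 _).const_mul _),
    lintegral_add_right _ (hlog2.const_mul _), lintegral_add_left measurable_const,
    setLIntegral_const, lintegral_const_mul _ (hind2 _), lintegral_const_mul _ (hind2 _),
    lintegral_const_mul _ hlog2]
  have b1 := lintegral_lintegral_indicator_le hF (S := S) hD h1
  have b2 := lintegral_lintegral_indicator_le hF (S := S) hD h2
  rw [hDv] at b1 b2
  have b3 : ∫⁻ a in S, ∫⁻ x in D, ENNReal.ofReal (|Real.log ‖F a x‖| ^ (2 * q)) ∂volume ∂P ≤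
      ENNReal.ofReal Λ := by
    calc _ ≤ ∫⁻ _ in S, ENNReal.ofReal Λ ∂P := setLIntegral_mono' hS fun a ha => hmom a ha
      _ = ENNReal.ofReal Λ * P S := setLIntegral_const _ _
      _ ≤ _ := mul_le_of_le_one_right' prob_le_one
  have hQq : 1 ≤ Q ^ q := one_le_pow₀ hQ
  calc _ ≤ ENNReal.ofReal (α * (2 * Q ^ q)) * ENNReal.ofReal v * 1 +
        ENNReal.ofReal (α * Λ) * (ENNReal.ofReal (1 / Λ) * ENNReal.ofReal v) +
        ENNReal.ofReal (α / Λ) * ENNReal.ofReal Λ +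
        ENNReal.ofReal l * (ENNReal.ofReal θ * ENNReal.ofReal v) := by
        gcongr
        exact prob_le_one
    _ = ENNReal.ofReal (α * (2 * Q ^ q) * v + α * Λ * (1 / Λ * v) + α / Λ * Λ + l * (θ * v)) := by
        rw [mul_one, ← ENNReal.ofReal_mul (by positivity), ← ENNReal.ofReal_mul (by positivity),
          ← ENNReal.ofReal_mul (by positivity), ← ENNReal.ofReal_mul (by positivity),
          ← ENNReal.ofReal_mul hθ, ← ENNReal.ofReal_mul hl,
          ← ENNReal.ofReal_add (by positivity) (by positivity),
          ← ENNReal.ofReal_add (by positivity) (by positivity),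
          ← ENNReal.ofReal_add (by positivity) (by positivity)]
    _ ≤ _ := by
        refine ENNReal.ofReal_le_ofReal ?_
        have e1 : α * Λ * (1 / Λ * v) = α * v := by field_simp
        have e2 : α / Λ * Λ = α := by field_simp
        have e3 : α * v ≤ α * v * Q ^ q := le_mul_of_one_le_right (by positivity) hQq
        have e4 : α ≤ α * Q ^ q := le_mul_of_one_le_right hα hQq
        rw [e1, e2]
        linarith

/-- The mean error of replacing a product of logarithms by truncated logarithms. -/
theorem lintegral_abs_prod_log_sub_prod_truncLog_le {m : ℕ} {F : Fin m → E → ℂ → ℂ}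
    (hF : ∀ j, Measurable fun q : E × ℂ => F j q.1 q.2) {S : Set E} (hS : MeasurableSet S)
    {D : Fin m → Set ℂ} (hD : ∀ j, MeasurableSet (D j)) {η B l Λ Q θ v : ℝ}
    (hη : 0 < η) (hB : 0 < B) (hl : 0 < l) (hΛ : 0 < Λ) (hQ : 1 ≤ Q) (hv : 0 ≤ v) (hθ : 0 ≤ θ)
    (htr : ∀ u, |truncLog η B u| ≤ Q) (hDv : ∀ j, volume (D j) = ENNReal.ofReal v)
    (hup : ∀ j, ∀ a ∈ S, ∀ x ∈ D j, ‖F j a x‖ ≤ √η * B ∧ ‖F j a x‖ ≤ Real.exp Q)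
    (hmom : ∀ j, ∀ a ∈ S, ∫⁻ x in D j,
      ENNReal.ofReal (|Real.log ‖F j a x‖| ^ (2 * (2 * m + 2))) ≤ ENNReal.ofReal Λ)
    (h1 : ∀ j, ∀ x ∈ D j, P.real {a | ‖F j a x‖ ≤ Real.exp (-Q)} ≤ 1 / Λ)
    (h2 : ∀ j, ∀ x ∈ D j, P.real {a | ‖F j a x‖ ≤ √η} ≤ θ) :
    ∫⁻ a in S, ∫⁻ x in Set.univ.pi D, ENNReal.ofReal
        |∏ j, Real.log ‖F j a (x j)‖ - ∏ j, truncLog η B (F j a (x j))| ∂volume ∂P ≤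
      ENNReal.ofReal (m * (v ^ (m - 1) * ((3 * v + 1) *
        (m * (η + 1 / l) * 4 ^ (2 * m + 2) * Q ^ (2 * m + 2)) + v * (l * θ)))) := by
  set q := 2 * m + 2 with hq
  set α : ℝ := m * (η + 1 / l) * 4 ^ q with hα
  have hα0 : 0 ≤ α := by positivity
  have hFa : ∀ j a, Measurable (F j a) := fun j a =>
    (hF j).comp (by fun_prop : Measurable fun x : ℂ => (a, x))
  have h4 : Measurable fun u : ℂ => ENNReal.ofReal (logError α l Λ Q √η q u) :=
    (measurable_logError _ _ _ _ _ _).ennreal_ofReal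
  have hmeas' : ∀ j (a : E), Measurable fun x : ℂ =>
      ENNReal.ofReal (logError α l Λ Q √η q (F j a x)) := fun j a => h4.comp (hFa j a)
  have hmeas2 : ∀ j, Measurable fun a : E => ∫⁻ x in D j,
      ENNReal.ofReal (logError α l Λ Q √η q (F j a x)) := fun j =>
    Measurable.lintegral_prod_right' (h4.comp (hF j))
  have hbound : ∀ a ∈ S, ∫⁻ x in Set.univ.pi D, ENNReal.ofReal
      |∏ j, Real.log ‖F j a (x j)‖ - ∏ j, truncLog η B (F j a (x j))| ≤
      ∑ j, ENNReal.ofReal (v ^ (m - 1)) *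
        ∫⁻ x in D j, ENNReal.ofReal (logError α l Λ Q √η q (F j a x)) := by
    intro a ha
    calc _ ≤ ∫⁻ x in Set.univ.pi D,
          ∑ j, ENNReal.ofReal (logError α l Λ Q √η q (F j a (x j))) := by
          refine setLIntegral_mono' (MeasurableSet.univ_pi hD) fun x hx => ?_
          refine (ENNReal.ofReal_le_ofReal (abs_prod_log_sub_prod_truncLog_le hη hB hQ hl hΛ htr
            (fun j => (hup j a ha _ (hx j (Set.mem_univ j))).1)
            (fun j => (hup j a ha _ (hx j (Set.mem_univ j))).2))).trans ?_
          rw [ENNReal.ofReal_sum_of_nonneg fun j _ =>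
            logError_nonneg hα0 hl.le hΛ.le (by linarith) _]
      _ = ∑ j, ENNReal.ofReal (v ^ (m - 1)) *
            ∫⁻ x in D j, ENNReal.ofReal (logError α l Λ Q √η q (F j a x)) := by
          have hm : ∀ j ∈ Finset.univ, Measurable fun x : Fin m → ℂ =>
              ENNReal.ofReal (logError α l Λ Q √η q (F j a (x j))) := fun j _ =>
            (hmeas' j a).comp (measurable_pi_apply j)
          rw [lintegral_finsetSum _ hm]
          refine Finset.sum_congr rfl fun j _ => ?_
          rw [lintegral_restrict_pi_eval D (fun i => by rw [hDv]; exact ENNReal.ofReal_ne_top) j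
            (hmeas' j a)]
          congr 1
          simp only [hDv, Finset.prod_const, Finset.card_erase_of_mem (Finset.mem_univ j),
            Finset.card_univ, Fintype.card_fin, ENNReal.ofReal_pow hv]
  calc _ ≤ ∫⁻ a in S, ∑ j, ENNReal.ofReal (v ^ (m - 1)) *
        (∫⁻ x in D j, ENNReal.ofReal (logError α l Λ Q √η q (F j a x))) ∂P :=
        setLIntegral_mono' hS fun a ha => hbound a ha
    _ = ∑ j, ∫⁻ a in S, ENNReal.ofReal (v ^ (m - 1)) *
        (∫⁻ x in D j, ENNReal.ofReal (logError α l Λ Q √η q (F j a x))) ∂P :=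
        lintegral_finsetSum _ fun j _ => (hmeas2 j).const_mul _
    _ ≤ ∑ j : Fin m, ENNReal.ofReal (v ^ (m - 1)) *
        ENNReal.ofReal ((3 * v + 1) * (α * Q ^ q) + v * (l * θ)) := by
        refine Finset.sum_le_sum fun j _ => ?_
        rw [lintegral_const_mul _ (hmeas2 j)]
        gcongr
        exact lintegral_lintegral_logError_le (hF j) hS (hD j) hα0 hl.le hΛ hQ hv hθ (hDv j)
          (hmom j) (h1 j) (h2 j)
    _ = _ := by
        rw [Finset.sum_const, nsmul_eq_mul, Finset.card_univ, Fintype.card_fin,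
          ENNReal.ofReal_mul (Nat.cast_nonneg m), ENNReal.ofReal_natCast,
          ENNReal.ofReal_mul (by positivity)]

end IntegratedComparison

/-! ### Root sums and their truncations. -/

/-- The product of the closed discs of radius `R` about the points `z j`. -/
def closedPolydisc {m : ℕ} (z : Fin m → ℂ) (R : ℝ) : Set (Fin m → ℂ) :=
  Set.univ.pi fun j => Metric.closedBall (z j) R

section Support

variable {m : ℕ} {z : Fin m → ℂ} {R : ℝ} {G : (Fin m → ℂ) → ℂ}

theorem mem_closedPolydisc {w : Fin m → ℂ} :
    w ∈ closedPolydisc z R ↔ ∀ j, ‖w j - z j‖ ≤ R := by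
  simp [closedPolydisc, Set.mem_pi, dist_eq_norm]

theorem isCompact_closedPolydisc (z : Fin m → ℂ) (R : ℝ) : IsCompact (closedPolydisc z R) :=
  isCompact_univ_pi fun j => isCompact_closedBall (z j) R

theorem measurableSet_closedPolydisc (z : Fin m → ℂ) (R : ℝ) :
    MeasurableSet (closedPolydisc z R) := (isCompact_closedPolydisc z R).measurableSet

theorem volume_closedBall_eq_ofReal (c : ℂ) (hR : 0 ≤ R) :
    volume (Metric.closedBall c R) = ENNReal.ofReal (Real.pi * R ^ 2) := by
  rw [Complex.volume_closedBall, ENNReal.ofReal_mul Real.pi_pos.le, ENNReal.ofReal_pow hR, mul_comm,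
    ← NNReal.coe_real_pi, ENNReal.ofReal_coe_nnreal]

theorem volume_closedPolydisc (z : Fin m → ℂ) (hR : 0 ≤ R) :
    volume (closedPolydisc z R) = ENNReal.ofReal ((Real.pi * R ^ 2) ^ m) := by
  have h0 : 0 ≤ Real.pi * R ^ 2 := by have := Real.pi_pos; positivity
  rw [closedPolydisc, volume_pi, Measure.pi_pi]
  simp [volume_closedBall_eq_ofReal _ hR, ENNReal.ofReal_pow h0]

theorem tsupport_subset_closedPolydisc (hs : ∀ w, G w ≠ 0 → w ∈ closedPolydisc z R) :
    tsupport G ⊆ closedPolydisc z R :=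
  closure_minimal (fun w hw => hs w hw) (isCompact_closedPolydisc z R).isClosed

theorem hasCompactSupport_of_subset_closedPolydisc
    (hs : ∀ w, G w ≠ 0 → w ∈ closedPolydisc z R) : HasCompactSupport G :=
  HasCompactSupport.of_support_subset_isCompact (isCompact_closedPolydisc z R) fun w hw => hs w hw

theorem fullLaplacian_eq_zero (hs : ∀ w, G w ≠ 0 → w ∈ closedPolydisc z R) {x : Fin m → ℂ}
    (hx : x ∉ closedPolydisc z R) : fullLaplacian G x = 0 :=
  image_eq_zero_of_notMem_tsupport fun h =>
    hx (tsupport_subset_closedPolydisc hs (tsupport_listLaplacian_subset _ _ h))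

theorem continuous_fullLaplacian (hG : ContDiff ℝ (⊤ : ℕ∞) G) : Continuous (fullLaplacian G) :=
  (contDiff_listLaplacian _ hG).continuous

theorem hasCompactSupport_fullLaplacian (hs : ∀ w, G w ≠ 0 → w ∈ closedPolydisc z R) :
    HasCompactSupport (fullLaplacian G) :=
  HasCompactSupport.of_support_subset_isCompact (isCompact_closedPolydisc z R) fun _ hw =>
    by_contra fun h => hw (fullLaplacian_eq_zero hs h)

end Support

/-- The sum of a test function over tuples of zeroes, with truncated logarithms in Green's
formula. -/
def truncSum {m n : ℕ} (η B : ℝ) (z : Fin m → ℂ) (G : (Fin m → ℂ) → ℂ)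
    (a : Fin (n + 1) → ℂ) : ℂ :=
  ((2 * Real.pi : ℂ) ^ m)⁻¹ *
    ∫ x : Fin m → ℂ, (∏ j, truncLog η B (weylField (z j) a (x j))) • fullLaplacian G x

section TruncSum

variable {m n : ℕ} {η B R Q KH : ℝ} {z : Fin m → ℂ} {G : (Fin m → ℂ) → ℂ}

theorem norm_inv_two_pi_pow_le (m : ℕ) : ‖((2 * Real.pi : ℂ) ^ m)⁻¹‖ ≤ 1 := by
  rw [norm_inv, norm_pow, norm_mul, Complex.norm_real, Real.norm_eq_abs, abs_of_pos Real.pi_pos]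
  refine inv_le_one_of_one_le₀ (one_le_pow₀ ?_)
  have := Real.pi_gt_three
  norm_num
  linarith

theorem locallyIntegrable_log_norm_weylField {a : Fin (n + 1) → ℂ} (hp : flatPolynomial n a ≠ 0)
    (c : ℂ) : LocallyIntegrable fun x : ℂ => Real.log ‖weylField c a x‖ := by
  have hc : Continuous fun x : ℂ => (-(‖c‖ ^ 2 / 2 : ℝ) + (starRingEnd ℂ) c * x).re :=
    Complex.continuous_re.comp (by fun_prop)
  have h := (locallyIntegrable_log_norm_eval hp).sub hc.locallyIntegrable
  rw [locallyIntegrable_iff] at h ⊢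
  intro K hK
  refine (h K hK).congr (ae_restrict_of_ae ?_)
  filter_upwards [ae_eval_ne_zero hp] with x hx
  exact (log_norm_weylField hx).symm

theorem continuous_prod_truncLog_weylField (η B : ℝ) (z : Fin m → ℂ) :
    Continuous fun q : (Fin (n + 1) → ℂ) × (Fin m → ℂ) =>
      ∏ j, truncLog η B (weylField (z j) q.1 (q.2 j)) := by
  refine continuous_finsetProd _ fun j _ => (continuous_truncLog η B).comp ?_
  exact (continuous_weylField (z j)).comp
    (by fun_prop : Continuous fun q : (Fin (n + 1) → ℂ) × (Fin m → ℂ) => (q.1, q.2 j))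

theorem abs_prod_truncLog_le (htr : ∀ u, |truncLog η B u| ≤ Q) (u : Fin m → ℂ) :
    |∏ j, truncLog η B (u j)| ≤ Q ^ m := by
  rw [Finset.abs_prod]
  refine (Finset.prod_le_prod (fun _ _ => abs_nonneg _) fun j _ => htr (u j)).trans ?_
  simp

theorem integrable_prod_truncLog_smul (hG : ContDiff ℝ (⊤ : ℕ∞) G)
    (hs : ∀ w, G w ≠ 0 → w ∈ closedPolydisc z R) (a : Fin (n + 1) → ℂ) :
    Integrable fun x : Fin m → ℂ =>
      (∏ j, truncLog η B (weylField (z j) a (x j))) • fullLaplacian G x :=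
  integrable_prod_smul_of_locallyIntegrable (fun j =>
    ((continuous_truncLog η B).comp ((continuous_weylField (z j)).comp
      (by fun_prop : Continuous fun x : ℂ => (a, x)))).locallyIntegrable)
    (continuous_fullLaplacian hG) (hasCompactSupport_fullLaplacian hs)

theorem enorm_integral_smul_fullLaplacian_le (hs : ∀ w, G w ≠ 0 → w ∈ closedPolydisc z R)
    (hKH : ∀ w, ‖fullLaplacian G w‖ ≤ KH) (f : (Fin m → ℂ) → ℝ) :
    ‖∫ x, f x • fullLaplacian G x‖ₑ ≤
      ENNReal.ofReal KH * ∫⁻ x in closedPolydisc z R, ENNReal.ofReal |f x| := by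
  have hKH0 : 0 ≤ KH := (norm_nonneg _).trans (hKH 0)
  refine (enorm_integral_le_lintegral_enorm _).trans ?_
  rw [← lintegral_const_mul' _ _ ENNReal.ofReal_ne_top,
    ← lintegral_indicator (measurableSet_closedPolydisc z R)]
  refine lintegral_mono fun x => ?_
  by_cases hx : x ∈ closedPolydisc z R
  · rw [Set.indicator_of_mem hx, enorm_smul, mul_comm, ← ofReal_norm, ← ofReal_norm,
      Real.norm_eq_abs]
    gcongr
    exact hKH x
  · rw [fullLaplacian_eq_zero hs hx]
    simp

theorem enorm_rootSum_sub_truncSum_le (hG : ContDiff ℝ (⊤ : ℕ∞) G)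
    (hs : ∀ w, G w ≠ 0 → w ∈ closedPolydisc z R) (hKH : ∀ w, ‖fullLaplacian G w‖ ≤ KH)
    {a : Fin (n + 1) → ℂ} (hp : flatPolynomial n a ≠ 0) :
    ‖rootSum G (flatPolynomial n a) - truncSum η B z G a‖ₑ ≤
      ENNReal.ofReal KH * ∫⁻ x in closedPolydisc z R, ENNReal.ofReal
        |∏ j, Real.log ‖weylField (z j) a (x j)‖ -
          ∏ j, truncLog η B (weylField (z j) a (x j))| := by
  have hc := hasCompactSupport_of_subset_closedPolydisc hs
  have h1 := integral_prod_log_weylField (z := z) hp hG hc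
  have hpi : ((2 * Real.pi : ℂ) ^ m) ≠ 0 := by
    have := Real.pi_ne_zero
    refine pow_ne_zero _ (mul_ne_zero two_ne_zero ?_)
    exact_mod_cast this
  have h2 : rootSum G (flatPolynomial n a) = ((2 * Real.pi : ℂ) ^ m)⁻¹ *
      ∫ x : Fin m → ℂ, (∏ j, Real.log ‖weylField (z j) a (x j)‖) • fullLaplacian G x := by
    rw [h1, inv_mul_cancel_left₀ hpi]
  rw [h2, truncSum, ← mul_sub, ← integral_sub
    (integrable_prod_smul_of_locallyIntegrable
      (fun j => locallyIntegrable_log_norm_weylField hp (z j))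
      (continuous_fullLaplacian hG) (hasCompactSupport_fullLaplacian hs))
    (integrable_prod_truncLog_smul hG hs a)]
  simp only [← sub_smul]
  rw [enorm_mul]
  calc _ ≤ 1 * ‖∫ x : Fin m → ℂ, (∏ j, Real.log ‖weylField (z j) a (x j)‖ -
          ∏ j, truncLog η B (weylField (z j) a (x j))) • fullLaplacian G x‖ₑ := by
        gcongr
        rw [← ofReal_norm, ← ENNReal.ofReal_one]
        exact ENNReal.ofReal_le_ofReal (norm_inv_two_pi_pow_le m)
    _ ≤ _ := by
        rw [one_mul]
        exact enorm_integral_smul_fullLaplacian_le hs hKH _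

theorem norm_truncSum_le (hR : 0 ≤ R) (hs : ∀ w, G w ≠ 0 → w ∈ closedPolydisc z R)
    (hKH : ∀ w, ‖fullLaplacian G w‖ ≤ KH) (htr : ∀ u, |truncLog η B u| ≤ Q)
    (a : Fin (n + 1) → ℂ) :
    ‖truncSum η B z G a‖ ≤ KH * (Q ^ m * (Real.pi * R ^ 2) ^ m) := by
  have hKH0 : 0 ≤ KH := (norm_nonneg _).trans (hKH 0)
  have hQ0 : 0 ≤ Q := (abs_nonneg _).trans (htr 0)
  have hpi := Real.pi_pos
  have h : ‖∫ x : Fin m → ℂ, (∏ j, truncLog η B (weylField (z j) a (x j))) • fullLaplacian G x‖ₑ ≤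
      ENNReal.ofReal (KH * (Q ^ m * (Real.pi * R ^ 2) ^ m)) := by
    refine (enorm_integral_smul_fullLaplacian_le hs hKH _).trans ?_
    rw [ENNReal.ofReal_mul hKH0, ENNReal.ofReal_mul (by positivity)]
    gcongr
    rw [← volume_closedPolydisc z hR, ← setLIntegral_const]
    exact lintegral_mono fun x => ENNReal.ofReal_le_ofReal (abs_prod_truncLog_le htr _)
  rw [← ofReal_norm, ENNReal.ofReal_le_ofReal_iff (by positivity)] at h
  unfold truncSum
  rw [norm_mul]
  calc _ ≤ 1 * (KH * (Q ^ m * (Real.pi * R ^ 2) ^ m)) :=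
        mul_le_mul (norm_inv_two_pi_pow_le m) h (norm_nonneg _) zero_le_one
    _ = _ := one_mul _

theorem stronglyMeasurable_truncSum (hG : ContDiff ℝ (⊤ : ℕ∞) G) :
    StronglyMeasurable fun a : Fin (n + 1) → ℂ => truncSum η B z G a := by
  have h : Continuous fun q : (Fin (n + 1) → ℂ) × (Fin m → ℂ) =>
      (∏ j, truncLog η B (weylField (z j) q.1 (q.2 j))) • fullLaplacian G q.2 :=
    (continuous_prod_truncLog_weylField η B z).smul
      ((continuous_fullLaplacian hG).comp continuous_snd)
  exact (h.stronglyMeasurable.integral_prod_right').const_mul _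

theorem stronglyMeasurable_rootSum (n : ℕ) (hG : Continuous G) :
    StronglyMeasurable fun a : Fin (n + 1) → ℂ => rootSum G (flatPolynomial n a) := by
  obtain ⟨S, _, d, q, -, -, h⟩ := exists_rootSum_eq_distinctRootSum_add m
  simp only [h]
  refine (stronglyMeasurable_distinctRootSum n hG).add ?_
  refine Finset.stronglyMeasurable_fun_sum _ fun s _ => ?_
  exact stronglyMeasurable_distinctRootSum n (hG.comp (by fun_prop))

end TruncSum

section TruncationError

variable {m n : ℕ} {η B R Q K KH : ℝ} {z : Fin m → ℂ} {G : (Fin m → ℂ) → ℂ}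

/-- On `S` the difference is Green's formula applied to the difference of the products; off `S` both
sums have deterministic bounds, multiplied by the probability of the complement. -/
theorem norm_integral_rootSum_sub_truncSum_le {P : Measure (Fin (n + 1) → ℂ)}
    [IsProbabilityMeasure P] (hG : ContDiff ℝ (⊤ : ℕ∞) G) (hR : 0 ≤ R)
    (hs : ∀ w, G w ≠ 0 → w ∈ closedPolydisc z R) (hK : ∀ w, ‖G w‖ ≤ K)
    (hKH : ∀ w, ‖fullLaplacian G w‖ ≤ KH) (htr : ∀ u, |truncLog η B u| ≤ Q)
    {S : Set (Fin (n + 1) → ℂ)} (hS : MeasurableSet S) (hp : ∀ a ∈ S, flatPolynomial n a ≠ 0)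
    {T : ℝ} (hT0 : 0 ≤ T) (hT : ∫⁻ a in S, ∫⁻ x in closedPolydisc z R, ENNReal.ofReal
        |∏ j, Real.log ‖weylField (z j) a (x j)‖ -
          ∏ j, truncLog η B (weylField (z j) a (x j))| ∂volume ∂P ≤ ENNReal.ofReal T) :
    ‖(∫ a, rootSum G (flatPolynomial n a) ∂P) - ∫ a, truncSum η B z G a ∂P‖ ≤
      KH * T + (K * (n : ℝ) ^ m + KH * (Q ^ m * (Real.pi * R ^ 2) ^ m)) * P.real Sᶜ := by
  have hK0 : 0 ≤ K := (norm_nonneg _).trans (hK 0)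
  have hKH0 : 0 ≤ KH := (norm_nonneg _).trans (hKH 0)
  have hQ0 : 0 ≤ Q := (abs_nonneg _).trans (htr 0)
  have hpi := Real.pi_pos
  have b1 : ∀ a : Fin (n + 1) → ℂ, ‖rootSum G (flatPolynomial n a)‖ ≤ K * (n : ℝ) ^ m := fun a =>
    norm_rootSum_le hK (natDegree_flatPolynomial_le n a)
  have b2 := norm_truncSum_le (n := n) hR hs hKH htr
  have m1 := stronglyMeasurable_rootSum n hG.continuous
  have m2 := stronglyMeasurable_truncSum (n := n) (η := η) (B := B) (z := z) hG
  have i1 : Integrable (fun a => rootSum G (flatPolynomial n a)) P :=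
    Integrable.of_bound m1.aestronglyMeasurable _ (Filter.Eventually.of_forall b1)
  have i2 : Integrable (fun a => truncSum η B z G a) P :=
    Integrable.of_bound m2.aestronglyMeasurable _ (Filter.Eventually.of_forall b2)
  rw [← integral_sub i1 i2]
  have hmain : ‖∫ a, (rootSum G (flatPolynomial n a) - truncSum η B z G a) ∂P‖ₑ ≤
      ENNReal.ofReal (KH * T +
        (K * (n : ℝ) ^ m + KH * (Q ^ m * (Real.pi * R ^ 2) ^ m)) * P.real Sᶜ) := by
    refine (enorm_integral_le_lintegral_enorm _).trans ?_
    rw [← lintegral_add_compl _ hS, ENNReal.ofReal_add (by positivity) (by positivity)]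
    refine add_le_add ?_ ?_
    · calc _ ≤ ∫⁻ a in S, ENNReal.ofReal KH * (∫⁻ x in closedPolydisc z R, ENNReal.ofReal
            |∏ j, Real.log ‖weylField (z j) a (x j)‖ -
              ∏ j, truncLog η B (weylField (z j) a (x j))|) ∂P :=
            setLIntegral_mono' hS fun a ha => enorm_rootSum_sub_truncSum_le hG hs hKH (hp a ha)
        _ ≤ ENNReal.ofReal KH * ENNReal.ofReal T := by
            rw [lintegral_const_mul' _ _ ENNReal.ofReal_ne_top]
            gcongr
        _ = _ := (ENNReal.ofReal_mul hKH0).symm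
    · calc _ ≤ ∫⁻ a in Sᶜ, ENNReal.ofReal
            (K * (n : ℝ) ^ m + KH * (Q ^ m * (Real.pi * R ^ 2) ^ m)) ∂P := by
            refine lintegral_mono fun a => ?_
            rw [← ofReal_norm]
            refine ENNReal.ofReal_le_ofReal ((norm_sub_le _ _).trans ?_)
            exact add_le_add (b1 a) (b2 a)
        _ = _ := by
            rw [setLIntegral_const, ← ofReal_measureReal (μ := P) (s := Sᶜ),
              ← ENNReal.ofReal_mul (by positivity)]
  rwa [← ofReal_norm, ENNReal.ofReal_le_ofReal_iff (by positivity)] at hmain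

end TruncationError

/-! ### Exchanging the atoms in truncated root sums. -/

section Exchange

variable {m n : ℕ} {η B R Q KH : ℝ} {z : Fin m → ℂ} {G : (Fin m → ℂ) → ℂ}

/-- Two of the `p` powers are summed as variances; the remaining `p - 2` are bounded by the largest
coefficient, which is where the gain lies. -/
theorem sum_norm_rpow_le {N : ℕ} {c : Fin N → Fin m → ℂ} {β s p : ℝ} (hp : 2 ≤ p) (hβ : 0 ≤ β)
    (hc : ∀ i j, ‖c i j‖ ≤ β) (hs : ∀ j, ∑ i, ‖c i j‖ ^ 2 ≤ s) :
    ∑ i, ‖c i‖ ^ p ≤ m * s * β ^ (p - 2) := by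
  have h1 : ∀ i, ‖c i‖ ^ 2 ≤ ∑ j, ‖c i j‖ ^ 2 := by
    intro i
    have h0 : 0 ≤ ∑ j, ‖c i j‖ ^ 2 := Finset.sum_nonneg fun j _ => sq_nonneg _
    rw [← Real.le_sqrt (norm_nonneg _) h0, pi_norm_le_iff_of_nonneg (Real.sqrt_nonneg _)]
    intro j
    rw [Real.le_sqrt (norm_nonneg _) h0]
    exact Finset.single_le_sum (f := fun j => ‖c i j‖ ^ 2) (fun j _ => sq_nonneg _)
      (Finset.mem_univ j)
  have h2 : ∀ i, ‖c i‖ ≤ β := fun i => (pi_norm_le_iff_of_nonneg hβ).2 (hc i)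
  calc ∑ i, ‖c i‖ ^ p ≤ ∑ i, (∑ j, ‖c i j‖ ^ 2) * β ^ (p - 2) := by
        refine Finset.sum_le_sum fun i _ => ?_
        have e : ‖c i‖ ^ p = ‖c i‖ ^ 2 * ‖c i‖ ^ (p - 2) := by
          rcases (norm_nonneg (c i)).eq_or_lt with h0 | h0
          · rw [← h0, Real.zero_rpow (by linarith)]
            simp
          · rw [← Real.rpow_natCast, ← Real.rpow_add h0]
            congr 1
            push_cast
            ring
        rw [e]
        refine mul_le_mul (h1 i) (Real.rpow_le_rpow (norm_nonneg _) (h2 i) (by linarith))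
          (Real.rpow_nonneg (norm_nonneg _) _) ((sq_nonneg _).trans (h1 i))
    _ = (∑ j, ∑ i, ‖c i j‖ ^ 2) * β ^ (p - 2) := by rw [← Finset.sum_mul, Finset.sum_comm]
    _ ≤ (∑ _j : Fin m, s) * β ^ (p - 2) := by
        gcongr with j
        exact hs j
    _ = _ := by simp

theorem weylField_eq_sum_smul (z : Fin m → ℂ) (x : Fin m → ℂ) (a : Fin (n + 1) → ℂ) (j : Fin m) :
    weylField (z j) a (x j) =
      ((0 : Fin m → ℂ) + ∑ i, a i • fun j => weylCoeff (z j) (x j) i) j := by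
  simp [weylField]

/-- The mean of a product of truncated logarithms depends little on the law of the coefficients. -/
theorem abs_integral_prod_truncLog_sub_le {p M β s : ℝ} (hp2 : 2 ≤ p) (hp3 : p ≤ 3) (hη : 0 < η)
    (hηB : η ≤ B) (hQ : 72 ≤ Q) (htr : ∀ u, |truncLog η B u| ≤ Q)
    {μ ν : Measure ℂ} (hμ : IsNormalizedAtom μ) (hν : IsNormalizedAtom ν)
    (hm : MatchMoments 2 μ ν)
    (hμp : Integrable (fun x : ℂ => ‖x‖ ^ p) μ) (hνp : Integrable (fun x : ℂ => ‖x‖ ^ p) ν)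
    (hM : 0 ≤ M) (hμM : ∫ x, ‖x‖ ^ p ∂μ ≤ M) (hνM : ∫ x, ‖x‖ ^ p ∂ν ≤ M) {x : Fin m → ℂ}
    (hβ : 0 ≤ β) (hc : ∀ j i, ‖weylCoeff (z j) (x j) i‖ ≤ β)
    (hs : ∀ j, ∑ i : Fin (n + 1), ‖weylCoeff (z j) (x j) i‖ ^ 2 ≤ s) :
    |(∫ a : Fin (n + 1) → ℂ, ∏ j, truncLog η B (weylField (z j) a (x j)) ∂(iidMeasure μ (n + 1))) -
      ∫ a : Fin (n + 1) → ℂ, ∏ j, truncLog η B (weylField (z j) a (x j)) ∂(iidMeasure ν (n + 1))| ≤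
      2 * M * (7 * Q) ^ m * η⁻¹ ^ p * (m * s * β ^ (p - 2)) := by
  have := hμ.isProbabilityMeasure
  have := hν.isProbabilityMeasure
  have hη' : 0 ≤ η⁻¹ := (inv_pos.2 hη).le
  -- All `m` values are treated as one random vector of `ℂ^m`, so that a single exchange handles
  -- their dependence.
  have hT : ∀ j : Fin m, TaylorBound Q η⁻¹ p (fun u : Fin m → ℂ => truncLog η B (u j)) := by
    intro j
    have h1 := (taylorBound_truncLog hp2 hp3 hη hηB).mono (by norm_num) hη' (by linarith) hQ le_rfl
    have h2 := h1.comp_linear (by linarith) hη' (by linarith)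
      (LinearMap.proj j : (Fin m → ℂ) →ₗ[ℝ] ℂ) (s := 1)
      (fun w => by simpa using norm_le_pi_norm w j)
    simpa using h2
  have hprod := TaylorBound.prod Finset.univ hT hη' hp2 hp3 (by linarith) fun j u => htr (u j)
  rw [Finset.card_univ, Fintype.card_fin] at hprod
  have hcont : Continuous fun u : Fin m → ℂ => ∏ j, truncLog η B (u j) :=
    continuous_finsetProd _ fun j _ => (continuous_truncLog η B).comp (continuous_apply j)
  have hL := lindeberg hprod.1 hcont hη' hprod.2 hμ.integrable_sq hν.integrable_sq hm hμp hνp hμM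
    hνM (by positivity) (fun (i : Fin (n + 1)) j => weylCoeff (z j) (x j) i) 0
  simp only [weylField_eq_sum_smul]
  refine hL.trans ?_
  have hsum := sum_norm_rpow_le (c := fun (i : Fin (n + 1)) j => weylCoeff (z j) (x j) i) hp2 hβ
    (fun i j => hc j i) hs
  calc ∑ i : Fin (n + 1), 2 * ((7 * Q) ^ m *
        (η⁻¹ * ‖fun j => weylCoeff (z j) (x j) (i : ℕ)‖) ^ p * M)
      = 2 * M * (7 * Q) ^ m * η⁻¹ ^ p *
        ∑ i : Fin (n + 1), ‖fun j => weylCoeff (z j) (x j) (i : ℕ)‖ ^ p := by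
        rw [Finset.mul_sum]
        refine Finset.sum_congr rfl fun i _ => ?_
        rw [Real.mul_rpow hη' (norm_nonneg _)]
        ring
    _ ≤ _ := by gcongr

theorem integral_truncSum_eq {P : Measure (Fin (n + 1) → ℂ)} [IsProbabilityMeasure P]
    (hG : ContDiff ℝ (⊤ : ℕ∞) G) (hs : ∀ w, G w ≠ 0 → w ∈ closedPolydisc z R)
    (htr : ∀ u, |truncLog η B u| ≤ Q) :
    ∫ a, truncSum η B z G a ∂P = ((2 * Real.pi : ℂ) ^ m)⁻¹ * ∫ x : Fin m → ℂ,
      (∫ a, ∏ j, truncLog η B (weylField (z j) a (x j)) ∂P) • fullLaplacian G x ∧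
    Integrable fun x : Fin m → ℂ =>
      (∫ a, ∏ j, truncLog η B (weylField (z j) a (x j)) ∂P) • fullLaplacian G x := by
  have hc : Integrable (fullLaplacian G) :=
    (continuous_fullLaplacian hG).integrable_of_hasCompactSupport
      (hasCompactSupport_fullLaplacian hs)
  have hint : Integrable (fun q : (Fin (n + 1) → ℂ) × (Fin m → ℂ) =>
      (∏ j, truncLog η B (weylField (z j) q.1 (q.2 j))) • fullLaplacian G q.2) (P.prod volume) := by
    refine (hc.comp_snd P).bdd_smul (Q ^ m)
      (continuous_prod_truncLog_weylField η B z).aestronglyMeasurable ?_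
    exact Filter.Eventually.of_forall fun q => abs_prod_truncLog_le htr _
  have h1 := integral_integral_swap (f := fun (a : Fin (n + 1) → ℂ) (x : Fin m → ℂ) =>
    (∏ j, truncLog η B (weylField (z j) a (x j))) • fullLaplacian G x) hint
  have h2 := hint.integral_prod_right
  simp only [integral_smul_const] at h1 h2
  refine ⟨?_, h2⟩
  rw [← h1, ← integral_const_mul]
  rfl

theorem norm_integral_truncSum_sub_le {P P' : Measure (Fin (n + 1) → ℂ)} [IsProbabilityMeasure P]
    [IsProbabilityMeasure P'] (hG : ContDiff ℝ (⊤ : ℕ∞) G) (hR : 0 ≤ R)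
    (hs : ∀ w, G w ≠ 0 → w ∈ closedPolydisc z R) (hKH : ∀ w, ‖fullLaplacian G w‖ ≤ KH)
    (htr : ∀ u, |truncLog η B u| ≤ Q) {L : ℝ} (hL0 : 0 ≤ L)
    (hL : ∀ x ∈ closedPolydisc z R,
      |(∫ a, ∏ j, truncLog η B (weylField (z j) a (x j)) ∂P) -
        ∫ a, ∏ j, truncLog η B (weylField (z j) a (x j)) ∂P'| ≤ L) :
    ‖(∫ a, truncSum η B z G a ∂P) - ∫ a, truncSum η B z G a ∂P'‖ ≤
      KH * (L * (Real.pi * R ^ 2) ^ m) := by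
  have hKH0 : 0 ≤ KH := (norm_nonneg _).trans (hKH 0)
  have hpi := Real.pi_pos
  obtain ⟨e1, i1⟩ := integral_truncSum_eq (P := P) hG hs htr
  obtain ⟨e2, i2⟩ := integral_truncSum_eq (P := P') hG hs htr
  rw [e1, e2, ← mul_sub, ← integral_sub i1 i2]
  simp only [← sub_smul]
  have h : ‖∫ x : Fin m → ℂ, ((∫ a, ∏ j, truncLog η B (weylField (z j) a (x j)) ∂P) -
        ∫ a, ∏ j, truncLog η B (weylField (z j) a (x j)) ∂P') • fullLaplacian G x‖ₑ ≤
      ENNReal.ofReal (KH * (L * (Real.pi * R ^ 2) ^ m)) := by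
    refine (enorm_integral_smul_fullLaplacian_le hs hKH _).trans ?_
    rw [ENNReal.ofReal_mul hKH0, ENNReal.ofReal_mul hL0]
    gcongr
    rw [← volume_closedPolydisc z hR, ← setLIntegral_const]
    exact setLIntegral_mono' (measurableSet_closedPolydisc z R) fun x hx =>
      ENNReal.ofReal_le_ofReal (hL x hx)
  rw [← ofReal_norm, ENNReal.ofReal_le_ofReal_iff (by positivity)] at h
  rw [norm_mul]
  calc _ ≤ 1 * (KH * (L * (Real.pi * R ^ 2) ^ m)) :=
        mul_le_mul (norm_inv_two_pi_pow_le m) h (norm_nonneg _) zero_le_one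
    _ = _ := one_mul _

end Exchange

/-! ### The event on which moments of the logarithm are controlled. -/

section GoodEvent

variable {m n : ℕ} {z : Fin m → ℂ}

/-- The event that the coefficients are at most `A` and the values at the points `z j` are at least
`exp (-Q)`. -/
def goodEvent (n : ℕ) (A Q : ℝ) (z : Fin m → ℂ) : Set (Fin (n + 1) → ℂ) :=
  {a | (∀ i, ‖a i‖ ≤ A) ∧ ∀ j, Real.exp (-Q) < ‖weylField (z j) a (z j)‖}

theorem continuous_weylField_left (c x : ℂ) :
    Continuous fun a : Fin (n + 1) → ℂ => weylField c a x :=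
  (continuous_weylField c).comp (by fun_prop : Continuous fun a : Fin (n + 1) → ℂ => (a, x))

theorem measurableSet_goodEvent (n : ℕ) (A Q : ℝ) (z : Fin m → ℂ) :
    MeasurableSet (goodEvent n A Q z) := by
  have h1 : MeasurableSet {a : Fin (n + 1) → ℂ | ∀ i, ‖a i‖ ≤ A} := by
    rw [Set.ofPred_forall]
    exact MeasurableSet.iInter fun i => (isClosed_le (by fun_prop) continuous_const).measurableSet
  have h2 : MeasurableSet {a : Fin (n + 1) → ℂ |
      ∀ j, Real.exp (-Q) < ‖weylField (z j) a (z j)‖} := by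
    rw [Set.ofPred_forall]
    exact MeasurableSet.iInter fun j => (isOpen_lt continuous_const
      (continuous_weylField_left (z j) (z j)).norm).measurableSet
  exact h1.inter h2

theorem measureReal_compl_goodEvent_le {μ : Measure ℂ} (hμ : IsNormalizedAtom μ) {A Q τ : ℝ}
    (hA : 0 < A) (hτ : ∀ j, (iidMeasure μ (n + 1)).real
      {a | ‖weylField (z j) a (z j)‖ ≤ Real.exp (-Q)} ≤ τ) :
    (iidMeasure μ (n + 1)).real (goodEvent n A Q z)ᶜ ≤ (n + 1) * (A ^ 2)⁻¹ + m * τ := by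
  have := hμ.isProbabilityMeasure
  have hsub : (goodEvent n A Q z)ᶜ ⊆ (⋃ i, {a : Fin (n + 1) → ℂ | A < ‖a i‖}) ∪
      ⋃ j, {a : Fin (n + 1) → ℂ | ‖weylField (z j) a (z j)‖ ≤ Real.exp (-Q)} := by
    intro a ha
    by_contra hcon
    refine ha ⟨fun i => ?_, fun j => ?_⟩
    · by_contra h
      exact hcon (Or.inl (Set.mem_iUnion.2 ⟨i, not_le.1 h⟩))
    · by_contra h
      exact hcon (Or.inr (Set.mem_iUnion.2 ⟨j, not_lt.1 h⟩))
  have h1 : ∀ i, (iidMeasure μ (n + 1)).real {a : Fin (n + 1) → ℂ | A < ‖a i‖} ≤ (A ^ 2)⁻¹ := by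
    intro i
    have hpre := (measurePreserving_eval (fun _ : Fin (n + 1) => μ) i).measure_preimage
      (s := {x : ℂ | A < ‖x‖})
      (isOpen_lt continuous_const continuous_norm).measurableSet.nullMeasurableSet
    have hle := hμ.measure_lt_norm_le hA
    rw [← hpre] at hle
    exact ENNReal.toReal_le_of_le_ofReal (by positivity) hle
  refine (measureReal_mono hsub).trans ((measureReal_union_le _ _).trans (add_le_add ?_ ?_))
  · refine (measureReal_iUnion_fintype_le _).trans ((Finset.sum_le_sum fun i _ => h1 i).trans ?_)
    simp
  · refine (measureReal_iUnion_fintype_le _).trans ((Finset.sum_le_sum fun j _ => hτ j).trans ?_)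
    simp

/-- Comparison of the root sum with its truncation, for coefficients with a given law. -/
theorem norm_integral_rootSum_sub_truncSum_iid_le {η B R Q K KH l Λ θ A : ℝ}
    {G : (Fin m → ℂ) → ℂ} {μ : Measure ℂ} (hμ : IsNormalizedAtom μ) (hm : 0 < m)
    (hG : ContDiff ℝ (⊤ : ℕ∞) G) (hR : 0 ≤ R)
    (hs : ∀ w, G w ≠ 0 → w ∈ closedPolydisc z R) (hK : ∀ w, ‖G w‖ ≤ K)
    (hKH : ∀ w, ‖fullLaplacian G w‖ ≤ KH) (htr : ∀ u, |truncLog η B u| ≤ Q)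
    (hη : 0 < η) (hB : 0 < B) (hl : 0 < l) (hΛ : 0 < Λ) (hQ : 1 ≤ Q) (hθ : 0 ≤ θ) (hA : 0 < A)
    (hz : ∀ j, 2 + R ≤ ‖z j‖) (hup1 : (n + 1) * (A * Real.exp (R ^ 2)) ≤ √η * B)
    (hup2 : (n + 1) * (A * Real.exp (R ^ 2)) ≤ Real.exp Q)
    (hmom : ∀ j, 2 ^ (4 * m + 3) * ((Q + R * ‖z j‖) ^ (4 * m + 3 + 1) +
        (n : ℝ) ^ (4 * m + 3 + 1) * (4 * m + 3 + 1 : ℕ) ^ (4 * m + 3 + 1)) * (Real.pi * R ^ 2) +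
        n * (2 ^ (4 * m + 3) * (n : ℝ) ^ (4 * m + 3) * (4 * m + 3 + 1 : ℕ) ^ (4 * m + 3 + 1) * R *
          (2 * Real.pi + Real.pi * (R + 1) ^ 2)) ≤ Λ)
    (h1 : ∀ j x, ‖x - z j‖ ≤ R → (iidMeasure μ (n + 1)).real
      {a | ‖weylField (z j) a x‖ ≤ Real.exp (-Q)} ≤ 1 / Λ)
    (h2 : ∀ j x, ‖x - z j‖ ≤ R → (iidMeasure μ (n + 1)).real
      {a | ‖weylField (z j) a x‖ ≤ √η} ≤ θ) :
    ‖(∫ a, rootSum G (flatPolynomial n a) ∂(iidMeasure μ (n + 1))) -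
        ∫ a, truncSum η B z G a ∂(iidMeasure μ (n + 1))‖ ≤
      KH * (m * ((Real.pi * R ^ 2) ^ (m - 1) * ((3 * (Real.pi * R ^ 2) + 1) *
        (m * (η + 1 / l) * 4 ^ (2 * m + 2) * Q ^ (2 * m + 2)) + (Real.pi * R ^ 2) * (l * θ)))) +
      (K * (n : ℝ) ^ m + KH * (Q ^ m * (Real.pi * R ^ 2) ^ m)) *
        ((n + 1) * (A ^ 2)⁻¹ + m * (1 / Λ)) := by
  have := hμ.isProbabilityMeasure
  have hpi := Real.pi_pos
  have hK0 : 0 ≤ K := (norm_nonneg _).trans (hK 0)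
  have hKH0 : 0 ≤ KH := (norm_nonneg _).trans (hKH 0)
  have hx2 : ∀ j x, ‖x - z j‖ ≤ R → 2 ≤ ‖x‖ := by
    intro j x hx
    have h3 := norm_sub_norm_le (z j) x
    rw [norm_sub_rev] at h3
    have := hz j
    linarith
  have hle : ∀ a ∈ goodEvent n A Q z, ∀ j x, ‖x - z j‖ ≤ R →
      ‖weylField (z j) a x‖ ≤ (n + 1) * (A * Real.exp (R ^ 2)) := fun a ha j x hx =>
    norm_weylField_le hx (hx2 j x hx) ha.1
  have hmem : ∀ j x, x ∈ Metric.closedBall (z j) R → ‖x - z j‖ ≤ R := fun j x hx => by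
    rwa [Metric.mem_closedBall, dist_eq_norm] at hx
  have hT := lintegral_abs_prod_log_sub_prod_truncLog_le (P := iidMeasure μ (n + 1))
    (F := fun j a x => weylField (z j) a x)
    (fun j => (continuous_weylField (z j)).measurable) (measurableSet_goodEvent n A Q z)
    (D := fun j => Metric.closedBall (z j) R)
    (fun j => Metric.isClosed_closedBall.measurableSet) hη hB hl hΛ hQ
    (v := Real.pi * R ^ 2) (by positivity) hθ htr (fun j => volume_closedBall_eq_ofReal (z j) hR)
    (fun j a ha x hx => ⟨(hle a ha j x (hmem j x hx)).trans hup1,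
      (hle a ha j x (hmem j x hx)).trans hup2⟩)
    (fun j a ha => by
      have h3 := lintegral_abs_log_norm_weylField_pow_le hR (by linarith) (ha.2 j).le
        (fun x hx => (hle a ha j x hx).trans hup2) (4 * m + 3)
      -- The moment estimate is stated for exponents `r + 1`; here `r = 4m + 3`.
      rw [show 2 * (2 * m + 2) = 4 * m + 3 + 1 by ring]
      exact h3.trans (ENNReal.ofReal_le_ofReal (hmom j)))
    (fun j x hx => h1 j x (hmem j x hx)) (fun j x hx => h2 j x (hmem j x hx))
  have hmain := norm_integral_rootSum_sub_truncSum_le (P := iidMeasure μ (n + 1)) hG hR hs hK hKH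
    htr (measurableSet_goodEvent n A Q z) (fun a ha hp => ?_) (by positivity) hT
  · refine hmain.trans (add_le_add le_rfl ?_)
    refine mul_le_mul_of_nonneg_left ?_ (by positivity)
    exact measureReal_compl_goodEvent_le hμ hA fun j => h1 j (z j) (by simpa using hR)
  -- A nonzero value at one reference point excludes the zero polynomial; this needs a variable,
  -- hence `0 < m`.
  · have h3 := ha.2 ⟨0, hm⟩
    rw [weylField_eq, hp] at h3
    simp only [Polynomial.eval_zero, zero_mul, norm_zero] at h3
    exact absurd (Real.exp_pos (-Q)) (not_lt.2 h3.le)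

end GoodEvent

/-! ### Choice of the parameters as powers of `n`. -/

section Asymptotics

open Filter Topology

theorem tendsto_natCast_rpow_atTop {a : ℝ} (ha : 0 < a) :
    Tendsto (fun n : ℕ => (n : ℝ) ^ a) atTop atTop :=
  (tendsto_rpow_atTop ha).comp tendsto_natCast_atTop_atTop

theorem eventually_pow_le_exp_rpow {a : ℝ} (ha : 0 < a) (N : ℕ) :
    ∀ᶠ n : ℕ in atTop, (n : ℝ) ^ N ≤ Real.exp ((n : ℝ) ^ a) := by
  filter_upwards [eventually_exp_neg_mul_rpow_le one_pos ha N, eventually_ge_atTop 1] with n hn hn1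
  have hn0 : (0 : ℝ) < n := by exact_mod_cast hn1
  rw [one_mul, Real.exp_neg, Real.rpow_neg hn0.le, Real.rpow_natCast, ← div_eq_mul_inv,
    div_le_iff₀ (Real.exp_pos _), inv_mul_eq_div, le_div_iff₀ (by positivity)] at hn
  have : 0 ≤ (n : ℝ) ^ N := by positivity
  linarith

theorem eventually_abs_truncLog_le {a δ : ℝ} (ha : 0 < a) (hδ : 0 < δ) (hδ1 : δ ≤ 1) {N : ℕ}
    (hN : 1 ≤ N) : ∀ᶠ n : ℕ in atTop,
      ∀ u, |truncLog ((n : ℝ) ^ (-δ)) ((n : ℝ) ^ N) u| ≤ (n : ℝ) ^ a := by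
  filter_upwards [eventually_pow_le_exp_rpow ha N, eventually_ge_atTop 1] with n hn hn1 u
  have hn1' : (1 : ℝ) ≤ n := by exact_mod_cast hn1
  have hn0 : (0 : ℝ) < n := by linarith
  have hlog : 0 ≤ Real.log n := Real.log_nonneg hn1'
  have h1 : Real.log ((n : ℝ) ^ N) ≤ (n : ℝ) ^ a :=
    (Real.log_le_iff_le_exp (by positivity)).2 hn
  refine abs_truncLog_le (by positivity) ?_ ?_ h1 u
  · exact (Real.rpow_le_one_of_one_le_of_nonpos hn1' (by linarith)).trans (one_le_pow₀ hn1')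
  · rw [Real.log_rpow hn0]
    rw [Real.log_pow] at h1
    have : (1 : ℝ) ≤ N := by exact_mod_cast hN
    nlinarith

theorem moment_le {μ : Measure ℂ} [IsProbabilityMeasure μ] {ε C p : ℝ} (hε : 0 ≤ ε) (hC : 0 ≤ C)
    (hp : 0 ≤ p) (hpε : p ≤ 2 + ε) (h : ∫⁻ x : ℂ, ‖x‖ₑ ^ (2 + ε) ∂μ ≤ ENNReal.ofReal C) :
    Integrable (fun x : ℂ => ‖x‖ ^ p) μ ∧ ∫ x : ℂ, ‖x‖ ^ p ∂μ ≤ 1 + C := by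
  have h1 := integrable_rpow_of_lintegral_le (by linarith) h
  have h2 := integral_rpow_le_of_lintegral_le (by linarith) hC h
  have hle : ∀ x : ℂ, ‖x‖ ^ p ≤ 1 + ‖x‖ ^ (2 + ε) := by
    intro x
    have h0 : 0 ≤ ‖x‖ ^ (2 + ε) := by positivity
    rcases le_total ‖x‖ 1 with hx | hx
    · have := Real.rpow_le_one (norm_nonneg x) hx hp
      linarith
    · have := Real.rpow_le_rpow_of_exponent_le hx hpε
      linarith
  have h3 : Integrable (fun x : ℂ => 1 + ‖x‖ ^ (2 + ε)) μ := (integrable_const 1).add h1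
  have h4 : Integrable (fun x : ℂ => ‖x‖ ^ p) μ := by
    refine h3.mono' (by fun_prop) (Eventually.of_forall fun x => ?_)
    rw [Real.norm_of_nonneg (by positivity)]
    exact hle x
  refine ⟨h4, (integral_mono h4 h3 hle).trans ?_⟩
  rw [integral_add (integrable_const 1) h1]
  simpa using h2

/-- The values of a random flat polynomial are rarely small. -/
theorem exists_eventually_smallBall {ε C δ : ℝ} (hε : 0 < ε) (hC : 0 < C) (hδ : 0 < δ)
    (hδε : 2 * δ ≤ ε) : ∃ K : ℝ, 0 < K ∧ ∀ᶠ n : ℕ in atTop, ∀ μ : Measure ℂ, IsNormalizedAtom μ →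
      ∫⁻ x, ‖x‖ₑ ^ (2 + ε) ∂μ ≤ ENNReal.ofReal C →
      ∀ z x : ℂ, (n : ℝ) ^ ε ≤ ‖z‖ → ‖z‖ ≤ √n + C → ‖x - z‖ ≤ C →
        (iidMeasure μ (n + 1)).real {a | ‖weylField z a x‖ ≤ √((n : ℝ) ^ (-δ))} ≤
          K * (n : ℝ) ^ (-(δ / 2)) := by
  set e := min ε 1 with he
  have he0 : 0 < e := by positivity
  have heε : e ≤ ε := min_le_left _ _
  have he1 : e ≤ 1 := min_le_right _ _
  obtain ⟨K₁, hK₁, hball⟩ := exists_smallBall_bound (p := 2 + e) (M := 1 + C) (by linarith)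
    (by linarith)
  set κ := Real.exp (-(4 * C + 3) ^ 2) / (2 * Real.exp 1) with hκ
  have hκ0 : 0 < κ := by positivity
  refine ⟨K₁ * (1 / √κ + 2 * Real.exp (C ^ 2)), by positivity, ?_⟩
  filter_upwards [eventually_ge_atTop 1,
    (tendsto_natCast_rpow_atTop hε).eventually_ge_atTop (C + 2 * (4 * C + 3)),
    (tendsto_natCast_rpow_atTop hε).eventually_ge_atTop (2 * C)]
    with n hn1 hn2 hn3 μ hμ hmom z x hz hz' hx
  have := hμ.isProbabilityMeasure
  have hn1' : (1 : ℝ) ≤ n := by exact_mod_cast hn1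
  have hn0 : (0 : ℝ) < n := by linarith
  have hxz : ‖z‖ ≤ ‖x‖ + C := by
    have := norm_sub_norm_le z x
    rw [norm_sub_rev] at this
    linarith
  have hxz' : ‖x‖ ≤ ‖z‖ + C := by
    have := norm_sub_norm_le x z
    linarith
  obtain ⟨hi, hi'⟩ := moment_le hε.le hC.le (show 0 ≤ 2 + e by linarith) (by linarith) hmom
  have hsum := le_sum_norm_weylCoeff_sq (z := z) (x := x) (n := n) (C := C) rfl (by linarith) hC.le
    (by linarith)
  -- Squared coefficients are at most `exp(C²)/‖x‖`, and `‖x‖ ≥ n^ε/2` for large `n`.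
  set β := √(2 * Real.exp (C ^ 2) * (n : ℝ) ^ (-ε)) with hβ
  have hβ2 : β ^ 2 = 2 * Real.exp (C ^ 2) * (n : ℝ) ^ (-ε) := Real.sq_sqrt (by positivity)
  have hcβ : ∀ i : Fin (n + 1), ‖weylCoeff z x i‖ ≤ β := by
    intro i
    refine le_of_sq_le_sq ?_ (Real.sqrt_nonneg _)
    rw [hβ2]
    refine (norm_weylCoeff_sq_le hx (by linarith) i).trans ?_
    rw [Real.rpow_neg hn0.le, ← div_eq_mul_inv, div_le_div_iff₀ (by linarith) (by positivity)]
    have := Real.exp_pos (C ^ 2)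
    nlinarith
  set r := √((n : ℝ) ^ (-δ)) with hr
  have hr0 : 0 < r := Real.sqrt_pos.2 (by positivity)
  have hr2 : r = (n : ℝ) ^ (-(δ / 2)) := by
    rw [hr, Real.sqrt_eq_rpow, ← Real.rpow_mul hn0.le]
    congr 1
    ring
  have hb := hball μ hμ hi hi' (n + 1) (fun i => weylCoeff z x i) κ β r hκ0 hsum hcβ hr0
  refine hb.trans ?_
  rw [mul_assoc]
  refine mul_le_mul_of_nonneg_left ?_ hK₁.le
  have h1 : (β / r) ^ 2 ≤ 2 * Real.exp (C ^ 2) * (n : ℝ) ^ (-(δ / 2)) := by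
    rw [div_pow, hβ2, hr, Real.sq_sqrt (by positivity), mul_div_assoc, ← Real.rpow_sub hn0]
    refine mul_le_mul_of_nonneg_left ?_ (by positivity)
    refine Real.rpow_le_rpow_of_exponent_le hn1' ?_
    linarith
  calc r / √κ + (β / r) ^ 2 ≤ (n : ℝ) ^ (-(δ / 2)) / √κ +
        2 * Real.exp (C ^ 2) * (n : ℝ) ^ (-(δ / 2)) := by rw [hr2] at h1 ⊢; linarith
    _ = _ := by ring

/-- With `η = y^{-δ}`, `l = y^{δ/4}` and small ball probability of order `y^{-δ/2}`: the term `(η +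
1/l)Q^{2m+2}` is `O(y^{-δ/4 + δ/8})`, and `l` times the probability is `O(y^{-δ/4})`. -/
theorem truncation_error_le {m : ℕ} {y δ a v K₂ : ℝ} (hy : 1 ≤ y) (hδ : 0 < δ)
    (ha : a * (2 * m + 2 : ℕ) = δ / 8) (hv : 0 ≤ v) (hK₂ : 0 ≤ K₂) :
    m * (v ^ (m - 1) * ((3 * v + 1) * (m * (y ^ (-δ) + 1 / y ^ (δ / 4)) * 4 ^ (2 * m + 2) *
      (y ^ a) ^ (2 * m + 2)) + v * (y ^ (δ / 4) * (K₂ * y ^ (-(δ / 2)))))) ≤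
    (m * (v ^ (m - 1) * ((3 * v + 1) * (m * 2 * 4 ^ (2 * m + 2)) + v * K₂))) *
      y ^ (-(δ / 8)) := by
  have hy0 : 0 < y := by linarith
  have h1 : (y ^ a) ^ (2 * m + 2) = y ^ (δ / 8) := by
    rw [← Real.rpow_natCast, ← Real.rpow_mul hy0.le, ha]
  have h2 : (y ^ (-δ) + 1 / y ^ (δ / 4)) * y ^ (δ / 8) ≤ 2 * y ^ (-(δ / 8)) := by
    rw [one_div, ← Real.rpow_neg hy0.le, add_mul, ← Real.rpow_add hy0, ← Real.rpow_add hy0, two_mul]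
    refine add_le_add ?_ ?_ <;>
    · refine Real.rpow_le_rpow_of_exponent_le hy ?_
      linarith
  have h3 : y ^ (δ / 4) * (K₂ * y ^ (-(δ / 2))) ≤ K₂ * y ^ (-(δ / 8)) := by
    rw [mul_left_comm, ← Real.rpow_add hy0]
    refine mul_le_mul_of_nonneg_left (Real.rpow_le_rpow_of_exponent_le hy ?_) hK₂
    linarith
  calc _ = m * (v ^ (m - 1) * ((3 * v + 1) * (m * 4 ^ (2 * m + 2) *
        ((y ^ (-δ) + 1 / y ^ (δ / 4)) * y ^ (δ / 8))) +
          v * (y ^ (δ / 4) * (K₂ * y ^ (-(δ / 2)))))) := by rw [h1]; ring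
    _ ≤ m * (v ^ (m - 1) * ((3 * v + 1) * (m * 4 ^ (2 * m + 2) * (2 * y ^ (-(δ / 8)))) +
          v * (K₂ * y ^ (-(δ / 8))))) := by gcongr
    _ = _ := by ring

/-- The deterministic bound is of order `n^m`, while the exceptional probability is `O(n^{-m-1})`,
from Chebyshev's inequality at level `n^{m+2}` and `1/Λ = n^{-(8m+9)}`. -/
theorem exceptional_error_le {m n : ℕ} (hn : 2 ≤ n) {K KH Q v : ℝ} (hQ0 : 0 ≤ Q) (hQ : Q ≤ n)
    (hv : 0 ≤ v) (hK : 0 ≤ K) (hKH : 0 ≤ KH) :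
    (K * (n : ℝ) ^ m + KH * (Q ^ m * v ^ m)) *
      ((n + 1) * (((n : ℝ) ^ (m + 2)) ^ 2)⁻¹ + m * (1 / (n : ℝ) ^ (8 * m + 9))) ≤
    ((K + KH * v ^ m) * (m + 1)) * (n : ℝ) ^ (-(1 : ℝ)) := by
  have hn2 : (2 : ℝ) ≤ n := by exact_mod_cast hn
  have hn0 : (0 : ℝ) < n := by linarith
  have h1 : K * (n : ℝ) ^ m + KH * (Q ^ m * v ^ m) ≤ (K + KH * v ^ m) * (n : ℝ) ^ m := by
    calc K * (n : ℝ) ^ m + KH * (Q ^ m * v ^ m)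
        ≤ K * (n : ℝ) ^ m + KH * ((n : ℝ) ^ m * v ^ m) := by gcongr
      _ = _ := by ring
  have h2 : ((n : ℝ) + 1) * (((n : ℝ) ^ (m + 2)) ^ 2)⁻¹ ≤ ((n : ℝ) ^ (m + 1))⁻¹ := by
    rw [← div_eq_mul_inv, div_le_iff₀ (by positivity), inv_mul_eq_div,
      le_div_iff₀ (by positivity), ← pow_mul]
    calc ((n : ℝ) + 1) * (n : ℝ) ^ (m + 1) ≤ (n : ℝ) ^ 2 * (n : ℝ) ^ (m + 1) := by
          gcongr
          nlinarith
      _ = (n : ℝ) ^ (m + 3) := by ring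
      _ ≤ (n : ℝ) ^ ((m + 2) * 2) := pow_le_pow_right₀ (by linarith) (by omega)
  have h3 : 1 / (n : ℝ) ^ (8 * m + 9) ≤ ((n : ℝ) ^ (m + 1))⁻¹ := by
    rw [one_div]
    exact inv_anti₀ (by positivity) (pow_le_pow_right₀ (by linarith) (by omega))
  calc _ ≤ ((K + KH * v ^ m) * (n : ℝ) ^ m) *
        (((n : ℝ) ^ (m + 1))⁻¹ + m * ((n : ℝ) ^ (m + 1))⁻¹) := by gcongr
    _ = _ := by
        rw [Real.rpow_neg_one]
        field_simp
        ring

/-- Since `‖z‖ ≤ √n + C`, the base is at most `n²` and its power at most `n^{8m+8}`; one more factor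
`n` absorbs the constants. -/
theorem eventually_logMoment_le (m : ℕ) {C : ℝ} (hC : 0 ≤ C) {a : ℝ} (ha1 : a ≤ 1) :
    ∀ᶠ n : ℕ in atTop, ∀ z : ℂ, ‖z‖ ≤ √n + C →
      2 ^ (4 * m + 3) * (((n : ℝ) ^ a + C * ‖z‖) ^ (4 * m + 3 + 1) +
        (n : ℝ) ^ (4 * m + 3 + 1) * (4 * m + 3 + 1 : ℕ) ^ (4 * m + 3 + 1)) * (Real.pi * C ^ 2) +
        n * (2 ^ (4 * m + 3) * (n : ℝ) ^ (4 * m + 3) * (4 * m + 3 + 1 : ℕ) ^ (4 * m + 3 + 1) * C *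
          (2 * Real.pi + Real.pi * (C + 1) ^ 2)) ≤ (n : ℝ) ^ (8 * m + 9) := by
  have hpi := Real.pi_pos
  set w : ℝ := ((4 * m + 3 + 1 : ℕ) : ℝ) ^ (4 * m + 3 + 1) with hw
  have hw0 : 0 ≤ w := by positivity
  clear_value w
  set u : ℝ := 2 * Real.pi + Real.pi * (C + 1) ^ 2 with hu
  have hu0 : 0 ≤ u := by positivity
  clear_value u
  set k : ℝ := 2 ^ (4 * m + 3) * (1 + w) * (Real.pi * C ^ 2) + 2 ^ (4 * m + 3) * w * C * u with hk
  filter_upwards [eventually_ge_atTop 1, tendsto_natCast_atTop_atTop.eventually_ge_atTop k,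
    tendsto_natCast_atTop_atTop.eventually_ge_atTop (1 + C + C ^ 2)] with n hn1 hnk hnC z hz
  have hn1' : (1 : ℝ) ≤ n := by exact_mod_cast hn1
  have hn0 : (0 : ℝ) < n := by linarith
  have hsqrt : √(n : ℝ) ≤ n := by
    rw [Real.sqrt_le_left hn0.le]
    nlinarith
  have h1 : (n : ℝ) ^ a + C * ‖z‖ ≤ (n : ℝ) ^ 2 := by
    have e1 : (n : ℝ) ^ a ≤ n := by
      simpa using Real.rpow_le_rpow_of_exponent_le hn1' ha1
    have e2 : C * ‖z‖ ≤ C * (n + C) := by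
      gcongr
      linarith
    nlinarith [sq_nonneg C]
  have h0 : 0 ≤ (n : ℝ) ^ a + C * ‖z‖ := by positivity
  have h2 : ((n : ℝ) ^ a + C * ‖z‖) ^ (4 * m + 3 + 1) ≤ (n : ℝ) ^ (8 * m + 8) := by
    refine (pow_le_pow_left₀ h0 h1 _).trans (le_of_eq ?_)
    rw [← pow_mul]
    congr 1
    ring
  have h3 : (n : ℝ) ^ (4 * m + 3 + 1) ≤ (n : ℝ) ^ (8 * m + 8) :=
    pow_le_pow_right₀ hn1' (by omega)
  have h4 : (n : ℝ) * (n : ℝ) ^ (4 * m + 3) ≤ (n : ℝ) ^ (8 * m + 8) := by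
    rw [← pow_succ']
    exact h3
  calc 2 ^ (4 * m + 3) * (((n : ℝ) ^ a + C * ‖z‖) ^ (4 * m + 3 + 1) +
        (n : ℝ) ^ (4 * m + 3 + 1) * w) * (Real.pi * C ^ 2) +
        n * (2 ^ (4 * m + 3) * (n : ℝ) ^ (4 * m + 3) * w * C * u)
      = 2 ^ (4 * m + 3) * (((n : ℝ) ^ a + C * ‖z‖) ^ (4 * m + 3 + 1) +
        (n : ℝ) ^ (4 * m + 3 + 1) * w) * (Real.pi * C ^ 2) +
        (n * (n : ℝ) ^ (4 * m + 3)) * (2 ^ (4 * m + 3) * w * C * u) := by ring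
    _ ≤ 2 ^ (4 * m + 3) * ((n : ℝ) ^ (8 * m + 8) + (n : ℝ) ^ (8 * m + 8) * w) *
          (Real.pi * C ^ 2) + (n : ℝ) ^ (8 * m + 8) * (2 ^ (4 * m + 3) * w * C * u) := by gcongr
    _ = k * (n : ℝ) ^ (8 * m + 8) := by rw [hk]; ring
    _ ≤ n * (n : ℝ) ^ (8 * m + 8) := by gcongr
    _ = (n : ℝ) ^ (8 * m + 9) := by ring

/-- For large `n`, root sums are approximated in the mean by their truncations. -/
theorem exists_eventually_truncation_error_le {m : ℕ} (hm : 0 < m) {ε C δ K : ℝ} (hε : 0 < ε)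
    (hC : 0 < C) (hδ : 0 < δ) (hδ1 : δ ≤ 1) (hδε : 2 * δ ≤ ε) (hK0 : 0 ≤ K) :
    ∃ K' : ℝ, ∀ᶠ n : ℕ in atTop, ∀ μ : Measure ℂ, IsNormalizedAtom μ →
      ∫⁻ x, ‖x‖ₑ ^ (2 + ε) ∂μ ≤ ENNReal.ofReal C →
      ∀ z : Fin m → ℂ, (∀ j, (n : ℝ) ^ ε ≤ ‖z j‖ ∧ ‖z j‖ ≤ √n + C) →
      ∀ G : (Fin m → ℂ) → ℂ, ContDiff ℝ (⊤ : ℕ∞) G → (∀ w, G w ≠ 0 → w ∈ closedPolydisc z C) →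
      (∀ w, ‖G w‖ ≤ K) → (∀ w, ‖fullLaplacian G w‖ ≤ K) →
      ‖(∫ a, rootSum G (flatPolynomial n a) ∂(iidMeasure μ (n + 1))) -
          ∫ a, truncSum ((n : ℝ) ^ (-δ)) ((n : ℝ) ^ (m + 5)) z G a ∂(iidMeasure μ (n + 1))‖ ≤
        K' * (n : ℝ) ^ (-(δ / 8)) := by
  obtain ⟨K₂, hK₂, hball⟩ := exists_eventually_smallBall hε hC hδ hδε
  -- Chosen so that `Q = n^a` satisfies `Q^{2m+2} = n^{δ/8}`.
  set a : ℝ := δ / 8 / (2 * m + 2 : ℕ) with ha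
  have hq : (0 : ℝ) < (2 * m + 2 : ℕ) := by positivity
  have ha0 : 0 < a := by positivity
  have haq : a * (2 * m + 2 : ℕ) = δ / 8 := div_mul_cancel₀ _ hq.ne'
  have ha1 : a ≤ 1 := by
    rw [ha, div_le_one hq]
    push_cast
    have : (0 : ℝ) ≤ m := Nat.cast_nonneg m
    linarith
  set v := Real.pi * C ^ 2 with hv
  have hv0 : 0 ≤ v := by have := Real.pi_pos; positivity
  refine ⟨K * (m * (v ^ (m - 1) * ((3 * v + 1) * (m * 2 * 4 ^ (2 * m + 2)) + v * K₂))) +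
    (K + K * v ^ m) * (m + 1), ?_⟩
  filter_upwards [hball, eventually_measure_norm_sum_weylCoeff_le hε hC ha0 ((8 * m + 9 : ℕ) : ℝ),
    eventually_abs_truncLog_le ha0 hδ hδ1 (show 1 ≤ m + 5 by omega),
    eventually_pow_le_exp_rpow ha0 (m + 5), eventually_logMoment_le m hC.le ha1,
    eventually_ge_atTop 2, tendsto_natCast_atTop_atTop.eventually_ge_atTop (2 * Real.exp (C ^ 2)),
    (tendsto_natCast_rpow_atTop hε).eventually_ge_atTop (2 + C)]
    with n hn1 hn2 hn3 hn4 hn5 hn6 hn7 hn8 μ hμ hmom z hz G hG hs hK hKH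
  have hn6' : (2 : ℝ) ≤ n := by exact_mod_cast hn6
  have hn1' : (1 : ℝ) ≤ n := by linarith
  have hn0 : (0 : ℝ) < n := by linarith
  -- On the good event the field is at most `n^{m+4}`. As `√η ≥ 1/n`, the choice `B = n^{m+5}` puts
  -- this below `√η B`, where the truncation at infinity is harmless.
  have hsum : ((n : ℝ) + 1) * ((n : ℝ) ^ (m + 2) * Real.exp (C ^ 2)) ≤ (n : ℝ) ^ (m + 4) := by
    have e1 : ((n : ℝ) + 1) * Real.exp (C ^ 2) ≤ (n : ℝ) ^ 2 := by
      have := Real.exp_pos (C ^ 2)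
      nlinarith
    calc ((n : ℝ) + 1) * ((n : ℝ) ^ (m + 2) * Real.exp (C ^ 2))
        = (n : ℝ) ^ (m + 2) * (((n : ℝ) + 1) * Real.exp (C ^ 2)) := by ring
      _ ≤ (n : ℝ) ^ (m + 2) * (n : ℝ) ^ 2 := by gcongr
      _ = _ := by ring
  have hsqrt : (n : ℝ)⁻¹ ≤ √((n : ℝ) ^ (-δ)) := by
    refine Real.le_sqrt_of_sq_le ?_
    rw [← Real.rpow_neg_one, ← Real.rpow_natCast, ← Real.rpow_mul hn0.le]
    refine Real.rpow_le_rpow_of_exponent_le hn1' ?_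
    push_cast
    linarith
  have hB1 : (n : ℝ) ^ (m + 4) ≤ √((n : ℝ) ^ (-δ)) * (n : ℝ) ^ (m + 5) := by
    calc (n : ℝ) ^ (m + 4) = (n : ℝ)⁻¹ * (n : ℝ) ^ (m + 5) := by
          rw [pow_succ (n : ℝ) (m + 4)]
          field_simp
      _ ≤ _ := by gcongr
  have hB2 : (n : ℝ) ^ (m + 4) ≤ Real.exp ((n : ℝ) ^ a) :=
    (pow_le_pow_right₀ hn1' (by omega)).trans hn4
  have hmain := norm_integral_rootSum_sub_truncSum_iid_le (n := n) (η := (n : ℝ) ^ (-δ))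
    (B := (n : ℝ) ^ (m + 5)) (R := C) (Q := (n : ℝ) ^ a) (l := (n : ℝ) ^ (δ / 4))
    (Λ := (n : ℝ) ^ (8 * m + 9)) (θ := K₂ * (n : ℝ) ^ (-(δ / 2))) (A := (n : ℝ) ^ (m + 2)) hμ hm hG
    hC.le hs hK hKH hn3 (by positivity) (by positivity) (by positivity) (by positivity)
    (Real.one_le_rpow hn1' ha0.le) (by positivity) (by positivity)
    (fun j => hn8.trans (hz j).1) (hsum.trans hB1) (hsum.trans hB2) (fun j => hn5 (z j) (hz j).2)
    (fun j x hx => by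
      have := hn2 μ hμ hmom (z j) x (hz j).1 (hz j).2 hx
      rw [Real.rpow_neg hn0.le, Real.rpow_natCast, ← one_div] at this
      exact this)
    (fun j x hx => hn1 μ hμ hmom (z j) x (hz j).1 (hz j).2 hx)
  have hQn : (n : ℝ) ^ a ≤ n := by simpa using Real.rpow_le_rpow_of_exponent_le hn1' ha1
  have e1 := truncation_error_le (m := m) (K₂ := K₂) hn1' hδ haq hv0 hK₂.le
  have e2 := exceptional_error_le (m := m) (K := K) (KH := K) hn6 (by positivity) hQn hv0 hK0 hK0
  have e3 : (n : ℝ) ^ (-(1 : ℝ)) ≤ (n : ℝ) ^ (-(δ / 8)) :=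
    Real.rpow_le_rpow_of_exponent_le hn1' (by linarith)
  refine hmain.trans ?_
  refine (add_le_add (mul_le_mul_of_nonneg_left e1 hK0)
    (e2.trans (mul_le_mul_of_nonneg_left e3 (by positivity)))).trans (le_of_eq ?_)
  ring

end Asymptotics

section Exchange

open Filter Topology

/-- The powers `y^δ` from the sup bound, `y^{3δ}` from the Taylor scale `η⁻¹` and `y^{-εe/2} =
y^{-8δ}` from the coefficients combine to `y^{-4δ}`. The relation between `δ` and `ε` comes from
here. -/
theorem exchange_error_le {m : ℕ} {y ε e δ a S M : ℝ} (hy : 1 ≤ y) (he1 : e ≤ 1)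
    (hδ : 0 < δ) (hδε : 16 * δ = ε * e) (ha : a * m ≤ δ) (hS : 1 ≤ S) (hM : 0 ≤ M) :
    2 * M * (7 * y ^ a) ^ m * ((y ^ (-δ))⁻¹) ^ (2 + e) *
      (m * S * √(2 * S * y ^ (-ε)) ^ (2 + e - 2)) ≤
    (2 * M * 7 ^ m * (m * S * (2 * S))) * y ^ (-(δ / 8)) := by
  have hy0 : 0 < y := by linarith
  have h1 : (y ^ a) ^ m ≤ y ^ δ := by
    rw [← Real.rpow_natCast, ← Real.rpow_mul hy0.le]
    exact Real.rpow_le_rpow_of_exponent_le hy ha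
  have h2 : ((y ^ (-δ))⁻¹) ^ (2 + e) ≤ y ^ (3 * δ) := by
    rw [← Real.rpow_neg hy0.le, neg_neg, ← Real.rpow_mul hy0.le]
    refine Real.rpow_le_rpow_of_exponent_le hy ?_
    nlinarith
  have h3 : √(2 * S * y ^ (-ε)) ^ (2 + e - 2) ≤ 2 * S * y ^ (-(8 * δ)) := by
    rw [Real.sqrt_eq_rpow, ← Real.rpow_mul (by positivity),
      Real.mul_rpow (by positivity) (by positivity), ← Real.rpow_mul hy0.le]
    have e1 : (2 * S) ^ (1 / 2 * (2 + e - 2)) ≤ 2 * S := by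
      refine (Real.rpow_le_rpow_of_exponent_le (by linarith)
        (show 1 / 2 * (2 + e - 2) ≤ 1 by linarith)).trans (le_of_eq (Real.rpow_one _))
    have e2 : -ε * (1 / 2 * (2 + e - 2)) = -(8 * δ) := by linarith
    rw [e2]
    gcongr
  calc 2 * M * (7 * y ^ a) ^ m * ((y ^ (-δ))⁻¹) ^ (2 + e) *
        (m * S * √(2 * S * y ^ (-ε)) ^ (2 + e - 2))
      = 2 * M * 7 ^ m * (m * S) * ((y ^ a) ^ m * ((y ^ (-δ))⁻¹) ^ (2 + e) *
        √(2 * S * y ^ (-ε)) ^ (2 + e - 2)) := by rw [mul_pow]; ring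
    _ ≤ 2 * M * 7 ^ m * (m * S) * (y ^ δ * y ^ (3 * δ) * (2 * S * y ^ (-(8 * δ)))) := by gcongr
    _ = (2 * M * 7 ^ m * (m * S * (2 * S))) * y ^ (-(4 * δ)) := by
        have : y ^ (-(4 * δ)) = y ^ δ * y ^ (3 * δ) * y ^ (-(8 * δ)) := by
          rw [← Real.rpow_add hy0, ← Real.rpow_add hy0]
          congr 1
          ring
        rw [this]
        ring
    _ ≤ _ := by
        refine mul_le_mul_of_nonneg_left (Real.rpow_le_rpow_of_exponent_le hy ?_) (by positivity)
        linarith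

/-- For large `n`, truncated root sums depend little on the law of the coefficients. -/
theorem exists_eventually_exchange_error_le (m : ℕ) {ε C δ K : ℝ} (hε : 0 < ε) (hC : 0 < C)
    (hδ : 0 < δ) (hδ1 : δ ≤ 1) (hδε : 16 * δ = ε * min ε 1) :
    ∃ K' : ℝ, ∀ᶠ n : ℕ in atTop, ∀ μ ν : Measure ℂ, IsNormalizedAtom μ → IsNormalizedAtom ν →
      MatchMoments 2 μ ν →
      ∫⁻ x, ‖x‖ₑ ^ (2 + ε) ∂μ ≤ ENNReal.ofReal C → ∫⁻ x, ‖x‖ₑ ^ (2 + ε) ∂ν ≤ ENNReal.ofReal C →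
      ∀ z : Fin m → ℂ, (∀ j, (n : ℝ) ^ ε ≤ ‖z j‖ ∧ ‖z j‖ ≤ √n + C) →
      ∀ G : (Fin m → ℂ) → ℂ, ContDiff ℝ (⊤ : ℕ∞) G → (∀ w, G w ≠ 0 → w ∈ closedPolydisc z C) →
      (∀ w, ‖fullLaplacian G w‖ ≤ K) →
      ‖(∫ a, truncSum ((n : ℝ) ^ (-δ)) ((n : ℝ) ^ (m + 5)) z G a ∂(iidMeasure μ (n + 1))) -
          ∫ a, truncSum ((n : ℝ) ^ (-δ)) ((n : ℝ) ^ (m + 5)) z G a ∂(iidMeasure ν (n + 1))‖ ≤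
        K' * (n : ℝ) ^ (-(δ / 8)) := by
  set e := min ε 1 with he
  have he0 : 0 < e := by positivity
  have heε : e ≤ ε := min_le_left _ _
  have he1 : e ≤ 1 := min_le_right _ _
  set a : ℝ := δ / (m + 1) with ha
  have ha0 : 0 < a := by positivity
  have ham : a * m ≤ δ := by
    rw [ha, div_mul_eq_mul_div, div_le_iff₀ (by positivity)]
    nlinarith
  set S := Real.exp (C ^ 2) with hS
  have hS1 : 1 ≤ S := Real.one_le_exp (sq_nonneg C)
  refine ⟨K * ((2 * (1 + C) * 7 ^ m * (m * S * (2 * S))) * (Real.pi * C ^ 2) ^ m), ?_⟩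
  filter_upwards [eventually_abs_truncLog_le ha0 hδ hδ1 (show 1 ≤ m + 5 by omega),
    eventually_ge_atTop 1, (tendsto_natCast_rpow_atTop hε).eventually_ge_atTop (2 + C),
    (tendsto_natCast_rpow_atTop hε).eventually_ge_atTop (2 * C),
    (tendsto_natCast_rpow_atTop ha0).eventually_ge_atTop 72]
    with n htr hn1 hn2 hn3 hn4 μ ν hμ hν hmatch hμm hνm z hz G hG hs hK
  have := hμ.isProbabilityMeasure
  have := hν.isProbabilityMeasure
  have hK0 : 0 ≤ K := (norm_nonneg _).trans (hK 0)
  have hpi := Real.pi_pos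
  have hn1' : (1 : ℝ) ≤ n := by exact_mod_cast hn1
  have hn0 : (0 : ℝ) < n := by linarith
  obtain ⟨iμ, bμ⟩ := moment_le hε.le hC.le (show 0 ≤ 2 + e by linarith) (by linarith) hμm
  obtain ⟨iν, bν⟩ := moment_le hε.le hC.le (show 0 ≤ 2 + e by linarith) (by linarith) hνm
  have hη : 0 < (n : ℝ) ^ (-δ) := by positivity
  have hηB : (n : ℝ) ^ (-δ) ≤ (n : ℝ) ^ (m + 5) :=
    (Real.rpow_le_one_of_one_le_of_nonpos hn1' (by linarith)).trans (one_le_pow₀ hn1')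
  have herr := exchange_error_le (m := m) (M := 1 + C) hn1' he1 hδ hδε ham hS1 (by linarith)
  have hmain := norm_integral_truncSum_sub_le (P := iidMeasure μ (n + 1))
    (P' := iidMeasure ν (n + 1)) (L := (2 * (1 + C) * 7 ^ m * (m * S * (2 * S))) *
      (n : ℝ) ^ (-(δ / 8))) hG hC.le hs hK htr (by positivity) (fun x hx => ?_)
  · refine hmain.trans (le_of_eq ?_)
    ring
  · rw [mem_closedPolydisc] at hx
    have hxz : ∀ j, ‖z j‖ ≤ ‖x j‖ + C := by
      intro j
      have h1 := norm_sub_norm_le (z j) (x j)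
      rw [norm_sub_rev] at h1
      have := hx j
      linarith
    refine (abs_integral_prod_truncLog_sub_le (M := 1 + C) (β := √(2 * S * (n : ℝ) ^ (-ε)))
      (s := S) (by linarith) (by linarith) hη hηB hn4 htr hμ hν hmatch iμ iν (by linarith) bμ bν
      (Real.sqrt_nonneg _) (fun j i => ?_)
      fun j => sum_norm_weylCoeff_sq_le (hx j) (n + 1)).trans herr
    refine Real.le_sqrt_of_sq_le ?_
    have h1 := hxz j
    have h2 := (hz j).1
    refine (norm_weylCoeff_sq_le (hx j) (by linarith) i).trans ?_
    rw [Real.rpow_neg hn0.le, ← div_eq_mul_inv, div_le_div_iff₀ (by linarith) (by positivity)]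
    nlinarith

/-- For large `n`, the mean of root sums depends little on the law of the coefficients. -/
theorem exists_eventually_rootSum_comparison {m : ℕ} (hm : 0 < m) {ε C δ K : ℝ} (hε : 0 < ε)
    (hC : 0 < C) (hδ : 0 < δ) (hδ1 : δ ≤ 1) (hδε : 16 * δ = ε * min ε 1) (hK0 : 0 ≤ K) :
    ∃ K' : ℝ, ∀ᶠ n : ℕ in atTop, ∀ μ ν : Measure ℂ, IsNormalizedAtom μ → IsNormalizedAtom ν →
      MatchMoments 2 μ ν →
      ∫⁻ x, ‖x‖ₑ ^ (2 + ε) ∂μ ≤ ENNReal.ofReal C → ∫⁻ x, ‖x‖ₑ ^ (2 + ε) ∂ν ≤ ENNReal.ofReal C →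
      ∀ z : Fin m → ℂ, (∀ j, (n : ℝ) ^ ε ≤ ‖z j‖ ∧ ‖z j‖ ≤ √n + C) →
      ∀ G : (Fin m → ℂ) → ℂ, ContDiff ℝ (⊤ : ℕ∞) G → (∀ w, G w ≠ 0 → w ∈ closedPolydisc z C) →
      (∀ w, ‖G w‖ ≤ K) → (∀ w, ‖fullLaplacian G w‖ ≤ K) →
      ‖(∫ a, rootSum G (flatPolynomial n a) ∂(iidMeasure μ (n + 1))) -
          ∫ a, rootSum G (flatPolynomial n a) ∂(iidMeasure ν (n + 1))‖ ≤
        K' * (n : ℝ) ^ (-(δ / 8)) := by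
  have hδε2 : 2 * δ ≤ ε := by nlinarith [min_le_right ε 1]
  obtain ⟨K₁, h1⟩ := exists_eventually_truncation_error_le hm hε hC hδ hδ1 hδε2 hK0
  obtain ⟨K₂, h2⟩ := exists_eventually_exchange_error_le m (K := K) hε hC hδ hδ1 hδε
  refine ⟨K₁ + K₂ + K₁, ?_⟩
  filter_upwards [h1, h2] with n h1 h2 μ ν hμ hν hmatch hμm hνm z hz G hG hs hK hKH
  have e1 := h1 μ hμ hμm z hz G hG hs hK hKH
  have e2 := h2 μ ν hμ hν hmatch hμm hνm z hz G hG hs hKH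
  have e3 := h1 ν hν hνm z hz G hG hs hK hKH
  rw [norm_sub_rev] at e3
  rw [← sub_add_sub_cancel _
    (∫ a, truncSum ((n : ℝ) ^ (-δ)) ((n : ℝ) ^ (m + 5)) z G a ∂(iidMeasure ν (n + 1))) _,
    ← sub_add_sub_cancel _
    (∫ a, truncSum ((n : ℝ) ^ (-δ)) ((n : ℝ) ^ (m + 5)) z G a ∂(iidMeasure μ (n + 1)))
    (∫ a, truncSum ((n : ℝ) ^ (-δ)) ((n : ℝ) ^ (m + 5)) z G a ∂(iidMeasure ν (n + 1)))]
  refine (norm_add₃_le).trans ?_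
  rw [add_mul, add_mul]
  exact add_le_add (add_le_add e1 e2) e3

end Exchange

/-! ### All `n`, and tuples of distinct zeroes. -/

section Comparison

/-- The comparison of root sums, for all `n`. -/
theorem exists_rootSum_comparison {m : ℕ} (hm : 0 < m) {ε C δ K : ℝ} (hε : 0 < ε)
    (hC : 0 < C) (hδ : 0 < δ) (hδ1 : δ ≤ 1) (hδε : 16 * δ = ε * min ε 1) (hK0 : 0 ≤ K) :
    ∃ K' : ℝ, ∀ n : ℕ, 1 ≤ n → ∀ μ ν : Measure ℂ, IsNormalizedAtom μ → IsNormalizedAtom ν →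
      MatchMoments 2 μ ν →
      ∫⁻ x, ‖x‖ₑ ^ (2 + ε) ∂μ ≤ ENNReal.ofReal C → ∫⁻ x, ‖x‖ₑ ^ (2 + ε) ∂ν ≤ ENNReal.ofReal C →
      ∀ z : Fin m → ℂ, (∀ j, (n : ℝ) ^ ε ≤ ‖z j‖ ∧ ‖z j‖ ≤ √n + C) →
      ∀ G : (Fin m → ℂ) → ℂ, ContDiff ℝ (⊤ : ℕ∞) G → (∀ w, G w ≠ 0 → w ∈ closedPolydisc z C) →
      (∀ w, ‖G w‖ ≤ K) → (∀ w, ‖fullLaplacian G w‖ ≤ K) →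
      ‖(∫ a, rootSum G (flatPolynomial n a) ∂(iidMeasure μ (n + 1))) -
          ∫ a, rootSum G (flatPolynomial n a) ∂(iidMeasure ν (n + 1))‖ ≤
        K' * (n : ℝ) ^ (-(δ / 8)) := by
  obtain ⟨K₁, h⟩ := exists_eventually_rootSum_comparison hm hε hC hδ hδ1 hδε hK0
  obtain ⟨N, hN⟩ := Filter.eventually_atTop.1 h
  refine ⟨|K₁| + 2 * (K * (N : ℝ) ^ m) * (N : ℝ) ^ (δ / 8),
    fun n hn1 μ ν hμ hν hmatch hμm hνm z hz G hG hs hK hKH => ?_⟩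
  have := hμ.isProbabilityMeasure
  have := hν.isProbabilityMeasure
  have hn0 : (0 : ℝ) < n := by exact_mod_cast hn1
  have hpow : 0 < (n : ℝ) ^ (-(δ / 8)) := by positivity
  rcases le_or_gt N n with hNn | hNn
  · refine (hN n hNn μ ν hμ hν hmatch hμm hνm z hz G hG hs hK hKH).trans ?_
    refine mul_le_mul_of_nonneg_right ?_ hpow.le
    have h1 := le_abs_self K₁
    have h2 : 0 ≤ 2 * (K * (N : ℝ) ^ m) * (N : ℝ) ^ (δ / 8) := by positivity
    linarith
  -- For the finitely many small `n` the trivial bound by the number of zeroes is absorbed in the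
  -- constant.
  · have hnN : (n : ℝ) ≤ N := by exact_mod_cast hNn.le
    have hb : ∀ P : Measure (Fin (n + 1) → ℂ), IsProbabilityMeasure P →
        ‖∫ a, rootSum G (flatPolynomial n a) ∂P‖ ≤ K * (N : ℝ) ^ m := by
      intro P _
      refine (norm_integral_le_of_norm_le_const (C := K * (n : ℝ) ^ m) (Filter.Eventually.of_forall
        fun a => norm_rootSum_le hK (natDegree_flatPolynomial_le n a))).trans ?_
      simp only [probReal_univ, mul_one]
      gcongr
    have h1 : 1 ≤ (N : ℝ) ^ (δ / 8) * (n : ℝ) ^ (-(δ / 8)) := by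
      rw [Real.rpow_neg hn0.le, ← div_eq_mul_inv, le_div_iff₀ (by positivity), one_mul]
      gcongr
    refine (norm_sub_le _ _).trans ((add_le_add (hb _ inferInstance) (hb _ inferInstance)).trans ?_)
    have h2 : 0 ≤ 2 * (K * (N : ℝ) ^ m) := by positivity
    have h3 := mul_le_mul_of_nonneg_left h1 h2
    have h4 : 0 ≤ |K₁| * (n : ℝ) ^ (-(δ / 8)) := by positivity
    rw [add_mul]
    linarith

/-- The pullback of functions on `ℂ^m` along a map of index sets. -/
def reindexCLM {m d : ℕ} (q : Fin m → Fin d) : (Fin d → ℂ) →L[ℝ] (Fin m → ℂ) :=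
  ContinuousLinearMap.pi fun j => ContinuousLinearMap.proj (q j)

theorem norm_reindexCLM_le {m d : ℕ} (q : Fin m → Fin d) : ‖reindexCLM q‖ ≤ 1 := by
  refine ContinuousLinearMap.opNorm_le_bound _ zero_le_one fun w => ?_
  rw [one_mul, pi_norm_le_iff_of_nonneg (norm_nonneg w)]
  exact fun j => norm_le_pi_norm w (q j)

/-- Identifying variables is a linear map of norm at most one for the sup norm, so it does not
increase derivatives. -/
theorem norm_iteratedFDeriv_reindex_le {m d : ℕ} (q : Fin m → Fin d) {G : (Fin m → ℂ) → ℂ}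
    (hG : ContDiff ℝ (⊤ : ℕ∞) G) (a : ℕ) (w : Fin d → ℂ) :
    ‖iteratedFDeriv ℝ a (fun w : Fin d → ℂ => G fun j => w (q j)) w‖ ≤
      ‖iteratedFDeriv ℝ a G fun j => w (q j)‖ := by
  have h := (reindexCLM q).iteratedFDeriv_comp_right hG w (i := a) (by exact_mod_cast le_top)
  have e : (fun w : Fin d → ℂ => G fun j => w (q j)) = G ∘ reindexCLM q := rfl
  rw [e, h]
  refine (ContinuousMultilinearMap.norm_compContinuousLinearMap_le _ _).trans ?_
  refine mul_le_of_le_one_right (norm_nonneg _) ?_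
  exact Finset.prod_le_one (fun _ _ => norm_nonneg _) fun _ _ => norm_reindexCLM_le q

/-- The mean of sums over tuples of zeroes with distinct indices depends little on the law of the
coefficients. -/
theorem exists_distinctRootSum_comparison {ε C δ K : ℝ} (hε : 0 < ε)
    (hC : 0 < C) (hδ : 0 < δ) (hδ1 : δ ≤ 1) (hδε : 16 * δ = ε * min ε 1) (hK0 : 0 ≤ K) (m : ℕ)
    (hm : 0 < m) :
    ∃ K' : ℝ, ∀ n : ℕ, 1 ≤ n → ∀ μ ν : Measure ℂ, IsNormalizedAtom μ → IsNormalizedAtom ν →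
      MatchMoments 2 μ ν →
      ∫⁻ x, ‖x‖ₑ ^ (2 + ε) ∂μ ≤ ENNReal.ofReal C → ∫⁻ x, ‖x‖ₑ ^ (2 + ε) ∂ν ≤ ENNReal.ofReal C →
      ∀ z : Fin m → ℂ, (∀ j, (n : ℝ) ^ ε ≤ ‖z j‖ ∧ ‖z j‖ ≤ √n + C) →
      ∀ G : (Fin m → ℂ) → ℂ, ContDiff ℝ (⊤ : ℕ∞) G → (∀ w, G w ≠ 0 → w ∈ closedPolydisc z C) →
      (∀ a : ℕ, a ≤ 2 * m → ∀ w, ‖iteratedFDeriv ℝ a G w‖ ≤ K) →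
      ‖(∫ a, distinctRootSum G (flatPolynomial n a) ∂(iidMeasure μ (n + 1))) -
          ∫ a, distinctRootSum G (flatPolynomial n a) ∂(iidMeasure ν (n + 1))‖ ≤
        K' * (n : ℝ) ^ (-(δ / 8)) := by
  induction m using Nat.strong_induction_on with
  -- The distinct sum is the full sum minus distinct sums in fewer variables, to which the induction
  -- hypothesis applies with the same `K` and `C`.
  | _ m ih =>
  obtain ⟨K₁, h1⟩ := exists_rootSum_comparison hm hε hC hδ hδ1 hδε
    (show 0 ≤ 2 ^ m * K by positivity)
  obtain ⟨S, _, d, q, hd, hq, hdec⟩ := exists_rootSum_eq_distinctRootSum_add m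
  have hd0 : ∀ s, 0 < d s := fun s => Fin.pos (q s ⟨0, hm⟩)
  choose K₂ h2 using fun s => ih (d s) (hd s) (hd0 s)
  refine ⟨K₁ + ∑ s, K₂ s, fun n hn1 μ ν hμ hν hmatch hμm hνm z hz G hG hs hder => ?_⟩
  have := hμ.isProbabilityMeasure
  have := hν.isProbabilityMeasure
  have hGK : ∀ w, ‖G w‖ ≤ K := fun w => by
    have := hder 0 (Nat.zero_le _) w
    rwa [norm_iteratedFDeriv_zero] at this
  have hKle : K ≤ 2 ^ m * K := le_mul_of_one_le_left hK0 (one_le_pow₀ (by norm_num))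
  have e1 := h1 n hn1 μ ν hμ hν hmatch hμm hνm z hz G hG hs (fun w => (hGK w).trans hKle)
    (fun w => (norm_fullLaplacian_le hG w).trans (by gcongr; exact hder _ le_rfl w))
  have e2 : ∀ s, _ := fun s => by
    -- Each class of identified variables gets the reference point of one chosen member; the support
    -- condition for that member localizes the class.
    choose σ hσ using hq s
    refine h2 s n hn1 μ ν hμ hν hmatch hμm hνm (fun i => z (σ i)) (fun i => hz (σ i))
      (fun w : Fin (d s) → ℂ => G fun j => w (q s j)) (hG.comp (reindexCLM (q s)).contDiff)
      (fun w hw => ?_) (fun a ha w => ?_)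
    · rw [mem_closedPolydisc]
      intro i
      have := mem_closedPolydisc.1 (hs _ hw) (σ i)
      rwa [hσ i] at this
    · exact (norm_iteratedFDeriv_reindex_le (q s) hG a w).trans
        (hder a (by have := hd s; omega) _)
  have hint : ∀ (P : Measure (Fin (n + 1) → ℂ)) [IsProbabilityMeasure P],
      ∫ a, rootSum G (flatPolynomial n a) ∂P = ∫ a, distinctRootSum G (flatPolynomial n a) ∂P +
        ∑ s, ∫ a, distinctRootSum (fun w : Fin (d s) → ℂ => G fun j => w (q s j))
          (flatPolynomial n a) ∂P := by
    intro P _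
    have hi : ∀ {r : ℕ} (H : (Fin r → ℂ) → ℂ), Continuous H → (∀ w, ‖H w‖ ≤ K) →
        Integrable (fun a => distinctRootSum H (flatPolynomial n a)) P := fun H hH hHK =>
      Integrable.of_bound (stronglyMeasurable_distinctRootSum n hH).aestronglyMeasurable _
        (Filter.Eventually.of_forall fun a =>
          norm_distinctRootSum_le hHK (natDegree_flatPolynomial_le n a))
    have hi2 : ∀ s, Integrable (fun a => distinctRootSum
        (fun w : Fin (d s) → ℂ => G fun j => w (q s j)) (flatPolynomial n a)) P := fun s =>
      hi _ (hG.continuous.comp (reindexCLM (q s)).continuous) fun w => hGK _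
    simp only [hdec]
    rw [integral_add (hi G hG.continuous hGK) (integrable_finsetSum _ fun s _ => hi2 s),
      integral_finsetSum _ fun s _ => hi2 s]
  rw [hint, hint] at e1
  rw [add_mul, Finset.sum_mul]
  have e3 : ∀ x y X Y : ℂ, x - y = (x + X - (y + Y)) - (X - Y) := fun x y X Y => by ring
  rw [e3 _ _ (∑ s, ∫ a, distinctRootSum (fun w : Fin (d s) → ℂ => G fun j => w (q s j))
    (flatPolynomial n a) ∂(iidMeasure μ (n + 1)))
    (∑ s, ∫ a, distinctRootSum (fun w : Fin (d s) → ℂ => G fun j => w (q s j))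
    (flatPolynomial n a) ∂(iidMeasure ν (n + 1)))]
  refine (norm_sub_le _ _).trans (add_le_add e1 ?_)
  rw [← Finset.sum_sub_distrib]
  exact norm_sum_le_of_le _ fun s _ => e2 s

end Comparison

/-! ### Passage to gradients, correlation measures and arbitrary probability spaces. -/

section Statement

/-- Each argument is expanded in the real basis, with coordinates bounded by its sup norm. The
cardinality counts the terms of the multilinear expansion. -/
theorem norm_iteratedFDeriv_le_gradNorm {k : ℕ} (a : ℕ) (G : (Fin k → ℂ) → ℂ) (w : Fin k → ℂ) :
    ‖iteratedFDeriv ℝ a G w‖ ≤ Fintype.card (Fin a → Fin k × Fin 2) * gradNorm a G w := by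
  have hg : 0 ≤ gradNorm a G w := Real.sqrt_nonneg _
  refine ContinuousMultilinearMap.opNorm_le_bound (by positivity) fun v => ?_
  let g : Fin a → Fin k × Fin 2 → ℝ := fun l p => if p.2 = 0 then (v l p.1).re else (v l p.1).im
  have hv : v = fun l => ∑ p, g l p • (realBasisVec p : Fin k → ℂ) := by
    funext l i
    rw [Fintype.sum_prod_type, Finset.sum_apply, Finset.sum_eq_single i]
    · simp only [Fin.sum_univ_two, g, realBasisVec, Pi.add_apply, Pi.smul_apply,
        Pi.single_eq_same]
      simp [Complex.re_add_im]
    · intro j _ hj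
      simp [realBasisVec, hj.symm]
    · simp
  have hgv : ∀ l p, |g l p| ≤ ‖v l‖ := by
    intro l p
    refine le_trans ?_ (norm_le_pi_norm (v l) p.1)
    simp only [g]
    split_ifs
    · exact Complex.abs_re_le_norm _
    · exact Complex.abs_im_le_norm _
  have hterm : ∀ s : Fin a → Fin k × Fin 2,
      ‖iteratedFDeriv ℝ a G w fun l => realBasisVec (s l)‖ ≤ gradNorm a G w := by
    intro s
    refine Real.le_sqrt_of_sq_le ?_
    exact Finset.single_le_sum
      (f := fun s : Fin a → Fin k × Fin 2 => ‖iteratedFDeriv ℝ a G w fun l => realBasisVec (s l)‖ ^ 2)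
      (fun _ _ => sq_nonneg _) (Finset.mem_univ s)
  have hexp : iteratedFDeriv ℝ a G w v = ∑ s : Fin a → Fin k × Fin 2,
      (∏ l, g l (s l)) • iteratedFDeriv ℝ a G w fun l => realBasisVec (s l) := by
    conv_lhs => rw [hv]
    rw [ContinuousMultilinearMap.map_sum]
    refine Finset.sum_congr rfl fun s _ => ?_
    rw [ContinuousMultilinearMap.map_smul_univ]
  rw [hexp]
  refine (norm_sum_le_of_le (n := fun _ => (∏ l, ‖v l‖) * gradNorm a G w) _
    fun s _ => ?_).trans ?_
  · rw [norm_smul, Real.norm_eq_abs, Finset.abs_prod]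
    refine mul_le_mul ?_ (hterm s) (norm_nonneg _) (Finset.prod_nonneg fun _ _ => norm_nonneg _)
    exact Finset.prod_le_prod (fun _ _ => abs_nonneg _) fun l _ => hgv l (s l)
  · rw [Finset.sum_const, Finset.card_univ, nsmul_eq_mul]
    exact le_of_eq (by ring)

/-- Allows `ε` to be decreased at the price of adding one to the moment bound. -/
theorem lintegral_rpow_le_add_one {μ : Measure ℂ} [IsProbabilityMeasure μ] {p q C : ℝ}
    (hp : 0 ≤ p) (hpq : p ≤ q) (hC : 0 ≤ C)
    (h : ∫⁻ x : ℂ, ‖x‖ₑ ^ q ∂μ ≤ ENNReal.ofReal C) :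
    ∫⁻ x : ℂ, ‖x‖ₑ ^ p ∂μ ≤ ENNReal.ofReal (C + 1) := by
  have hle : ∀ x : ℂ, ‖x‖ₑ ^ p ≤ ‖x‖ₑ ^ q + 1 := by
    intro x
    rcases le_total ‖x‖ₑ 1 with hx | hx
    · exact (ENNReal.rpow_le_one hx hp).trans le_add_self
    · exact (ENNReal.rpow_le_rpow_of_exponent_le hx hpq).trans le_self_add
  calc ∫⁻ x : ℂ, ‖x‖ₑ ^ p ∂μ ≤ ∫⁻ x : ℂ, (‖x‖ₑ ^ q + 1) ∂μ := lintegral_mono hle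
    _ = ∫⁻ x : ℂ, ‖x‖ₑ ^ q ∂μ + 1 := by
        rw [lintegral_add_right _ measurable_const]
        simp
    _ ≤ _ := by
        rw [ENNReal.ofReal_add hC zero_le_one, ENNReal.ofReal_one]
        gcongr

theorem integral_correlationMeasure_flatPolynomial {Ω : Type*} [MeasurableSpace Ω] {P : Measure Ω}
    [IsProbabilityMeasure P] {n k : ℕ} {ξ : Fin (n + 1) → Ω → ℂ} {μ : Measure ℂ}
    [IsProbabilityMeasure μ]
    (h : IsIIDWithLaw P ξ μ) {φ : (Fin k → ℂ) → ℂ} (hφ : Continuous φ)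
    (hφ' : HasCompactSupport φ) :
    ∫ x, φ x ∂(correlationMeasure P k fun ω => flatPolynomial n fun i => ξ i ω) =
      ∫ a, distinctRootSum φ (flatPolynomial n a) ∂(iidMeasure μ (n + 1)) := by
  have hlaw := h.indep.hasLaw_pi h.hasLaw
  have hae : AEMeasurable (fun ω i => ξ i ω) P := hlaw.aemeasurable
  rw [integral_correlationMeasure P n k _ (fun ω => natDegree_flatPolynomial_le n _) (fun i => ?_)
    φ hφ hφ', iidMeasure, ← hlaw.map_eq, integral_map hae
    (stronglyMeasurable_distinctRootSum n hφ).aestronglyMeasurable]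
  · rfl
  · have hc : (fun ω => (flatPolynomial n fun i => ξ i ω).coeff i) =
        fun ω => flatCoeff n i * ξ i ω := by
      funext ω
      simp only [flatPolynomial, coeffPolynomial, Polynomial.finsetSum_coeff,
        Polynomial.coeff_C_mul, Polynomial.coeff_X_pow]
      rw [Finset.sum_eq_single i]
      · simp
      · intro b _ hb
        have : (i : ℕ) ≠ b := fun h => hb (Fin.ext h.symm)
        simp [this]
      · simp
    rw [hc]
    exact ((h.hasLaw i).aemeasurable).const_mul _

end Statement

end

theorem theorem5p1 (ε : ℝ) (hε : 0 < ε) :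
    ∃ c₀ : ℝ, 0 < c₀ ∧
      ∀ (k : ℕ), 1 ≤ k → ∀ (C : ℝ), 0 < C →
        ∃ C' : ℝ,
          ∀ (n : ℕ), 1 ≤ n →
          -- the two atom distributions
          ∀ (μ ν : Measure ℂ), IsNormalizedAtom μ → IsNormalizedAtom ν →
            MatchMoments 2 μ ν →
            ∫⁻ x, ‖x‖ₑ ^ (2 + ε) ∂μ ≤ ENNReal.ofReal C →
            ∫⁻ x, ‖x‖ₑ ^ (2 + ε) ∂ν ≤ ENNReal.ofReal C →
          -- the two families of independent copies, on possibly different probability spaces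
          ∀ (Ω : Type*) [MeasurableSpace Ω] (P : Measure Ω) [IsProbabilityMeasure P]
            (Ω' : Type*) [MeasurableSpace Ω'] (P' : Measure Ω') [IsProbabilityMeasure P']
            (ξ : Fin (n + 1) → Ω → ℂ) (ξ' : Fin (n + 1) → Ω' → ℂ),
            IsIIDWithLaw P ξ μ → IsIIDWithLaw P' ξ' ν →
          -- the reference points
          ∀ z : Fin k → ℂ,
            (∀ j, (n : ℝ) ^ ε ≤ ‖z j‖ ∧ ‖z j‖ ≤ Real.sqrt n + C) →
          -- the test function
          ∀ G : (Fin k → ℂ) → ℂ, ContDiff ℝ (⊤ : ℕ∞) G →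
            (∀ w, G w ≠ 0 → ∀ j, ‖w j‖ < C) →
            (∀ a : ℕ, a ≤ 5 * k + 1 → ∀ w, gradNorm a G w ≤ C) →
            ‖(∫ x, G (fun j => x j - z j)
                ∂(correlationMeasure P k fun ω => flatPolynomial n fun i => ξ i ω)) -
              ∫ x, G (fun j => x j - z j)
                ∂(correlationMeasure P' k fun ω => flatPolynomial n fun i => ξ' i ω)‖
              ≤ C' * (n : ℝ) ^ (-c₀) := by
  -- The exponent may be decreased: since `n ≥ 1`, the condition `n^ε ≤ ‖z j‖` becomes weaker, and
  -- moments of lower order remain bounded. It makes `δ ≤ 1`, and `δ` depends on `ε` only.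
  set ε' : ℝ := min ε 1 with hε'
  have hε'0 : 0 < ε' := lt_min hε one_pos
  have hε'1 : ε' ≤ 1 := min_le_right _ _
  have hε'ε : ε' ≤ ε := min_le_left _ _
  set δ : ℝ := ε' * min ε' 1 / 16 with hδdef
  have hδ : 0 < δ := by positivity
  have hδ1 : δ ≤ 1 := by
    rw [hδdef, min_eq_left hε'1]
    nlinarith
  refine ⟨δ / 8, by positivity, fun k hk C hC => ?_⟩
  set K : ℝ := ∑ a ∈ Finset.range (2 * k + 1), (Fintype.card (Fin a → Fin k × Fin 2) : ℝ) * C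
  have hK0 : 0 ≤ K := Finset.sum_nonneg fun a _ => by positivity
  -- The radius and moment constant `C + 1` covers the loss in the moment bound; the support and the
  -- range of the reference points only become larger.
  obtain ⟨K', hK'⟩ := exists_distinctRootSum_comparison hε'0 (show 0 < C + 1 by positivity) hδ hδ1
    (by rw [hδdef]; ring) hK0 k hk
  refine ⟨K', fun n hn μ ν hμ hν hμν hμC hνC Ω _ P _ Ω' _ P' _ ξ ξ' hξ hξ' z hz G hG hGs hGd => ?_⟩
  have := hμ.isProbabilityMeasure
  have := hν.isProbabilityMeasure
  have hn1 : (1 : ℝ) ≤ n := by exact_mod_cast hn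
  have hG' : ContDiff ℝ (⊤ : ℕ∞) fun x : Fin k → ℂ => G (x - z) :=
    hG.comp (contDiff_id.sub contDiff_const)
  have hsupp : ∀ x : Fin k → ℂ, G (x - z) ≠ 0 → x ∈ closedPolydisc z (C + 1) := fun x hx =>
    mem_closedPolydisc.2 fun j => by
      have := hGs _ hx j
      rw [Pi.sub_apply] at this
      linarith
  have hcomp : HasCompactSupport fun x : Fin k → ℂ => G (x - z) :=
    hasCompactSupport_of_subset_closedPolydisc hsupp
  have hderiv : ∀ a : ℕ, a ≤ 2 * k → ∀ x : Fin k → ℂ,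
      ‖iteratedFDeriv ℝ a (fun x : Fin k → ℂ => G (x - z)) x‖ ≤ K := by
    intro a ha x
    rw [iteratedFDeriv_comp_sub]
    refine (norm_iteratedFDeriv_le_gradNorm a G _).trans ?_
    refine (mul_le_mul_of_nonneg_left (hGd a (by omega) _) (by positivity)).trans ?_
    exact Finset.single_le_sum
      (f := fun a => (Fintype.card (Fin a → Fin k × Fin 2) : ℝ) * C)
      (fun _ _ => by positivity) (Finset.mem_range.2 (by omega))
  have hmain := hK' n hn μ ν hμ hν hμν
    (lintegral_rpow_le_add_one (by positivity) (by linarith) hC.le hμC)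
    (lintegral_rpow_le_add_one (by positivity) (by linarith) hC.le hνC) z
    (fun j => ⟨(Real.rpow_le_rpow_of_exponent_le hn1 hε'ε).trans (hz j).1, by
      linarith [(hz j).2]⟩) _ hG' hsupp hderiv
  rw [← integral_correlationMeasure_flatPolynomial hξ hG'.continuous hcomp,
    ← integral_correlationMeasure_flatPolynomial hξ' hG'.continuous hcomp] at hmain
  exact hmain
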